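/- **Conventions.** For $v\in\mathbb R^d\setminus\{0\}$ let $\mathcal D_v$ be the distribution on $[d]$ with density $\mathcal D_v(i)=v_i^2/\|v\|^2$, and $\|p,q\|_{TV}=\frac12\sum_i|p(i)-q(i)|$. Let $A\in\mathbb R^{m\times n}$ be nonzero with rank $k$ and condition number $\kappa=\sigma_{\max}/\sigma_{\min}$ (largest over smallest nonzero singular value). $A_{(i)}$ is the $i$-th row of $A$, $M^{(j)}$ the $j$-th column of $M$. **Subroutines** ($C>0$ is a constant). * $\mathrm{FKV}(A,k,\epsilon',\delta')$. Let $p=\lceil C(k/\epsilon')^4\log(2/\delta')\rceil$. Sample rows $i_1,\dots,i_p$ independently with probabilities $D(i)=\|A_{(i)}\|^2/\|A\|_F^2$; then sample columns $j_1,\dots,j_p$ independently from $F(j)=\frac1p\sum_r \mathcal D_{A_{(i_r)}}(j)$. Put $S_{rj}=A_{i_rj}/\sqrt{pD(i_r)}$ and $W_{rc}=S_{rj_c}/\sqrt{pF(j_c)}$. With left singular vectors $u_t$ and singular values $\sigma_1\ge\sigma_2\ge\dots$ of $W$, return the matrix in $\mathbb R^{n\times k}$ with columns $S^{T}u_t/\sigma_t$,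 $t\in[k]$ (a column is replaced by $0$ if $\sigma_t^2<\frac{\epsilon'}{8k}\|W\|_F^2$). * Estimation of $LAR\in\mathbb R^{k\times k}$ with error $\zeta$ and failure probability $\eta$: the $(a,b)$ entry is the median of $\lceil C\log(2/\eta')\rceil$ means, $\eta'=1-(1-\eta)^{1/k^2}$, of $\lceil C/\zeta^2\rceil$ independent copies each of $\|A\|_F^2L_{ai}R_{jb}/A_{ij}$, where $(i,j)$ is drawn with probability $A_{ij}^2/\|A\|_F^2$. * Rejection sampling for $\mathcal D_{Uy}$, $U\in\mathbb R^{m\times k}$, with failure probability $\gamma$: at most $\lceil Ck\log(2/\gamma)\rceil$ independent trials; in each, draw $j$ with probability proportional to $\|U^{(j)}y_j\|^2$, draw $l\sim\mathcal D_{U^{(j)}}$, and accept $l$ with probability $(Uy)_l^2/\bigl(k\sum_j(y_jU_{lj})^2\bigr)$. The first accepted $l$ is returned; the run fails if no trial accepts. **Algorithm.** Given $\delta\in(0,1)$, $s\in\mathbb N$ and $\epsilon_V,\epsilon_U,\zeta>0$, put $\delta_1=1-(1-\delta)^{1/4}$ and $\gamma=1-(1-\delta)^{1/(4s)}$. Compute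 $\hat V=\mathrm{FKV}(A,k,\epsilon_V,\delta_1)$, $\hat U=\mathrm{FKV}(A^T,k,\epsilon_U,\delta_1)$, and the estimate $\tilde M$ of $\hat U^TA\hat V$ with error $\zeta$ and failure probability $\delta_1$. For each $i\in[s]$ draw a uniform unit vector $x_i\in\mathbb R^k$, put $\tilde y_i=\tilde Mx_i$, and run rejection sampling for $\mathcal D_{\hat U\tilde y_i}$ with failure probability $\gamma$. All random choices are independent unless stated otherwise. Let $\mathcal O_i$ be the distribution of the index returned by the $i$-th run, given $\hat U,\tilde M,x_i$ and given that the run does not fail. **Statement.** There are absolute constants $c,C,c_1,c_2>0$ and a map $\hat V\mapsto V$ on real matrices ($V$ has the shape of $\hat V$ and depends on $\hat V$ only) such that the following holds for every such $A$, every $s$, every $\delta\in(0,1)$, every $\epsilon\in(0,1]$, every choice of the singular vectors in FKV, and all $\epsilon_V,\epsilon_U,\zeta>0$ with $$\epsilon_V\le c\min\Bigl\{\frac{\epsilon}{\sqrt k\,\kappa},\frac1{k\kappa^2}\Bigr\},\qquad \epsilon_U\le c\min\Bigl\{\frac{\epsilon}{k},\frac1{k\kappa^2}\Bigr\},\qquad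 \zeta\le \frac{c\,\epsilon}{k^2\kappa}.$$ With probability at least $1-\delta$ all of the following hold at once: 1. with $\alpha_V=\epsilon_Vk/16$, the columns of $V$ are orthonormal, span the column space of $\hat V$, which is the row space of $A$, and $\|V-\hat V\|_F\le\alpha_V/\sqrt2+c_1\alpha_V^2$, $\|VV^T-\hat V\hat V^T\|_F\le c_2\alpha_V$; 2. for every $i\in[s]$ the $i$-th rejection sampling run does not fail, and $$\|\mathcal O_i,\mathcal D_{AVx_i}\|_{TV}\le\epsilon .$$ -/

import Mathlib

open MeasureTheory Matrix

noncomputable section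

namespace FAS

/-! ### Norms, `ℓ₂`-sampling distributions, total variation, condition number -/

/-- Euclidean norm of a vector given by its coordinates. -/
def l2norm {ι : Type*} [Fintype ι] (v : ι → ℝ) : ℝ := ‖WithLp.toLp 2 v‖

/-- Frobenius norm. -/
def frob {ι κ : Type*} [Fintype ι] [Fintype κ] (A : Matrix ι κ ℝ) : ℝ :=
  Real.sqrt (∑ i, ∑ j, A i j ^ 2)

/-- Density of the `ℓ₂`-sampling distribution `D_v`, `D_v(i) = v_i² / ‖v‖²`. -/
def l2Density {ι : Type*} [Fintype ι] (v : ι → ℝ) (i : ι) : ℝ := v i ^ 2 / l2norm v ^ 2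

/-- Total variation distance of two densities on a finite set. -/
def tv {ι : Type*} [Fintype ι] (p q : ι → ℝ) : ℝ := (1 / 2) * ∑ i, |p i - q i|

/-- The law on a finite set with density `f`. -/
def lawOf {ι : Type*} [Fintype ι] [MeasurableSpace ι] (f : ι → ℝ) : Measure ι :=
  ∑ i, ENNReal.ofReal (f i) • Measure.dirac i

/-- The `t`-th largest singular value, `t = 0, 1, …` (zero for `t` beyond the rank). -/
def sv {m n : ℕ} (A : Matrix (Fin m) (Fin n) ℝ) (t : ℕ) : ℝ :=
  (Matrix.toEuclideanLin A).singularValues t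

/-- Condition number: largest over smallest nonzero singular value. -/
def condNumber {m n : ℕ} (A : Matrix (Fin m) (Fin n) ℝ) : ℝ := sv A 0 / sv A (A.rank - 1)

/-- The uniform distribution on the unit sphere of `ℝᵏ`. -/
def sphereUniform (k : ℕ) : Measure (Metric.sphere (0 : EuclideanSpace ℝ (Fin k)) 1) :=
  ((volume : Measure (EuclideanSpace ℝ (Fin k))).toSphere Set.univ)⁻¹ •
    (volume : Measure (EuclideanSpace ℝ (Fin k))).toSphere

/-! ### The Frieze–Kannan–Vempala algorithm -/

/-- Number of sampled rows (and of sampled columns). -/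
def fkvSize (C : ℝ) (k : ℕ) (ε δ : ℝ) : ℕ := ⌈C * (k / ε) ^ 4 * Real.log (2 / δ)⌉₊

/-- Row `i` is sampled with probability `‖A_(i)‖² / ‖A‖_F²`. -/
def rowDensity {m n : ℕ} (A : Matrix (Fin m) (Fin n) ℝ) : Fin m → ℝ :=
  l2Density fun i => l2norm (A i)

/-- Given sampled rows `i_1, …, i_p`, a column is sampled by choosing `r ∈ [p]` uniformly and then
a column from the `ℓ₂`-distribution of row `i_r`. -/
def colDensity {m n p : ℕ} (A : Matrix (Fin m) (Fin n) ℝ) (rows : Fin p → Fin m) (j : Fin n) : ℝ :=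
  (1 / (p : ℝ)) * ∑ r, l2Density (A (rows r)) j

/-- The joint law of the `p` sampled rows and the `p` sampled columns. -/
def fkvLaw {m n : ℕ} (A : Matrix (Fin m) (Fin n) ℝ) (p : ℕ) :
    Measure ((Fin p → Fin m) × (Fin p → Fin n)) :=
  (Measure.pi fun _ : Fin p => lawOf (rowDensity A)).bind fun rows =>
    (Measure.pi fun _ : Fin p => lawOf (colDensity A rows)).map (Prod.mk rows)

/-- The sampled rows, rescaled. -/
def fkvS {m n p : ℕ} (A : Matrix (Fin m) (Fin n) ℝ) (rows : Fin p → Fin m) :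
    Matrix (Fin p) (Fin n) ℝ :=
  fun r j => A (rows r) j / Real.sqrt (p * rowDensity A (rows r))

/-- The sampled columns of `fkvS`, rescaled. -/
def fkvW {m n p : ℕ} (A : Matrix (Fin m) (Fin n) ℝ) (ω : (Fin p → Fin m) × (Fin p → Fin n)) :
    Matrix (Fin p) (Fin p) ℝ :=
  fun r c => fkvS A ω.1 r (ω.2 c) / Real.sqrt (p * colDensity A ω.1 (ω.2 c))

/-- `u 0, u 1, …` is an orthonormal system of left singular vectors of `W`, ordered by
decreasing singular value. -/
def IsLeftSingularBasis {p : ℕ} (W : Matrix (Fin p) (Fin p) ℝ) (u : Fin p → Fin p → ℝ) : Prop :=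
  (∀ s t, u s ⬝ᵥ u t = if s = t then 1 else 0) ∧
    ∀ t : Fin p, (W * Wᵀ) *ᵥ u t = sv W t ^ 2 • u t

/-- The output `V̂` of FKV with target rank `k` and error parameter `ε`: its `t`-th column is
`Sᵀ u_t / σ_t` with `u_t`, `σ_t` the `t`-th left singular vector and singular value of `W`. Columns
with `σ_t²` below the threshold `ε ‖W‖_F² / (8 k)` are dropped, that is, set to zero. -/
def fkvOutput {m n p : ℕ} (A : Matrix (Fin m) (Fin n) ℝ) (k : ℕ) (ε : ℝ)
    (svd : ∀ p : ℕ, Matrix (Fin p) (Fin p) ℝ → Fin p → Fin p → ℝ)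
    (ω : (Fin p → Fin m) × (Fin p → Fin n)) : Matrix (Fin n) (Fin k) ℝ :=
  fun j t =>
    if h : (t : ℕ) < p then
      if ε / (8 * k) * frob (fkvW A ω) ^ 2 ≤ sv (fkvW A ω) t ^ 2 then
        ((fkvS A ω.1)ᵀ *ᵥ svd p (fkvW A ω) ⟨t, h⟩) j / sv (fkvW A ω) t
      else 0
    else 0

/-- `V` is an orthonormalization of the `α`-approximately orthonormal matrix `V̂`: its columns are
orthonormal, they span the same space as those of `V̂`, and `V`, `V Vᵀ` are close to `V̂`, `V̂ V̂ᵀ`. -/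
structure IsOrthonormalization {n k : ℕ} (c₁ c₂ α : ℝ) (Vhat V : Matrix (Fin n) (Fin k) ℝ) :
    Prop where
  orthonormal : Vᵀ * V = 1
  span_eq : Submodule.span ℝ (Set.range V.col) = Submodule.span ℝ (Set.range Vhat.col)
  close : frob (V - Vhat) ≤ α / Real.sqrt 2 + c₁ * α ^ 2
  proj_close : frob (V * Vᵀ - Vhat * Vhatᵀ) ≤ c₂ * α

/-! ### Estimating `L A R` entrywise by a median of means -/

/-- The (upper) median of finitely many reals. -/
def median {N : ℕ} (f : Fin N → ℝ) : ℝ :=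
  if h : 0 < N then f (Tuple.sort f ⟨N / 2, Nat.div_lt_self h one_lt_two⟩) else 0

/-- Number of samples in each mean. -/
def meanSize (C ζ : ℝ) : ℕ := ⌈C / ζ ^ 2⌉₊

/-- Number of means, for failure probability `η' = 1 - (1 - η)^(1/k²)` of each of the `k²` entries. -/
def medianSize (C : ℝ) (k : ℕ) (η : ℝ) : ℕ :=
  ⌈C * Real.log (2 / (1 - (1 - η) ^ (1 / (k : ℝ) ^ 2)))⌉₊

/-- Law of independent samples of positions `(i, j)`, each with probability `A_ij² / ‖A‖_F²`. -/
def entryLaw {m n : ℕ} (A : Matrix (Fin m) (Fin n) ℝ) (k G q : ℕ) :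
    Measure (Fin k × Fin k × Fin G × Fin q → Fin m × Fin n) :=
  Measure.pi fun _ => lawOf (l2Density fun ij : Fin m × Fin n => A ij.1 ij.2)

/-- The estimate `M̃` of `L A R`: entry `(a, b)` is the median of `G` means of `q` copies of the
unbiased estimator `‖A‖_F² L_ai R_jb / A_ij`, where `(i, j)` is a sampled position. -/
def estimate {m n k G q : ℕ} (A : Matrix (Fin m) (Fin n) ℝ)
    (L : Matrix (Fin k) (Fin m) ℝ) (R : Matrix (Fin n) (Fin k) ℝ)
    (ω : Fin k × Fin k × Fin G × Fin q → Fin m × Fin n) : Matrix (Fin k) (Fin k) ℝ :=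
  fun a b => median fun g : Fin G => (1 / (q : ℝ)) * ∑ l : Fin q,
    frob A ^ 2 * L a (ω (a, b, g, l)).1 * R (ω (a, b, g, l)).2 b /
      A (ω (a, b, g, l)).1 (ω (a, b, g, l)).2

/-! ### Rejection sampling from `D_{U y}` -/

/-- Acceptance probability of a proposed index. -/
def acceptProb {m k : ℕ} (U : Matrix (Fin m) (Fin k) ℝ) (y : Fin k → ℝ) (l : Fin m) : ℝ :=
  (U *ᵥ y) l ^ 2 / (k * ∑ j, (y j * U l j) ^ 2)

/-- One trial: `j` is sampled with probability proportional to `‖U^(j) y_j‖²`, then `l` from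
`D_{U^(j)}`, and then `l` is accepted (`true`) with probability `acceptProb U y l`. -/
def trialDensity {m k : ℕ} (U : Matrix (Fin m) (Fin k) ℝ) (y : Fin k → ℝ) :
    Fin k × Fin m × Bool → ℝ :=
  fun w => l2Density (fun j => l2norm (y j • U.col j)) w.1 * l2Density (U.col w.1) w.2.1 *
    if w.2.2 then acceptProb U y w.2.1 else 1 - acceptProb U y w.2.1

/-- Trials allowed in one run. -/
def trialCount (C : ℝ) (k : ℕ) (γ : ℝ) : ℕ := ⌈C * k * Real.log (2 / γ)⌉₊

/-- The law of the `T` independent trials of a run. -/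
def runLaw {m k : ℕ} (U : Matrix (Fin m) (Fin k) ℝ) (y : Fin k → ℝ) (T : ℕ) :
    Measure (Fin T → Fin k × Fin m × Bool) :=
  Measure.pi fun _ => lawOf (trialDensity U y)

/-- The output of a run: the first accepted index, or `none` if there is none (failure). -/
def runOutput {m k T : ℕ} (w : Fin T → Fin k × Fin m × Bool) : Option (Fin m) :=
  (List.ofFn w).findSome? fun t => if t.2.2 then some t.2.1 else none

/-- The distribution of the index that a run returns, given that it does not fail. -/
def outputDensity {m k : ℕ} (U : Matrix (Fin m) (Fin k) ℝ) (y : Fin k → ℝ) (T : ℕ) (l : Fin m) :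
    ℝ :=
  (runLaw U y T).real {w | runOutput w = some l} / (runLaw U y T).real {w | runOutput w ≠ none}

/-! ### The whole algorithm -/

/-- Parameters: target rank, number of projections, failure probability `δ`, error parameters of the
two FKV calls and of the estimation step, and the constant in the sample sizes. -/
structure Params where
  k : ℕ
  s : ℕ
  δ : ℝ
  εV : ℝ
  εU : ℝ
  ζ : ℝ
  C : ℝ

namespace Params

variable (P : Params)

/-- Failure probability of each FKV call and of the estimation step. -/
def δ₁ : ℝ := 1 - (1 - P.δ) ^ (1 / 4 : ℝ)

/-- Failure probability of each rejection sampling run. -/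
def γ : ℝ := 1 - (1 - P.δ) ^ (1 / (4 * (P.s : ℝ)))

def pV : ℕ := fkvSize P.C P.k P.εV P.δ₁

def pU : ℕ := fkvSize P.C P.k P.εU P.δ₁

def G : ℕ := medianSize P.C P.k P.δ₁

def q : ℕ := meanSize P.C P.ζ

def T : ℕ := trialCount P.C P.k P.γ

end Params

/-- The random choices made before rejection sampling: those of `FKV(A, k, εV, δ₁)`, of
`FKV(Aᵀ, k, εU, δ₁)`, of the estimation step, and the unit vectors `x_1, …, x_s`. -/
abbrev Choices (P : Params) (m n : ℕ) : Type :=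
  ((Fin P.pV → Fin m) × (Fin P.pV → Fin n)) × ((Fin P.pU → Fin n) × (Fin P.pU → Fin m)) ×
    (Fin P.k × Fin P.k × Fin P.G × Fin P.q → Fin m × Fin n) ×
    (Fin P.s → Metric.sphere (0 : EuclideanSpace ℝ (Fin P.k)) 1)

/-- Their joint law. -/
def choicesLaw {m n : ℕ} (P : Params) (A : Matrix (Fin m) (Fin n) ℝ) : Measure (Choices P m n) :=
  (fkvLaw A P.pV).prod <| (fkvLaw Aᵀ P.pU).prod <| (entryLaw A P.k P.G P.q).prod <|
    Measure.pi fun _ => sphereUniform P.k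

section

variable {m n : ℕ} (P : Params) (A : Matrix (Fin m) (Fin n) ℝ)
  (svd : ∀ p : ℕ, Matrix (Fin p) (Fin p) ℝ → Fin p → Fin p → ℝ) (ω : Choices P m n)

/-- The approximate right singular vectors. -/
def Vhat : Matrix (Fin n) (Fin P.k) ℝ := fkvOutput A P.k P.εV svd ω.1

/-- The approximate left singular vectors. -/
def Uhat : Matrix (Fin m) (Fin P.k) ℝ := fkvOutput Aᵀ P.k P.εU svd ω.2.1

/-- The estimate of `Ûᵀ A V̂`. -/
def Mtilde : Matrix (Fin P.k) (Fin P.k) ℝ :=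
  estimate A (Uhat P A svd ω)ᵀ (Vhat P A svd ω) ω.2.2.1

/-- The coordinates of the random unit vector `x_i`. -/
def xvec (i : Fin P.s) : Fin P.k → ℝ := fun t => (ω.2.2.2 i : EuclideanSpace ℝ (Fin P.k)) t

/-- `ỹ_i = M̃ x_i`. -/
def ytilde (i : Fin P.s) : Fin P.k → ℝ := Mtilde P A svd ω *ᵥ xvec P ω i

/-- The distribution `O_i` actually produced for the `i`-th projection. -/
def O (i : Fin P.s) : Fin m → ℝ := outputDensity (Uhat P A svd ω) (ytilde P A svd ω i) P.T

end

/-- The probability of an event of the whole algorithm: first the choices `ω` are made, then, given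
`ω`, the rejection sampling runs `ρ_1, …, ρ_s` are performed independently. -/
def prob {m n : ℕ} (P : Params) (A : Matrix (Fin m) (Fin n) ℝ)
    (svd : ∀ p : ℕ, Matrix (Fin p) (Fin p) ℝ → Fin p → Fin p → ℝ)
    (E : Choices P m n → (Fin P.s → Fin P.T → Fin P.k × Fin m × Bool) → Prop) : ENNReal :=
  ∫⁻ ω, (Measure.pi fun i => runLaw (Uhat P A svd ω) (ytilde P A svd ω i) P.T) {ρ | E ω ρ}
    ∂choicesLaw P A

end FAS

end

/-!
The algorithm succeeds because each of its random parts does, with probability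
`r = (1 - δ) ^ (1 / 4)`, and because success of all parts forces the claimed bounds.

**Sketches.** Sampling rows with probability proportional to their squared length makes the rescaled
sample `S` satisfy `‖AᵀA - SᵀS‖_F ≤ θ ‖A‖_F²` with `θ = (ε' / k)²`, up to the allowed failure
probability. This is a dimension-free tail bound for sums of independent bounded vectors
(`measure_norm_sum_ge_le`): the exponential moment of the norm is controlled by peeling off one step
at a time with Hoeffding's lemma, and the mean of the norm by orthogonality of centred independent
steps. The mixture from which FKV samples columns is exactly the length-squared distribution of the
columns of `S` (`colDensity_eq_rowDensity`), so the same bound gives `‖SSᵀ - WWᵀ‖_F ≤ θ ‖A‖_F²`.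

**Perturbation.** Let `σ` be the smallest nonzero singular value of `A` and `e = ε'² κ² σ² / k`, a
bound for `θ ‖A‖_F²`. A Courant–Fischer argument shows that the `k` leading singular values `σ_t` of
`W` are at least `3 σ / 4`, hence no column of `V̂` is dropped. With `E = SSᵀ - WWᵀ` one has
`(V̂ᵀV̂ - 1)_st = u_sᵀ E u_t / (σ_s σ_t)`, so `V̂` is nearly orthonormal, and its polar factor `V`
(`exists_orthonormal_close`) is as close to it as `V̂ᵀV̂` is to `1`. The columns of `V̂` lie in the
row space of `A` and are linearly independent, so they span it. The error of `Û Ûᵀ` as a projection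
has to be small relative to `σ` even after multiplication by `A`, where a bound by `‖A‖` times
`‖ÛᵀÛ - 1‖` would be too weak. It is small since the entries of `ÛᵀÛ - 1` carry the factor `1 / σ_t`
while `‖Aᵀ û_t‖ ≤ 3 σ_t` (`IsSketch.l2norm_proj_sub_le`).

**Estimation.** Each entry of `M̃` is a median of means: Chebyshev's inequality makes a mean bad with
probability at most `1 / 16`, and a bad median needs half of the means to be bad, which has
probability at most `2⁻ᴳ`. The entries use disjoint blocks of samples, so their success probabilities
multiply; for `δ` close to `1` a union bound would not suffice.

**Rejection sampling.** In one trial an index `l` is accepted with probability proportional to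
`(U y)_l²`, so a run that does not fail outputs a sample of `D_{Uy}` exactly
(`outputDensity_eq`), and for nearly orthonormal `U` a trial accepts with probability at least
`1 / (2 k)`. It remains to compare `Û M̃ x` with `A V x`: the difference is at most `ε σ / 2`
(`l2norm_projection_error_le`) while `‖A V x‖ ≥ σ`, and the total variation distance of `D_u` and
`D_v` is at most `2 ‖u - v‖ / ‖v‖`.
-/

namespace FAS

/-! ### Euclidean and Frobenius norms -/

section Norms

lemma col_mul {ι κ τ : Type*} [Fintype κ] (M : Matrix ι κ ℝ) (N : Matrix κ τ ℝ) (j : τ) :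
    (M * N).col j = M *ᵥ N.col j := rfl

variable {ι κ τ : Type*} [Fintype ι] [Fintype κ] [Fintype τ]

lemma l2norm_nonneg (v : ι → ℝ) : 0 ≤ l2norm v := norm_nonneg _

lemma l2norm_sq (v : ι → ℝ) : l2norm v ^ 2 = ∑ i, v i ^ 2 := by
  simp [l2norm, EuclideanSpace.norm_sq_eq]

lemma dotProduct_self_eq_l2norm_sq (v : ι → ℝ) : v ⬝ᵥ v = l2norm v ^ 2 := by
  rw [l2norm_sq, dotProduct]
  exact Finset.sum_congr rfl fun i _ => (sq _).symm

lemma l2norm_add_le (v w : ι → ℝ) : l2norm (v + w) ≤ l2norm v + l2norm w := by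
  simpa [l2norm] using norm_add_le (WithLp.toLp 2 v) (WithLp.toLp 2 w)

lemma l2norm_sub_rev (v w : ι → ℝ) : l2norm (v - w) = l2norm (w - v) := by
  simpa [l2norm] using norm_sub_rev (WithLp.toLp 2 v) (WithLp.toLp 2 w)

lemma l2norm_sub_le (v w : ι → ℝ) : l2norm v - l2norm w ≤ l2norm (v - w) := by
  simpa [l2norm] using norm_sub_norm_le (WithLp.toLp 2 v) (WithLp.toLp 2 w)

lemma l2norm_smul (c : ℝ) (v : ι → ℝ) : l2norm (c • v) = |c| * l2norm v := by
  simp [l2norm, norm_smul]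

lemma l2norm_eq_zero {v : ι → ℝ} : l2norm v = 0 ↔ v = 0 := by
  simp [l2norm]

@[simp]
lemma l2norm_zero : l2norm (0 : ι → ℝ) = 0 := l2norm_eq_zero.2 rfl

lemma l2norm_pos {v : ι → ℝ} (h : v ≠ 0) : 0 < l2norm v :=
  (l2norm_nonneg v).lt_of_ne fun h' => h (l2norm_eq_zero.1 h'.symm)

lemma abs_dotProduct_le (v w : ι → ℝ) : |v ⬝ᵥ w| ≤ l2norm v * l2norm w := by
  have := abs_real_inner_le_norm (WithLp.toLp 2 w) (WithLp.toLp 2 v)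
  rw [EuclideanSpace.inner_toLp_toLp, star_trivial] at this
  rwa [mul_comm (l2norm v)]

lemma l2norm_le_of_sq_le {v : ι → ℝ} {b : ℝ} (hb : 0 ≤ b) (h : l2norm v ^ 2 ≤ b ^ 2) :
    l2norm v ≤ b := (sq_le_sq₀ (l2norm_nonneg v) hb).1 h

lemma frob_nonneg (M : Matrix ι κ ℝ) : 0 ≤ frob M := Real.sqrt_nonneg _

lemma frob_sq (M : Matrix ι κ ℝ) : frob M ^ 2 = ∑ i, ∑ j, M i j ^ 2 :=
  Real.sq_sqrt (Finset.sum_nonneg fun _ _ => Finset.sum_nonneg fun _ _ => sq_nonneg _)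

lemma frob_eq_l2norm (M : Matrix ι κ ℝ) : frob M = l2norm fun p : ι × κ => M p.1 p.2 := by
  rw [← sq_eq_sq₀ (frob_nonneg M) (l2norm_nonneg _), frob_sq, l2norm_sq, Fintype.sum_prod_type]

lemma frob_sq_eq_sum_row (M : Matrix ι κ ℝ) : frob M ^ 2 = ∑ i, l2norm (M i) ^ 2 := by
  simp [frob_sq, l2norm_sq]

lemma frob_transpose (M : Matrix ι κ ℝ) : frob Mᵀ = frob M := by
  rw [← sq_eq_sq₀ (frob_nonneg _) (frob_nonneg _), frob_sq, frob_sq, Finset.sum_comm]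
  rfl

lemma frob_sq_eq_sum_col (M : Matrix ι κ ℝ) : frob M ^ 2 = ∑ j, l2norm (M.col j) ^ 2 := by
  rw [← frob_transpose, frob_sq_eq_sum_row]
  rfl

lemma frob_add_le (M N : Matrix ι κ ℝ) : frob (M + N) ≤ frob M + frob N := by
  simp only [frob_eq_l2norm]
  exact l2norm_add_le _ _

lemma frob_sub_rev (M N : Matrix ι κ ℝ) : frob (M - N) = frob (N - M) := by
  simp only [frob_eq_l2norm]
  exact l2norm_sub_rev (fun p : ι × κ => M p.1 p.2) (fun p : ι × κ => N p.1 p.2)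

lemma frob_le_of_sq_le {M : Matrix ι κ ℝ} {b : ℝ} (hb : 0 ≤ b) (h : frob M ^ 2 ≤ b ^ 2) :
    frob M ≤ b := (sq_le_sq₀ (frob_nonneg M) hb).1 h

lemma frob_pos {M : Matrix ι κ ℝ} (h : M ≠ 0) : 0 < frob M := by
  refine (frob_nonneg M).lt_of_ne fun h0 => h ?_
  rw [frob_eq_l2norm] at h0
  have := l2norm_eq_zero.1 h0.symm
  ext i j
  exact congrFun this (i, j)

/-- The Frobenius norm dominates the operator norm. -/
lemma l2norm_mulVec_le (M : Matrix ι κ ℝ) (v : κ → ℝ) : l2norm (M *ᵥ v) ≤ frob M * l2norm v := by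
  refine l2norm_le_of_sq_le (mul_nonneg (frob_nonneg _) (l2norm_nonneg _)) ?_
  rw [l2norm_sq, mul_pow, frob_sq_eq_sum_row, Finset.sum_mul]
  refine Finset.sum_le_sum fun i _ => ?_
  rw [← mul_pow, ← sq_abs]
  exact pow_le_pow_left₀ (abs_nonneg _) (abs_dotProduct_le _ _) 2

/-- The Frobenius norm of `M N` is at most the operator norm of `M` times that of `N`. -/
lemma frob_mul_le_of_bound {M : Matrix ι κ ℝ} (N : Matrix κ τ ℝ) {b : ℝ} (hb : 0 ≤ b)
    (hM : ∀ v, l2norm (M *ᵥ v) ≤ b * l2norm v) : frob (M * N) ≤ b * frob N := by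
  refine frob_le_of_sq_le (mul_nonneg hb (frob_nonneg _)) ?_
  rw [mul_pow, frob_sq_eq_sum_col, frob_sq_eq_sum_col, Finset.mul_sum]
  refine Finset.sum_le_sum fun j _ => ?_
  rw [col_mul, ← mul_pow]
  exact pow_le_pow_left₀ (l2norm_nonneg _) (hM _) 2

lemma dotProduct_mulVec_eq (M : Matrix ι κ ℝ) (v : ι → ℝ) (w : κ → ℝ) :
    v ⬝ᵥ M *ᵥ w = Mᵀ *ᵥ v ⬝ᵥ w := by
  rw [dotProduct_mulVec, mulVec_transpose]

lemma l2norm_mulVec_sq (M : Matrix ι κ ℝ) (v : κ → ℝ) :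
    l2norm (M *ᵥ v) ^ 2 = v ⬝ᵥ (Mᵀ * M) *ᵥ v := by
  rw [← dotProduct_self_eq_l2norm_sq, dotProduct_mulVec_eq, mulVec_mulVec, dotProduct_comm]

lemma l2norm_mulVec_of_orthonormal [DecidableEq κ] {V : Matrix ι κ ℝ} (hV : Vᵀ * V = 1)
    (v : κ → ℝ) : l2norm (V *ᵥ v) = l2norm v := by
  rw [← sq_eq_sq₀ (l2norm_nonneg _) (l2norm_nonneg _), l2norm_mulVec_sq, hV, one_mulVec,
    dotProduct_self_eq_l2norm_sq]

lemma abs_dotProduct_mulVec_le (M : Matrix ι κ ℝ) (v : ι → ℝ) (w : κ → ℝ) :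
    |v ⬝ᵥ M *ᵥ w| ≤ frob M * (l2norm v * l2norm w) := by
  refine (abs_dotProduct_le _ _).trans ?_
  calc l2norm v * l2norm (M *ᵥ w) ≤ l2norm v * (frob M * l2norm w) :=
        mul_le_mul_of_nonneg_left (l2norm_mulVec_le _ _) (l2norm_nonneg _)
    _ = _ := by ring

lemma l2norm_le_of_abs_le {v : ι → ℝ} {b : ℝ} (hb : 0 ≤ b) (h : ∀ i, |v i| ≤ b) :
    l2norm v ≤ √(Fintype.card ι) * b := by
  refine l2norm_le_of_sq_le (by positivity) ?_
  rw [l2norm_sq, mul_pow, Real.sq_sqrt (Nat.cast_nonneg _), ← nsmul_eq_mul]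
  refine Finset.sum_le_card_nsmul _ _ _ fun i _ => ?_
  rw [← sq_abs]
  exact pow_le_pow_left₀ (abs_nonneg _) (h i) 2

lemma frob_le_of_abs_le {M : Matrix ι ι ℝ} {b : ℝ} (hb : 0 ≤ b) (h : ∀ i j, |M i j| ≤ b) :
    frob M ≤ Fintype.card ι * b := by
  rw [frob_eq_l2norm]
  refine (l2norm_le_of_abs_le hb fun p : ι × ι => h p.1 p.2).trans_eq ?_
  rw [Fintype.card_prod, Nat.cast_mul, Real.sqrt_mul_self (Nat.cast_nonneg _)]

end Norms

/-! ### Orthonormalizing a nearly orthonormal matrix -/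

lemma l2norm_le_of_gram_close {ι κ : Type*} [Fintype ι] [Fintype κ] [DecidableEq κ]
    (M : Matrix ι κ ℝ) (v : κ → ℝ) :
    (1 - frob (Mᵀ * M - 1)) * l2norm v ^ 2 ≤ l2norm (M *ᵥ v) ^ 2 ∧
      l2norm (M *ᵥ v) ^ 2 ≤ (1 + frob (Mᵀ * M - 1)) * l2norm v ^ 2 := by
  have h := abs_dotProduct_mulVec_le (Mᵀ * M - 1) v v
  rw [sub_mulVec, dotProduct_sub, ← l2norm_mulVec_sq, one_mulVec, dotProduct_self_eq_l2norm_sq,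
    ← sq, abs_le] at h
  constructor <;> linarith [h.1, h.2]

open scoped MatrixOrder in
/-- The polar decomposition `V̂ = V H`, `H = (V̂ᵀ V̂)^(1/2)`, yields an orthonormalization with
`‖V - V̂‖_F = ‖1 - H‖_F ≤ ‖1 - H ^ 2‖_F`. -/
lemma exists_orthonormal_close {ι κ : Type*} [Fintype ι] [Fintype κ] [DecidableEq κ]
    (M : Matrix ι κ ℝ) (hM : frob (Mᵀ * M - 1) < 1) :
    ∃ V : Matrix ι κ ℝ, Vᵀ * V = 1 ∧
      Submodule.span ℝ (Set.range V.col) = Submodule.span ℝ (Set.range M.col) ∧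
      frob (V - M) ≤ frob (Mᵀ * M - 1) := by
  have hB : (Mᵀ * M).PosSemidef := by
    simpa using posSemidef_conjTranspose_mul_self M
  set H : Matrix κ κ ℝ := CFC.sqrt (Mᵀ * M) with hH
  have hHH : H * H = Mᵀ * M := CFC.sqrt_mul_sqrt_self _ hB.nonneg
  have hHpos : H.PosSemidef := (CFC.sqrt_nonneg (Mᵀ * M)).posSemidef
  have hHt : Hᵀ = H := by simpa using hHpos.isHermitian.eq
  have hunit : IsUnit H := by
    rw [← Matrix.mulVec_injective_iff_isUnit]
    refine (injective_iff_map_eq_zero H.mulVecLin).2 fun v hv => ?_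
    have hv' : H *ᵥ v = 0 := hv
    have h1 : l2norm (M *ᵥ v) ^ 2 = 0 := by
      rw [l2norm_mulVec_sq, ← hHH, ← mulVec_mulVec, hv', mulVec_zero, dotProduct_zero]
    have h2 := (l2norm_le_of_gram_close M v).1
    rw [h1] at h2
    by_contra hne
    have := l2norm_pos hne
    have h3 : 0 < (1 - frob (Mᵀ * M - 1)) * l2norm v ^ 2 :=
      mul_pos (by linarith) (by positivity)
    linarith
  have hdet : IsUnit H.det := (Matrix.isUnit_iff_isUnit_det H).1 hunit
  have hVH : M * H⁻¹ * H = M := by rw [Matrix.mul_assoc, Matrix.nonsing_inv_mul _ hdet, Matrix.mul_one]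
  have hV : (M * H⁻¹)ᵀ * (M * H⁻¹) = 1 := by
    rw [transpose_mul, transpose_nonsing_inv, hHt, Matrix.mul_assoc, ← Matrix.mul_assoc Mᵀ, ← hHH,
      Matrix.mul_assoc, Matrix.mul_nonsing_inv _ hdet, Matrix.mul_one,
      Matrix.nonsing_inv_mul _ hdet]
  refine ⟨M * H⁻¹, hV, ?_, ?_⟩
  · rw [← Matrix.range_mulVecLin, ← Matrix.range_mulVecLin]
    apply le_antisymm
    · rw [Matrix.mulVecLin_mul]
      exact LinearMap.range_comp_le_range _ _
    · conv_lhs => rw [← hVH, Matrix.mulVecLin_mul]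
      exact LinearMap.range_comp_le_range _ _
  · have h1 : M * H⁻¹ - M = M * H⁻¹ * (1 - H) := by rw [Matrix.mul_sub, hVH, Matrix.mul_one]
    have h2 : (1 + H) * (1 - H) = 1 - Mᵀ * M := by rw [← hHH]; noncomm_ring
    rw [h1, ← frob_sub_rev, ← h2]
    refine (frob_mul_le_of_bound _ zero_le_one fun v => ?_).trans (one_mul _).le |>.trans ?_
    · rw [l2norm_mulVec_of_orthonormal hV, one_mul]
    · refine frob_le_of_sq_le (frob_nonneg _) ?_
      rw [frob_sq_eq_sum_col, frob_sq_eq_sum_col]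
      refine Finset.sum_le_sum fun j _ => ?_
      rw [col_mul]
      generalize (1 - H).col j = z
      -- `‖(1 + H) z‖² = ‖z‖² + 2 zᵀ H z + ‖H z‖²`
      have h3 : 0 ≤ z ⬝ᵥ H *ᵥ z := by simpa using hHpos.dotProduct_mulVec_nonneg z
      have h4 : 0 ≤ (H *ᵥ z) ⬝ᵥ (H *ᵥ z) := by
        rw [dotProduct_self_eq_l2norm_sq]; positivity
      have h5 : (H *ᵥ z) ⬝ᵥ z = z ⬝ᵥ H *ᵥ z := dotProduct_comm _ _
      rw [← dotProduct_self_eq_l2norm_sq, ← dotProduct_self_eq_l2norm_sq, add_mulVec, one_mulVec,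
        add_dotProduct, dotProduct_add, dotProduct_add, h5]
      linarith

open Classical in
/-- An orthonormal matrix with the column space of `M` and at Frobenius distance at most
`‖Mᵀ M - 1‖_F` from `M` if there is one, and `0` otherwise. -/
noncomputable def orthonormalize (n k : ℕ) (M : Matrix (Fin n) (Fin k) ℝ) :
    Matrix (Fin n) (Fin k) ℝ :=
  if h : ∃ V : Matrix (Fin n) (Fin k) ℝ, Vᵀ * V = 1 ∧
      Submodule.span ℝ (Set.range V.col) = Submodule.span ℝ (Set.range M.col) ∧
      frob (V - M) ≤ frob (Mᵀ * M - 1) then h.choose else 0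

lemma orthonormalize_spec {n k : ℕ} {M : Matrix (Fin n) (Fin k) ℝ} (hM : frob (Mᵀ * M - 1) < 1) :
    (orthonormalize n k M)ᵀ * orthonormalize n k M = 1 ∧
      Submodule.span ℝ (Set.range (orthonormalize n k M).col) =
        Submodule.span ℝ (Set.range M.col) ∧
      frob (orthonormalize n k M - M) ≤ frob (Mᵀ * M - 1) := by
  have h := exists_orthonormal_close M hM
  rw [orthonormalize, dif_pos h]
  exact h.choose_spec

/-- The projections onto the column spaces are as close as the matrices, up to a constant. -/
lemma frob_proj_sub_le {ι κ : Type*} [Fintype ι] [Fintype κ] [DecidableEq κ]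
    {V M : Matrix ι κ ℝ} (hV : Vᵀ * V = 1) {b : ℝ} (hb : frob (V - M) ≤ b) (hb1 : b ≤ 1) :
    frob (V * Vᵀ - M * Mᵀ) ≤ 3 * b := by
  have hb0 : 0 ≤ b := (frob_nonneg _).trans hb
  have h1 : V * Vᵀ - M * Mᵀ = V * (V - M)ᵀ + (M * (V - M)ᵀ)ᵀ := by
    rw [transpose_mul, transpose_transpose, transpose_sub, Matrix.mul_sub, Matrix.sub_mul]
    abel
  have hMb : ∀ v, l2norm (M *ᵥ v) ≤ 2 * l2norm v := fun v => by
    have h2 := l2norm_sub_le (M *ᵥ v) (V *ᵥ v)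
    rw [l2norm_sub_rev, ← sub_mulVec, l2norm_mulVec_of_orthonormal hV] at h2
    have h3 := (l2norm_mulVec_le (V - M) v).trans
      (mul_le_mul_of_nonneg_right (hb.trans hb1) (l2norm_nonneg v))
    linarith
  rw [h1]
  refine (frob_add_le _ _).trans ?_
  rw [frob_transpose]
  have h4 := frob_mul_le_of_bound (V - M)ᵀ zero_le_one fun v => by
    rw [l2norm_mulVec_of_orthonormal hV v, one_mul]
  have h5 := frob_mul_le_of_bound (V - M)ᵀ zero_le_two hMb
  rw [frob_transpose] at h4 h5
  linarith

/-! ### Singular values and the condition number -/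

section SingularValues

variable {m n : ℕ} (A : Matrix (Fin m) (Fin n) ℝ)

lemma sv_nonneg (t : ℕ) : 0 ≤ sv A t := LinearMap.singularValues_nonneg _ _

lemma sv_antitone : Antitone (sv A) := LinearMap.singularValues_antitone _

lemma sv_pos_iff {t : ℕ} : 0 < sv A t ↔ t < A.rank := by
  rw [sv, LinearMap.singularValues_pos_iff_lt_finrank_range, Matrix.rank_eq_finrank_range_toLin A
    (EuclideanSpace.basisFun (Fin m) ℝ).toBasis (EuclideanSpace.basisFun (Fin n) ℝ).toBasis,
    Matrix.toEuclideanLin_eq_toLin_orthonormal]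

/-- In a basis of right singular vectors, `‖A v‖²` is a weighted sum of squared coordinates. -/
lemma exists_right_singular_basis :
    ∃ b : OrthonormalBasis (Fin n) ℝ (EuclideanSpace ℝ (Fin n)),
      ∀ v : Fin n → ℝ, l2norm (A *ᵥ v) ^ 2 =
        ∑ i : Fin n, sv A i ^ 2 * inner ℝ (b i) (WithLp.toLp 2 v) ^ 2 := by
  have hn : Module.finrank ℝ (EuclideanSpace ℝ (Fin n)) = n := finrank_euclideanSpace_fin
  set T := Matrix.toEuclideanLin A with hT
  refine ⟨T.isSymmetric_adjoint_comp_self.eigenvectorBasis hn, fun v => ?_⟩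
  set b := T.isSymmetric_adjoint_comp_self.eigenvectorBasis hn with hb
  set x : EuclideanSpace ℝ (Fin n) := WithLp.toLp 2 v with hx
  have h1 : l2norm (A *ᵥ v) ^ 2 = inner ℝ x ((LinearMap.adjoint T ∘ₗ T) x) := by
    rw [LinearMap.comp_apply, LinearMap.adjoint_inner_right, real_inner_self_eq_norm_sq]
    rfl
  rw [h1, ← b.sum_inner_mul_inner]
  refine Finset.sum_congr rfl fun i _ => ?_
  have h2 : inner ℝ (b i) ((LinearMap.adjoint T ∘ₗ T) x) = sv A i ^ 2 * inner ℝ (b i) x := by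
    rw [← T.isSymmetric_adjoint_comp_self (b i) x, hb,
      LinearMap.IsSymmetric.apply_eigenvectorBasis, real_inner_smul_left, sv,
      LinearMap.sq_singularValues_fin _ hn]
    rfl
  rw [h2, real_inner_comm]
  ring

lemma frob_sq_eq_sum_sv : frob A ^ 2 = ∑ i : Fin n, sv A i ^ 2 := by
  obtain ⟨b, hb⟩ := exists_right_singular_basis A
  have h1 : ∀ j : Fin n, l2norm (A.col j) ^ 2 =
      ∑ i : Fin n, sv A i ^ 2 * (b i) j ^ 2 := fun j => by
    rw [← Matrix.mulVec_single_one, hb]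
    refine Finset.sum_congr rfl fun i _ => ?_
    congr 2
    rw [PiLp.inner_apply, Finset.sum_eq_single j] <;> simp +contextual
  rw [frob_sq_eq_sum_col, Finset.sum_congr rfl fun j _ => h1 j, Finset.sum_comm]
  refine Finset.sum_congr rfl fun i _ => ?_
  rw [← Finset.mul_sum, ← EuclideanSpace.real_norm_sq_eq, b.norm_eq_one, one_pow, mul_one]

variable {A} {k : ℕ}

lemma frob_le_sqrt_mul_sv (hk : A.rank = k) : frob A ≤ √k * sv A 0 := by
  refine frob_le_of_sq_le (mul_nonneg (Real.sqrt_nonneg _) (sv_nonneg _ _)) ?_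
  rw [frob_sq_eq_sum_sv, mul_pow, Real.sq_sqrt (Nat.cast_nonneg _)]
  have h1 : ∀ i : Fin n, sv A i ^ 2 ≤ if (i : ℕ) < k then sv A 0 ^ 2 else 0 := fun i => by
    split_ifs with hi
    · exact pow_le_pow_left₀ (sv_nonneg _ _) (sv_antitone A (Nat.zero_le _)) 2
    · have : ¬ 0 < sv A i := fun h => hi (hk ▸ (sv_pos_iff A).1 h)
      rw [le_antisymm (not_lt.1 this) (sv_nonneg _ _)]
      norm_num
  refine (Finset.sum_le_sum fun i _ => h1 i).trans ?_
  rw [Fin.sum_univ_eq_sum_range (fun i => if i < k then sv A 0 ^ 2 else 0) n, ← Finset.sum_filter,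
    Finset.sum_const, nsmul_eq_mul]
  refine mul_le_mul_of_nonneg_right ?_ (sq_nonneg _)
  refine Nat.cast_le.2 ((Finset.card_le_card fun i hi => ?_).trans_eq (Finset.card_range k))
  simp only [Finset.mem_filter] at hi
  exact Finset.mem_range.2 hi.2

/-- `A` stretches vectors of its row space at least by its smallest nonzero singular value. -/
lemma sv_mul_le_of_mem_rowSpace (hk : A.rank = k) {x : Fin n → ℝ}
    (hx : x ∈ Submodule.span ℝ (Set.range A.row)) :
    sv A (k - 1) * l2norm x ≤ l2norm (A *ᵥ x) := by
  obtain ⟨b, hb⟩ := exists_right_singular_basis A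
  rw [← sq_le_sq₀ (mul_nonneg (sv_nonneg _ _) (l2norm_nonneg _)) (l2norm_nonneg _), hb, mul_pow]
  have h0 : l2norm x ^ 2 = ∑ i, inner ℝ (b i) (WithLp.toLp 2 x) ^ 2 := by
    rw [l2norm, ← b.sum_sq_norm_inner_right]
    simp
  rw [h0, Finset.mul_sum]
  refine Finset.sum_le_sum fun i _ => ?_
  by_cases hi : (i : ℕ) < k
  · exact mul_le_mul_of_nonneg_right
      (pow_le_pow_left₀ (sv_nonneg _ _) (sv_antitone A (by omega)) 2) (sq_nonneg _)
  · -- a right singular vector of singular value zero is orthogonal to the rows of `A`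
    have h1 : sv A i = 0 :=
      le_antisymm (not_lt.1 fun h => hi (hk ▸ (sv_pos_iff A).1 h)) (sv_nonneg _ _)
    have h2 : A *ᵥ (b i).ofLp = 0 := by
      rw [← l2norm_eq_zero, ← sq_eq_zero_iff, hb]
      refine Finset.sum_eq_zero fun j _ => ?_
      by_cases hj : j = i
      · rw [hj, h1]; ring
      · have : inner ℝ (b j) (WithLp.toLp 2 (b i).ofLp) = (0 : ℝ) :=
          b.orthonormal.inner_eq_zero hj
        rw [this]; ring
    have h3 : x ⬝ᵥ (b i).ofLp = 0 := by
      refine Submodule.span_induction (p := fun y _ => y ⬝ᵥ (b i).ofLp = 0) ?_ ?_ ?_ ?_ hx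
      · rintro _ ⟨r, rfl⟩
        exact congrFun h2 r
      · exact zero_dotProduct _
      · intro y z _ _ hy hz
        rw [add_dotProduct, hy, hz, add_zero]
      · intro a y _ hy
        rw [smul_dotProduct, hy, smul_zero]
    have h4 : inner ℝ (b i) (WithLp.toLp 2 x) = (0 : ℝ) := by
      rw [← h3]
      exact EuclideanSpace.inner_eq_star_dotProduct _ _
    rw [h4, h1]
    norm_num

lemma condNumber_facts (hA : A ≠ 0) (hk : A.rank = k) :
    0 < k ∧ 0 < sv A (k - 1) ∧ 1 ≤ condNumber A ∧
      frob A ≤ √k * condNumber A * sv A (k - 1) := by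
  have hk0 : 0 < k := by
    refine Nat.pos_of_ne_zero fun h => (frob_pos hA).not_ge ?_
    simpa [h] using frob_le_sqrt_mul_sv hk
  have hpos : 0 < sv A (k - 1) := (sv_pos_iff A).2 (by omega)
  refine ⟨hk0, hpos, ?_, ?_⟩
  · rw [condNumber, hk, one_le_div hpos]
    exact sv_antitone A (Nat.zero_le _)
  · rw [condNumber, hk, mul_assoc, div_mul_cancel₀ _ hpos.ne']
    exact frob_le_sqrt_mul_sv hk

/-- The transpose inherits the lower bound on the row space: every `z` in the column space is
`A x` with `x` in the row space. -/
lemma le_transpose_mulVec_of_mem_colSpace {σ : ℝ} (hσ : 0 ≤ σ)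
    (hA : ∀ x ∈ Submodule.span ℝ (Set.range A.row), σ * l2norm x ≤ l2norm (A *ᵥ x))
    {z : Fin m → ℝ} (hz : z ∈ Submodule.span ℝ (Set.range Aᵀ.row)) :
    σ * l2norm z ≤ l2norm (Aᵀ *ᵥ z) := by
  have h1 : LinearMap.range (A * Aᵀ).mulVecLin = LinearMap.range A.mulVecLin := by
    refine Submodule.eq_of_le_of_finrank_eq ?_ (Matrix.rank_self_mul_transpose A)
    rw [Matrix.mulVecLin_mul]
    exact LinearMap.range_comp_le_range _ _
  have h2 : z ∈ LinearMap.range A.mulVecLin := by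
    rw [Matrix.range_mulVecLin]
    exact hz
  rw [← h1] at h2
  obtain ⟨y, hy⟩ := h2
  set x := Aᵀ *ᵥ y with hx
  have hzx : z = A *ᵥ x := by
    rw [hx, mulVec_mulVec]
    exact hy.symm
  have hxm : x ∈ Submodule.span ℝ (Set.range A.row) := by
    have : x ∈ LinearMap.range Aᵀ.mulVecLin := ⟨y, rfl⟩
    rw [Matrix.range_mulVecLin] at this
    exact this
  by_cases h0 : l2norm z = 0
  · rw [h0, mul_zero]
    exact l2norm_nonneg _
  have hz0 := (l2norm_nonneg z).lt_of_ne' h0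
  have h3 : l2norm z ^ 2 ≤ l2norm (Aᵀ *ᵥ z) * l2norm x := by
    rw [← dotProduct_self_eq_l2norm_sq]
    conv_lhs => rw [hzx, dotProduct_mulVec_eq, ← hzx]
    exact (le_abs_self _).trans (abs_dotProduct_le _ _)
  have h4 := mul_le_mul_of_nonneg_left (hA x hxm) (l2norm_nonneg (Aᵀ *ᵥ z))
  rw [← hzx] at h4
  refine le_of_mul_le_mul_right ?_ hz0
  nlinarith

end SingularValues

/-! ### Left singular bases -/

section LeftSingular

variable {p : ℕ} {W : Matrix (Fin p) (Fin p) ℝ} {u : Fin p → Fin p → ℝ}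

lemma IsLeftSingularBasis.l2norm_eq_one (hu : IsLeftSingularBasis W u) (t : Fin p) :
    l2norm (u t) = 1 := by
  have := hu.1 t t
  rw [if_pos rfl, dotProduct_self_eq_l2norm_sq] at this
  exact (pow_eq_one_iff_of_nonneg (l2norm_nonneg _) two_ne_zero).1 this

lemma IsLeftSingularBasis.dotProduct_eq_sum (hu : IsLeftSingularBasis W u) (x y : Fin p → ℝ) :
    x ⬝ᵥ y = ∑ t, (u t ⬝ᵥ x) * (u t ⬝ᵥ y) := by
  have h1 : Matrix.of u * (Matrix.of u)ᵀ = 1 := by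
    ext s t
    rw [Matrix.one_apply, ← hu.1 s t]
    rfl
  have h2 : (Matrix.of u)ᵀ * Matrix.of u = 1 := mul_eq_one_comm.1 h1
  have h3 : x ⬝ᵥ y = (Matrix.of u *ᵥ x) ⬝ᵥ (Matrix.of u *ᵥ y) := by
    rw [dotProduct_mulVec_eq, mulVec_mulVec, h2, one_mulVec]
  rw [h3]
  rfl

lemma IsLeftSingularBasis.l2norm_transpose_mulVec_sq (hu : IsLeftSingularBasis W u)
    (y : Fin p → ℝ) : l2norm (Wᵀ *ᵥ y) ^ 2 = ∑ t : Fin p, sv W t ^ 2 * (u t ⬝ᵥ y) ^ 2 := by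
  rw [l2norm_mulVec_sq, transpose_transpose, hu.dotProduct_eq_sum]
  refine Finset.sum_congr rfl fun t _ => ?_
  rw [dotProduct_mulVec_eq (W * Wᵀ), transpose_mul, transpose_transpose, hu.2 t, smul_dotProduct,
    smul_eq_mul]
  ring

/-- A Courant–Fischer bound: if `‖Wᵀ y‖² ≥ b ‖y‖²` on the image of a subspace of dimension
greater than `t` under an injective map, then the `t`-th squared singular value is at least `b`. -/
lemma IsLeftSingularBasis.le_sv_sq (hu : IsLeftSingularBasis W u) {n : ℕ}
    (S : Matrix (Fin p) (Fin n) ℝ) (R : Submodule ℝ (Fin n → ℝ)) {b : ℝ}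
    (hinj : ∀ x ∈ R, x ≠ 0 → S *ᵥ x ≠ 0)
    (hb : ∀ x ∈ R, b * l2norm (S *ᵥ x) ^ 2 ≤ l2norm (Wᵀ *ᵥ S *ᵥ x) ^ 2)
    {t : Fin p} (ht : (t : ℕ) < Module.finrank ℝ R) : b ≤ sv W t ^ 2 := by
  let L : R →ₗ[ℝ] (Fin t → ℝ) :=
    ((Matrix.of fun s : Fin t => u ⟨s, s.2.trans t.2⟩).mulVecLin ∘ₗ S.mulVecLin) ∘ₗ R.subtype
  have hL : LinearMap.ker L ≠ ⊥ := LinearMap.ker_ne_bot_of_finrank_lt (by simpa using ht)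
  obtain ⟨⟨x, hxR⟩, hx, hx0⟩ := Submodule.exists_mem_ne_zero_of_ne_bot hL
  have hx0' : x ≠ 0 := fun h => hx0 (Subtype.ext h)
  set y := S *ᵥ x with hy
  have hort : ∀ s : Fin p, s < t → u s ⬝ᵥ y = 0 := fun s hs =>
    congrFun (LinearMap.mem_ker.1 hx) ⟨s, hs⟩
  have hypos : 0 < l2norm y ^ 2 := pow_pos (l2norm_pos (hinj x hxR hx0')) 2
  refine le_of_mul_le_mul_right ((hb x hxR).trans ?_) hypos
  rw [← hy, hu.l2norm_transpose_mulVec_sq, ← dotProduct_self_eq_l2norm_sq, hu.dotProduct_eq_sum,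
    Finset.mul_sum]
  refine Finset.sum_le_sum fun s _ => ?_
  by_cases hs : s < t
  · rw [hort s hs]; norm_num
  · rw [← sq]
    exact mul_le_mul_of_nonneg_right
      (pow_le_pow_left₀ (sv_nonneg _ _) (sv_antitone W (not_lt.1 hs)) 2) (sq_nonneg _)

end LeftSingular

/-! ### Perturbation analysis of the Frieze–Kannan–Vempala output -/

/-- `S` is a row sketch of the rank `k` matrix `A` and `W` a column sketch of `S`, with
`‖AᵀA - SᵀS‖_F, ‖SSᵀ - WWᵀ‖_F ≤ e`, where `e` is small compared with the square of `σ`, a lower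
bound for the nonzero singular values of `A`. -/
structure IsSketch {m n p : ℕ} (A : Matrix (Fin m) (Fin n) ℝ) (k : ℕ) (σ e : ℝ)
    (S : Matrix (Fin p) (Fin n) ℝ) (W : Matrix (Fin p) (Fin p) ℝ) : Prop where
  rank_eq : A.rank = k
  k_pos : 0 < k
  k_le : k ≤ p
  σ_pos : 0 < σ
  le_mulVec : ∀ x ∈ Submodule.span ℝ (Set.range A.row), σ * l2norm x ≤ l2norm (A *ᵥ x)
  rows_mem : ∀ y, Sᵀ *ᵥ y ∈ Submodule.span ℝ (Set.range A.row)
  gram_close : frob (Aᵀ * A - Sᵀ * S) ≤ e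
  cogram_close : frob (S * Sᵀ - W * Wᵀ) ≤ e
  small : 8 * k * e ≤ σ ^ 2

section

variable {m n p k : ℕ} {A : Matrix (Fin m) (Fin n) ℝ} {σ e : ℝ} {S : Matrix (Fin p) (Fin n) ℝ}
  {W : Matrix (Fin p) (Fin p) ℝ} {u : Fin p → Fin p → ℝ} {V : Matrix (Fin n) (Fin k) ℝ}

namespace IsSketch

lemma e_nonneg (h : IsSketch A k σ e S W) : 0 ≤ e := (frob_nonneg _).trans h.gram_close

lemma one_le_k (h : IsSketch A k σ e S W) : (1 : ℝ) ≤ k := by exact_mod_cast h.k_pos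

lemma eight_mul_e_le (h : IsSketch A k σ e S W) : 8 * e ≤ σ ^ 2 := by
  nlinarith [h.small, h.one_le_k, h.e_nonneg]

lemma abs_l2norm_mulVec_sub (h : IsSketch A k σ e S W) (x : Fin n → ℝ) :
    |l2norm (A *ᵥ x) ^ 2 - l2norm (S *ᵥ x) ^ 2| ≤ e * l2norm x ^ 2 := by
  rw [l2norm_mulVec_sq, l2norm_mulVec_sq, ← dotProduct_sub, ← sub_mulVec, sq (l2norm x)]
  exact (abs_dotProduct_mulVec_le _ _ _).trans (mul_le_mul_of_nonneg_right h.gram_close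
    (mul_nonneg (l2norm_nonneg _) (l2norm_nonneg _)))

lemma abs_l2norm_transpose_mulVec_sub (h : IsSketch A k σ e S W) (y : Fin p → ℝ) :
    |l2norm (Sᵀ *ᵥ y) ^ 2 - l2norm (Wᵀ *ᵥ y) ^ 2| ≤ e * l2norm y ^ 2 := by
  rw [l2norm_mulVec_sq, l2norm_mulVec_sq, ← dotProduct_sub, ← sub_mulVec, transpose_transpose,
    transpose_transpose, sq (l2norm y)]
  exact (abs_dotProduct_mulVec_le _ _ _).trans (mul_le_mul_of_nonneg_right h.cogram_close
    (mul_nonneg (l2norm_nonneg _) (l2norm_nonneg _)))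

/-- The leading singular values of the small sketch are at least comparable with those of `A`. -/
lemma le_sv_sq (h : IsSketch A k σ e S W) (hu : IsLeftSingularBasis W u) {t : Fin p}
    (ht : (t : ℕ) < k) : 3 / 4 * σ ^ 2 ≤ sv W t ^ 2 := by
  have hσ := h.σ_pos
  have hS : ∀ x ∈ Submodule.span ℝ (Set.range A.row),
      (σ ^ 2 - e) * l2norm x ^ 2 ≤ l2norm (S *ᵥ x) ^ 2 := fun x hx => by
    have h1 := (abs_le.1 (h.abs_l2norm_mulVec_sub x)).2
    have h2 := pow_le_pow_left₀ (mul_nonneg hσ.le (l2norm_nonneg _)) (h.le_mulVec x hx) 2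
    rw [mul_pow] at h2
    linarith
  have he := h.eight_mul_e_le
  have he0 := h.e_nonneg
  have hσe : 0 < σ ^ 2 - e := by nlinarith [pow_pos hσ 2]
  have hinj : ∀ x ∈ Submodule.span ℝ (Set.range A.row), x ≠ 0 → S *ᵥ x ≠ 0 := by
    intro x hx hx0 h0
    have h1 := hS x hx
    rw [h0, l2norm_zero] at h1
    have h2 := mul_pos hσe (pow_pos (l2norm_pos hx0) 2)
    linarith
  refine le_trans ?_ (hu.le_sv_sq S (Submodule.span ℝ (Set.range A.row)) (b := σ ^ 2 - 2 * e)
    hinj ?_ ?_)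
  · linarith
  · intro x hx
    by_cases hx0 : x = 0
    · rw [hx0, mulVec_zero, mulVec_zero]
      norm_num
    set y := S *ᵥ x with hy
    have hxpos := l2norm_pos hx0
    -- `‖S x‖² = ⟨x, Sᵀ S x⟩ ≤ ‖x‖ ‖Sᵀ S x‖` turns the bound for `S` into one for `Sᵀ`
    have h1 : l2norm y ^ 2 ≤ l2norm x * l2norm (Sᵀ *ᵥ y) := by
      rw [← dotProduct_self_eq_l2norm_sq]
      conv_lhs => rw [hy, dotProduct_mulVec_eq, ← hy, dotProduct_comm]
      exact (le_abs_self _).trans (abs_dotProduct_le _ _)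
    have h2 := hS x hx
    rw [← hy] at h2
    have h3 : (σ ^ 2 - e) * l2norm y ^ 2 ≤ l2norm (Sᵀ *ᵥ y) ^ 2 := by
      refine le_of_mul_le_mul_right ?_ (pow_pos hxpos 2)
      calc (σ ^ 2 - e) * l2norm y ^ 2 * l2norm x ^ 2
          = (σ ^ 2 - e) * l2norm x ^ 2 * l2norm y ^ 2 := by ring
        _ ≤ l2norm y ^ 2 * l2norm y ^ 2 := mul_le_mul_of_nonneg_right h2 (sq_nonneg _)
        _ = (l2norm y ^ 2) ^ 2 := by ring
        _ ≤ (l2norm x * l2norm (Sᵀ *ᵥ y)) ^ 2 := pow_le_pow_left₀ (sq_nonneg _) h1 2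
        _ = _ := by ring
    have h4 := (abs_le.1 (h.abs_l2norm_transpose_mulVec_sub y)).2
    linarith
  · rwa [← Matrix.rank_eq_finrank_span_row, h.rank_eq]

lemma mul_le_sv (h : IsSketch A k σ e S W) (hu : IsLeftSingularBasis W u) {t : Fin p}
    (ht : (t : ℕ) < k) : 3 / 4 * σ ≤ sv W t := by
  have hσ := h.σ_pos
  refine (sq_le_sq₀ (by positivity) (sv_nonneg _ _)).1 ?_
  nlinarith [h.le_sv_sq hu ht, pow_pos hσ 2]

lemma sv_pos (h : IsSketch A k σ e S W) (hu : IsLeftSingularBasis W u) {t : Fin p}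
    (ht : (t : ℕ) < k) : 0 < sv W t := by
  linarith [h.mul_le_sv hu ht, h.σ_pos]

/-- The approximate right singular vectors are orthonormal up to an error that is relative to the
singular values of the sketch. -/
lemma abs_gram_sub_one_le (h : IsSketch A k σ e S W) (hu : IsLeftSingularBasis W u)
    (hV : ∀ t : Fin k, V.col t = (sv W t)⁻¹ • (Sᵀ *ᵥ u (Fin.castLE h.k_le t))) (s t : Fin k) :
    |(Vᵀ * V - 1 : Matrix (Fin k) (Fin k) ℝ) s t| ≤ e / (sv W s * sv W t) := by
  have hs := h.sv_pos hu (t := Fin.castLE h.k_le s) s.2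
  have ht := h.sv_pos hu (t := Fin.castLE h.k_le t) t.2
  simp only [Fin.val_castLE] at hs ht
  have h0 : (Vᵀ * V) s t = V.col s ⬝ᵥ V.col t := rfl
  have h1 : (Sᵀ *ᵥ u (Fin.castLE h.k_le s)) ⬝ᵥ (Sᵀ *ᵥ u (Fin.castLE h.k_le t)) =
      u (Fin.castLE h.k_le s) ⬝ᵥ (S * Sᵀ - W * Wᵀ) *ᵥ u (Fin.castLE h.k_le t) +
        sv W t ^ 2 * (1 : Matrix (Fin k) (Fin k) ℝ) s t := by
    rw [sub_mulVec, dotProduct_sub, hu.2, dotProduct_smul, hu.1, ← mulVec_mulVec,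
      dotProduct_mulVec_eq S, Matrix.one_apply]
    simp
  have h2 := abs_dotProduct_mulVec_le (S * Sᵀ - W * Wᵀ) (u (Fin.castLE h.k_le s))
    (u (Fin.castLE h.k_le t))
  rw [hu.l2norm_eq_one, hu.l2norm_eq_one, mul_one, mul_one] at h2
  have h3 : (Vᵀ * V - 1 : Matrix (Fin k) (Fin k) ℝ) s t =
      (u (Fin.castLE h.k_le s) ⬝ᵥ (S * Sᵀ - W * Wᵀ) *ᵥ u (Fin.castLE h.k_le t)) /
        (sv W s * sv W t) := by
    rw [Matrix.sub_apply, h0, hV, hV, smul_dotProduct, dotProduct_smul, h1, smul_eq_mul,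
      smul_eq_mul]
    by_cases hst : s = t
    · subst hst
      rw [Matrix.one_apply_eq]
      field_simp
      ring
    · rw [Matrix.one_apply_ne hst]
      field_simp
      ring
  rw [h3, abs_div, abs_of_pos (mul_pos hs ht)]
  exact div_le_div_of_nonneg_right (h2.trans h.cogram_close) (mul_pos hs ht).le

lemma frob_gram_sub_one_le (h : IsSketch A k σ e S W) (hu : IsLeftSingularBasis W u)
    (hV : ∀ t : Fin k, V.col t = (sv W t)⁻¹ • (Sᵀ *ᵥ u (Fin.castLE h.k_le t))) :
    frob (Vᵀ * V - 1) ≤ 2 * k * (e / σ ^ 2) := by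
  have hσ := h.σ_pos
  have he := h.e_nonneg
  refine (frob_le_of_abs_le (b := 2 * (e / σ ^ 2)) (by positivity) fun s t => ?_).trans_eq ?_
  · refine (h.abs_gram_sub_one_le hu hV s t).trans ?_
    have hs := h.mul_le_sv hu (t := Fin.castLE h.k_le s) s.2
    have ht := h.mul_le_sv hu (t := Fin.castLE h.k_le t) t.2
    simp only [Fin.val_castLE] at hs ht
    have h1 := mul_le_mul hs ht (by positivity) (sv_nonneg _ _)
    calc e / (sv W s * sv W t) ≤ e / (3 / 4 * σ * (3 / 4 * σ)) :=
          div_le_div_of_nonneg_left he (by positivity) h1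
      _ = 16 / 9 * (e / σ ^ 2) := by field_simp; ring
      _ ≤ 2 * (e / σ ^ 2) := by
          refine mul_le_mul_of_nonneg_right (by norm_num) (by positivity)
  · rw [Fintype.card_fin]; ring

lemma frob_gram_sub_one_le_quarter (h : IsSketch A k σ e S W) (hu : IsLeftSingularBasis W u)
    (hV : ∀ t : Fin k, V.col t = (sv W t)⁻¹ • (Sᵀ *ᵥ u (Fin.castLE h.k_le t))) :
    frob (Vᵀ * V - 1) ≤ 1 / 4 := by
  refine (h.frob_gram_sub_one_le hu hV).trans ?_
  have h1 : 2 * k * (e / σ ^ 2) = 2 * k * e / σ ^ 2 := by ring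
  rw [h1, div_le_iff₀ (pow_pos h.σ_pos 2)]
  linarith [h.small]

lemma span_col_eq (h : IsSketch A k σ e S W) (hu : IsLeftSingularBasis W u)
    (hV : ∀ t : Fin k, V.col t = (sv W t)⁻¹ • (Sᵀ *ᵥ u (Fin.castLE h.k_le t))) :
    Submodule.span ℝ (Set.range V.col) = Submodule.span ℝ (Set.range A.row) := by
  have hq := h.frob_gram_sub_one_le_quarter hu hV
  obtain ⟨Q, hQ1, hQ2, -⟩ := exists_orthonormal_close V (by linarith)
  refine Submodule.eq_of_le_of_finrank_eq ?_ ?_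
  · rw [Submodule.span_le]
    rintro _ ⟨t, rfl⟩
    rw [hV]
    exact Submodule.smul_mem _ _ (h.rows_mem _)
  · rw [← hQ2, ← Matrix.rank_eq_finrank_span_cols, ← Matrix.rank_eq_finrank_span_row, h.rank_eq,
      ← Matrix.rank_transpose_mul_self, hQ1, Matrix.rank_one, Fintype.card_fin]

/-- `‖A v̂_t‖ ≤ 3 σ_t`: the approximate singular vector `v̂_t` is stretched by `A` only as much as
its own singular value allows. -/
lemma l2norm_mulVec_col_le (h : IsSketch A k σ e S W) (hu : IsLeftSingularBasis W u)
    (hV : ∀ t : Fin k, V.col t = (sv W t)⁻¹ • (Sᵀ *ᵥ u (Fin.castLE h.k_le t))) (t : Fin k) :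
    l2norm (A *ᵥ V.col t) ≤ 3 * sv W t := by
  have ht := h.sv_pos hu (t := Fin.castLE h.k_le t) t.2
  have ht2 := h.le_sv_sq hu (t := Fin.castLE h.k_le t) t.2
  simp only [Fin.val_castLE] at ht ht2
  have he := h.eight_mul_e_le
  have he0 := h.e_nonneg
  set τ := sv W t with hτ
  have heτ : e ≤ τ ^ 2 / 6 := by linarith
  have h1 : l2norm (V.col t) ^ 2 ≤ 2 := by
    have h2 := (abs_le.1 (h.abs_gram_sub_one_le hu hV t t)).2
    have h3 : (Vᵀ * V - 1 : Matrix (Fin k) (Fin k) ℝ) t t = l2norm (V.col t) ^ 2 - 1 := by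
      rw [← dotProduct_self_eq_l2norm_sq, Matrix.sub_apply, Matrix.one_apply_eq]
      rfl
    have h4 : e / (sv W t * sv W t) ≤ 1 := by
      rw [← hτ, div_le_one (mul_pos ht ht)]
      nlinarith
    linarith
  have h2 : l2norm (S *ᵥ V.col t) ≤ 2 * τ := by
    set v := u (Fin.castLE h.k_le t) with hv
    have h3 : S *ᵥ V.col t = τ⁻¹ • ((S * Sᵀ - W * Wᵀ) *ᵥ v + τ ^ 2 • v) := by
      rw [hV, mulVec_smul, mulVec_mulVec, sub_mulVec, hv, hu.2, Fin.val_castLE, ← hτ, ← hv,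
        sub_add_cancel]
    rw [h3, l2norm_smul, abs_of_pos (inv_pos.2 ht), inv_mul_le_iff₀ ht]
    refine (l2norm_add_le _ _).trans ?_
    have h4 := l2norm_mulVec_le (S * Sᵀ - W * Wᵀ) v
    rw [l2norm_smul, hv, hu.l2norm_eq_one, abs_of_nonneg (sq_nonneg _), mul_one]
    rw [hv, hu.l2norm_eq_one, mul_one] at h4
    have := h.cogram_close
    nlinarith
  have h5 := (abs_le.1 (h.abs_l2norm_mulVec_sub (V.col t))).2
  have h6 := pow_le_pow_left₀ (l2norm_nonneg _) h2 2
  refine l2norm_le_of_sq_le (by positivity) ?_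
  nlinarith

/-- `V̂ V̂ᵀ` nearly fixes the rows of `A`, with an error relative to the smallest singular value.
The cancellation behind this is `|(V̂ᵀV̂ - 1)_st| ≤ e / (σ_s σ_t)` against `‖A v̂_t‖ ≤ 3 σ_t`. -/
lemma l2norm_proj_sub_le (h : IsSketch A k σ e S W) (hu : IsLeftSingularBasis W u)
    (hV : ∀ t : Fin k, V.col t = (sv W t)⁻¹ • (Sᵀ *ᵥ u (Fin.castLE h.k_le t))) (w : Fin m → ℝ) :
    l2norm (V *ᵥ Vᵀ *ᵥ Aᵀ *ᵥ w - Aᵀ *ᵥ w) ≤ 8 * √k * k * (e / σ) * l2norm w := by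
  have hσ := h.σ_pos
  have he0 := h.e_nonneg
  have hq := h.frob_gram_sub_one_le_quarter hu hV
  obtain ⟨Q, hQ1, hQ2, hQ3⟩ := exists_orthonormal_close V (by linarith)
  set g := Vᵀ *ᵥ Aᵀ *ᵥ w with hg
  set d := V *ᵥ g - Aᵀ *ᵥ w with hd
  have hdQ : d ∈ LinearMap.range Q.mulVecLin := by
    rw [Matrix.range_mulVecLin, hQ2]
    refine Submodule.sub_mem _ ?_ ?_
    · rw [← Matrix.range_mulVecLin]
      exact ⟨g, rfl⟩
    · rw [h.span_col_eq hu hV]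
      have : Aᵀ *ᵥ w ∈ LinearMap.range Aᵀ.mulVecLin := ⟨w, rfl⟩
      rw [Matrix.range_mulVecLin] at this
      exact this
  obtain ⟨c, hc⟩ := hdQ
  replace hc : Q *ᵥ c = d := hc
  have hdc : l2norm d = l2norm c := by rw [← hc, l2norm_mulVec_of_orthonormal hQ1]
  have h1 : l2norm d ≤ 2 * l2norm (Vᵀ *ᵥ d) := by
    have h2 : Vᵀ *ᵥ d = c - (Q - V)ᵀ *ᵥ d := by
      rw [transpose_sub, sub_mulVec]
      conv_rhs => rw [← hc, mulVec_mulVec, hQ1, one_mulVec, hc]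
      abel
    have h3 := l2norm_sub_le c ((Q - V)ᵀ *ᵥ d)
    rw [← h2, ← hdc] at h3
    have h4 := l2norm_mulVec_le (Q - V)ᵀ d
    rw [frob_transpose] at h4
    have h5 := mul_le_mul_of_nonneg_right (hQ3.trans hq) (l2norm_nonneg d)
    have := l2norm_nonneg d
    linarith
  have h2 : Vᵀ *ᵥ d = (Vᵀ * V - 1) *ᵥ g := by
    rw [hd, mulVec_sub, ← hg, sub_mulVec, one_mulVec, mulVec_mulVec]
  have hgt : ∀ t : Fin k, |g t| ≤ 3 * sv W t * l2norm w := fun t => by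
    have h3 : g t = (A *ᵥ V.col t) ⬝ᵥ w := by
      rw [dotProduct_comm, dotProduct_mulVec_eq, dotProduct_comm]
      rfl
    rw [h3]
    exact (abs_dotProduct_le _ _).trans
      (mul_le_mul_of_nonneg_right (h.l2norm_mulVec_col_le hu hV t) (l2norm_nonneg w))
  have h3 : ∀ s : Fin k, |((Vᵀ * V - 1 : Matrix (Fin k) (Fin k) ℝ) *ᵥ g) s| ≤ 4 * k * (e / σ) * l2norm w := fun s => by
    have hs := h.mul_le_sv hu (t := Fin.castLE h.k_le s) s.2
    simp only [Fin.val_castLE] at hs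
    have hspos : 0 < sv W s := by linarith
    have h0 : |((Vᵀ * V - 1 : Matrix (Fin k) (Fin k) ℝ) *ᵥ g) s| ≤
        ∑ t, |(Vᵀ * V - 1 : Matrix (Fin k) (Fin k) ℝ) s t * g t| := by
      rw [mulVec, dotProduct]
      exact Finset.abs_sum_le_sum_abs _ _
    refine h0.trans ?_
    have h4 : ∀ t ∈ (Finset.univ : Finset (Fin k)), |(Vᵀ * V - 1 : Matrix (Fin k) (Fin k) ℝ) s t * g t| ≤
        4 * (e / σ) * l2norm w := fun t _ => by
      have ht := h.sv_pos hu (t := Fin.castLE h.k_le t) t.2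
      simp only [Fin.val_castLE] at ht
      rw [abs_mul]
      refine (mul_le_mul (h.abs_gram_sub_one_le hu hV s t) (hgt t) (abs_nonneg _)
        (by positivity)).trans ?_
      have h5 : e / (sv W s * sv W t) * (3 * sv W t * l2norm w) =
          3 * (e / sv W s) * l2norm w := by
        field_simp
      have h6 : e / sv W s ≤ e / (3 / 4 * σ) := div_le_div_of_nonneg_left he0 (by positivity) hs
      have h7 : e / (3 / 4 * σ) = 4 / 3 * (e / σ) := by field_simp
      rw [h5]
      refine mul_le_mul_of_nonneg_right ?_ (l2norm_nonneg w)
      linarith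
    refine (Finset.sum_le_card_nsmul _ _ _ h4).trans_eq ?_
    rw [Finset.card_univ, Fintype.card_fin, nsmul_eq_mul]
    ring
  have h4 := l2norm_le_of_abs_le (by have := l2norm_nonneg w; positivity) h3
  rw [Fintype.card_fin] at h4
  rw [h2] at h1
  calc l2norm d ≤ 2 * (√k * (4 * k * (e / σ) * l2norm w)) := by linarith
    _ = _ := by ring

end IsSketch

end

/-! ### Concentration of sums of independent bounded vectors -/

section Concentration

variable {α : Type*} [Finite α] [MeasurableSpace α] [MeasurableSingletonClass α]
  {E : Type*} [NormedAddCommGroup E]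

lemma integral_pi_succ {F : Type*} [NormedAddCommGroup F] [NormedSpace ℝ F] (μ : Measure α)
    [IsProbabilityMeasure μ] {p : ℕ} (f : (Fin (p + 1) → α) → F) :
    ∫ ω, f ω ∂Measure.pi (fun _ => μ) =
      ∫ a, ∫ ω, f (Fin.cons a ω) ∂Measure.pi (fun _ : Fin p => μ) ∂μ := by
  have h := (measurePreserving_piFinSuccAbove (fun _ : Fin (p + 1) => μ) 0).symm
  rw [← h.integral_comp', integral_prod _ Integrable.of_finite]
  simp [MeasurableEquiv.piFinSuccAbove, Fin.consEquiv]

/-- Hoeffding's lemma for a random variable within distance `B` of a constant. -/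
lemma integral_exp_le_of_abs_sub_le (μ : Measure α) [IsProbabilityMeasure μ] {f : α → ℝ} {c B : ℝ}
    (hf : ∀ a, |f a - c| ≤ B) (t : ℝ) :
    ∫ a, Real.exp (t * f a) ∂μ ≤ Real.exp (t * ∫ a, f a ∂μ + t ^ 2 * B ^ 2 / 2) := by
  have h := (ProbabilityTheory.hasSubgaussianMGF_of_mem_Icc (μ := μ) (X := f) (a := c - B)
    (b := c + B) (Measurable.of_discrete).aemeasurable
    (ae_of_all _ fun a => ⟨by linarith [(abs_le.1 (hf a)).1], by linarith [(abs_le.1 (hf a)).2]⟩)).mgf_le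
    t
  have h1 : ((((‖c + B - (c - B)‖₊ / 2) ^ 2 : NNReal)) : ℝ) = B ^ 2 := by
    push_cast
    rw [Real.norm_eq_abs, div_pow, sq_abs]
    ring
  rw [h1, ProbabilityTheory.mgf] at h
  have h2 : ∀ a, Real.exp (t * (f a - ∫ x, f x ∂μ)) =
      Real.exp (-(t * ∫ x, f x ∂μ)) * Real.exp (t * f a) := fun a => by
    rw [← Real.exp_add]; ring_nf
  simp_rw [h2] at h
  rw [integral_const_mul, Real.exp_neg, inv_mul_le_iff₀ (Real.exp_pos _), ← Real.exp_add] at h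
  refine h.trans_eq ?_
  ring_nf

variable (μ : Measure α) [IsProbabilityMeasure μ] {Y : α → E} {B : ℝ}

/-- The exponential moment of the norm of a random walk with steps bounded by `B`. The induction
removes the first step: given it, the mean norm of the rest is a `1`-Lipschitz function of the
starting point, to which Hoeffding's lemma applies. -/
lemma integral_exp_norm_sum_le (hY : ∀ a, ‖Y a‖ ≤ B) (t : ℝ) (p : ℕ) (s : E) :
    ∫ ω, Real.exp (t * ‖s + ∑ i, Y (ω i)‖) ∂Measure.pi (fun _ : Fin p => μ) ≤
      Real.exp (t * ∫ ω, ‖s + ∑ i, Y (ω i)‖ ∂Measure.pi (fun _ : Fin p => μ) +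
        p * (t ^ 2 * B ^ 2 / 2)) := by
  induction p generalizing s with
  | zero => simp
  | succ p ih =>
    have hcons : ∀ (a : α) (ω : Fin p → α),
        s + ∑ i, Y ((Fin.cons a ω : Fin (p + 1) → α) i) = s + Y a + ∑ i, Y (ω i) := fun a ω => by
      rw [Fin.sum_univ_succ, Fin.cons_zero, add_assoc]
      simp only [Fin.cons_succ]
    rw [integral_pi_succ, integral_pi_succ]
    simp only [hcons]
    set φ : E → ℝ := fun s => ∫ ω, ‖s + ∑ i, Y (ω i)‖ ∂Measure.pi (fun _ : Fin p => μ) with hφ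
    have hlip : ∀ a, |φ (s + Y a) - φ s| ≤ B := fun a => by
      rw [hφ]
      simp only
      rw [← integral_sub Integrable.of_finite Integrable.of_finite]
      refine (abs_integral_le_integral_abs).trans ?_
      have h1 : ∀ ω : Fin p → α,
          |‖s + Y a + ∑ i, Y (ω i)‖ - ‖s + ∑ i, Y (ω i)‖| ≤ B := fun ω => by
        refine (abs_norm_sub_norm_le _ _).trans ?_
        rw [add_sub_add_right_eq_sub, add_sub_cancel_left]
        exact hY a
      refine (integral_mono Integrable.of_finite Integrable.of_finite h1).trans_eq ?_
      simp
    calc ∫ a, ∫ ω, Real.exp (t * ‖s + Y a + ∑ i, Y (ω i)‖) ∂Measure.pi (fun _ : Fin p => μ) ∂μ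
        ≤ ∫ a, Real.exp (p * (t ^ 2 * B ^ 2 / 2)) * Real.exp (t * φ (s + Y a)) ∂μ := by
          refine integral_mono Integrable.of_finite Integrable.of_finite fun a => ?_
          simp only
          rw [← Real.exp_add, add_comm (_ * _ : ℝ)]
          exact ih (s + Y a)
      _ ≤ Real.exp (p * (t ^ 2 * B ^ 2 / 2)) *
          Real.exp (t * ∫ a, φ (s + Y a) ∂μ + t ^ 2 * B ^ 2 / 2) := by
          rw [integral_const_mul]
          exact mul_le_mul_of_nonneg_left (integral_exp_le_of_abs_sub_le μ hlip t)
            (Real.exp_pos _).le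
      _ = _ := by
          rw [← Real.exp_add]
          simp only [hφ]
          push_cast
          ring_nf

variable [InnerProductSpace ℝ E] [CompleteSpace E]

/-- Centred independent steps are orthogonal, so their second moments add up. -/
lemma integral_norm_sum_sq_le {v : ℝ} (hv : ∫ a, ‖Y a‖ ^ 2 ∂μ ≤ v) (h0 : ∫ a, Y a ∂μ = 0)
    (p : ℕ) (s : E) :
    ∫ ω, ‖s + ∑ i, Y (ω i)‖ ^ 2 ∂Measure.pi (fun _ : Fin p => μ) ≤ ‖s‖ ^ 2 + p * v := by
  induction p generalizing s with
  | zero => simp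
  | succ p ih =>
    have hcons : ∀ (a : α) (ω : Fin p → α),
        s + ∑ i, Y ((Fin.cons a ω : Fin (p + 1) → α) i) = s + Y a + ∑ i, Y (ω i) := fun a ω => by
      rw [Fin.sum_univ_succ, Fin.cons_zero, add_assoc]
      simp only [Fin.cons_succ]
    rw [integral_pi_succ]
    simp only [hcons]
    have h1 : ∀ a, ∫ ω, ‖s + Y a + ∑ i, Y (ω i)‖ ^ 2 ∂Measure.pi (fun _ : Fin p => μ) ≤
        ‖s‖ ^ 2 + p * v + (2 * inner ℝ s (Y a) + ‖Y a‖ ^ 2) := fun a => by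
      refine (ih (s + Y a)).trans_eq ?_
      rw [norm_add_sq_real]
      ring
    have h2 : ∫ a, (2 * inner ℝ s (Y a) + ‖Y a‖ ^ 2) ∂μ ≤ v := by
      rw [integral_add Integrable.of_finite Integrable.of_finite, integral_const_mul,
        integral_inner Integrable.of_finite, h0, inner_zero_right]
      linarith
    refine (integral_mono Integrable.of_finite Integrable.of_finite h1).trans ?_
    rw [integral_add Integrable.of_finite Integrable.of_finite]
    simp only [integral_const, probReal_univ, one_smul]
    push_cast
    linarith

lemma integral_norm_sum_le (hB : 0 ≤ B) (hY : ∀ a, ‖Y a‖ ≤ B) (h0 : ∫ a, Y a ∂μ = 0) (p : ℕ) :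
    ∫ ω, ‖∑ i, Y (ω i)‖ ∂Measure.pi (fun _ : Fin p => μ) ≤ √p * B := by
  have hv : ∫ a, ‖Y a‖ ^ 2 ∂μ ≤ B ^ 2 := by
    refine (integral_mono Integrable.of_finite Integrable.of_finite fun a =>
      pow_le_pow_left₀ (norm_nonneg _) (hY a) 2).trans_eq ?_
    simp
  have h := integral_norm_sum_sq_le μ hv h0 p 0
  simp only [zero_add, norm_zero] at h
  rcases (mul_nonneg (Real.sqrt_nonneg (p : ℝ)) hB).eq_or_lt with hr | hr
  · have h1 : ∀ ω : Fin p → α, ‖∑ i, Y (ω i)‖ ≤ √p * B := fun ω => by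
      rcases mul_eq_zero.1 hr.symm with hp | hB0
      · have : p = 0 := by simpa using hp
        subst this
        simp
      · rw [hB0, mul_zero]
        refine (norm_sum_le _ _).trans ?_
        exact Finset.sum_nonpos fun i _ => (hY _).trans_eq hB0
    refine (integral_mono Integrable.of_finite Integrable.of_finite h1).trans_eq ?_
    simp
  · set r := √p * B with hrdef
    have hr2 : r ^ 2 = p * B ^ 2 := by rw [hrdef, mul_pow, Real.sq_sqrt (Nat.cast_nonneg _)]
    have h1 : ∀ ω : Fin p → α,
        ‖∑ i, Y (ω i)‖ ≤ (2 * r)⁻¹ * ‖∑ i, Y (ω i)‖ ^ 2 + r / 2 := fun ω => by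
      have h2 : ‖∑ i, Y (ω i)‖ * (2 * r) ≤ ‖∑ i, Y (ω i)‖ ^ 2 + r ^ 2 := by
        nlinarith [sq_nonneg (‖∑ i, Y (ω i)‖ - r)]
      rw [← le_div_iff₀ (by positivity)] at h2
      refine h2.trans_eq ?_
      field_simp
    refine (integral_mono Integrable.of_finite Integrable.of_finite h1).trans ?_
    rw [integral_add Integrable.of_finite Integrable.of_finite, integral_const_mul]
    have h3 := mul_le_mul_of_nonneg_left h (inv_nonneg.2 (by positivity : 0 ≤ 2 * r))
    have h4 : (2 * r)⁻¹ * (0 ^ 2 + (p : ℝ) * B ^ 2) = r / 2 := by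
      rw [← hr2]
      field_simp
      ring
    simp only [integral_const, probReal_univ, one_smul]
    linarith

/-- A dimension-free tail bound for sums of independent, centred, bounded random vectors. -/
theorem measure_norm_sum_ge_le (hB : 0 < B) (hY : ∀ a, ‖Y a‖ ≤ B) (h0 : ∫ a, Y a ∂μ = 0) {p : ℕ}
    {θ : ℝ} (hθ : 0 ≤ θ) (hp : 4 * B ^ 2 ≤ p * θ ^ 2) :
    (Measure.pi fun _ : Fin p => μ).real {ω | p * θ ≤ ‖∑ i, Y (ω i)‖} ≤
      Real.exp (-(p * θ ^ 2 / (8 * B ^ 2))) := by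
  set t := θ / (2 * B ^ 2) with ht
  have ht0 : 0 ≤ t := by positivity
  have h1 := ProbabilityTheory.measure_ge_le_exp_mul_mgf (μ := Measure.pi fun _ : Fin p => μ)
    (X := fun ω => ‖∑ i, Y (ω i)‖) (p * θ) ht0 Integrable.of_finite
  refine h1.trans ?_
  have h2 := integral_exp_norm_sum_le μ hY t p 0
  simp only [zero_add] at h2
  have h3 : √p * B ≤ p * θ / 2 := by
    refine (sq_le_sq₀ (by positivity) (by positivity)).1 ?_
    rw [mul_pow, Real.sq_sqrt (Nat.cast_nonneg _)]
    nlinarith [(Nat.cast_nonneg p : (0 : ℝ) ≤ p)]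
  have h4 := (integral_norm_sum_le μ hB.le hY h0 p).trans h3
  rw [ProbabilityTheory.mgf]
  refine (mul_le_mul_of_nonneg_left h2 (Real.exp_pos _).le).trans ?_
  rw [← Real.exp_add, Real.exp_le_exp]
  have h5 := mul_le_mul_of_nonneg_left h4 ht0
  have h6 : -t * (p * θ) + (t * (p * θ / 2) + p * (t ^ 2 * B ^ 2 / 2)) =
      -(p * θ ^ 2 / (8 * B ^ 2)) := by
    rw [ht]
    field_simp
    ring
  linarith

end Concentration

/-! ### Finite laws -/

section LawOf

variable {α : Type*} [Fintype α] [MeasurableSpace α] [MeasurableSingletonClass α] {f : α → ℝ}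

lemma lawOf_real_apply (hf : ∀ a, 0 ≤ f a) (s : Set α) :
    (lawOf f).real s = ∑ a, s.indicator f a := by
  have h : lawOf f s = ENNReal.ofReal (∑ a, s.indicator f a) := by
    rw [lawOf, Measure.finsetSum_apply,
      ENNReal.ofReal_sum_of_nonneg fun a _ => Set.indicator_nonneg (fun a _ => hf a) _]
    refine Finset.sum_congr rfl fun a _ => ?_
    rw [Measure.smul_apply, Measure.dirac_apply, smul_eq_mul]
    by_cases ha : a ∈ s <;> simp [ha]
  rw [measureReal_def, h, ENNReal.toReal_ofReal
    (Finset.sum_nonneg fun a _ => Set.indicator_nonneg (fun a _ => hf a) _)]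

omit [MeasurableSingletonClass α] in
lemma isProbabilityMeasure_lawOf (hf : ∀ a, 0 ≤ f a) (h1 : ∑ a, f a = 1) :
    IsProbabilityMeasure (lawOf f) := by
  constructor
  rw [lawOf, Measure.finsetSum_apply]
  simp only [Measure.smul_apply, measure_univ, smul_eq_mul, mul_one]
  rw [← ENNReal.ofReal_sum_of_nonneg fun a _ => hf a, h1, ENNReal.ofReal_one]

lemma integral_lawOf {F : Type*} [NormedAddCommGroup F] [NormedSpace ℝ F] [CompleteSpace F]
    (hf : ∀ a, 0 ≤ f a) (h1 : ∑ a, f a = 1) (g : α → F) :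
    ∫ a, g a ∂lawOf f = ∑ a, f a • g a := by
  have := isProbabilityMeasure_lawOf hf h1
  rw [integral_fintype Integrable.of_finite]
  refine Finset.sum_congr rfl fun a _ => ?_
  rw [lawOf_real_apply hf, Finset.sum_eq_single a] <;> simp +contextual

lemma l2Density_nonneg {ι : Type*} [Fintype ι] (v : ι → ℝ) (i : ι) : 0 ≤ l2Density v i :=
  div_nonneg (sq_nonneg _) (sq_nonneg _)

lemma sum_l2Density {ι : Type*} [Fintype ι] {v : ι → ℝ} (hv : v ≠ 0) :
    ∑ i, l2Density v i = 1 := by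
  simp only [l2Density]
  rw [← Finset.sum_div, ← l2norm_sq, div_self (pow_ne_zero _ (l2norm_pos hv).ne')]

end LawOf

/-! ### Length-squared sampling of rows and columns -/

section Sampling

variable {m n p : ℕ}

lemma l2norm_rows (M : Matrix (Fin m) (Fin n) ℝ) : l2norm (fun i => l2norm (M i)) = frob M := by
  rw [← sq_eq_sq₀ (l2norm_nonneg _) (frob_nonneg _), l2norm_sq, frob_sq_eq_sum_row]

lemma rowDensity_apply (M : Matrix (Fin m) (Fin n) ℝ) (i : Fin m) :
    rowDensity M i = l2norm (M i) ^ 2 / frob M ^ 2 := by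
  rw [rowDensity, l2Density, l2norm_rows]

lemma rowDensity_nonneg (M : Matrix (Fin m) (Fin n) ℝ) (i : Fin m) : 0 ≤ rowDensity M i :=
  l2Density_nonneg _ _

lemma sum_rowDensity {M : Matrix (Fin m) (Fin n) ℝ} (hM : M ≠ 0) : ∑ i, rowDensity M i = 1 := by
  refine sum_l2Density fun h => (frob_pos hM).ne' ?_
  rw [← l2norm_rows, h, l2norm_zero]

lemma isProbabilityMeasure_rowLaw {M : Matrix (Fin m) (Fin n) ℝ} (hM : M ≠ 0) :
    IsProbabilityMeasure (lawOf (rowDensity M)) :=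
  isProbabilityMeasure_lawOf (rowDensity_nonneg M) (sum_rowDensity hM)

lemma l2norm_sq_div_rowDensity_le (M : Matrix (Fin m) (Fin n) ℝ) (i : Fin m) :
    l2norm (M i) ^ 2 / rowDensity M i ≤ frob M ^ 2 := by
  by_cases h : l2norm (M i) = 0
  · rw [h]
    simp [sq_nonneg]
  rw [rowDensity_apply, div_div_cancel₀ (pow_ne_zero 2 h)]

lemma l2norm_fkvS_row_sq (M : Matrix (Fin m) (Fin n) ℝ) (ω : Fin p → Fin m) (r : Fin p) :
    l2norm (fkvS M ω r) ^ 2 = l2norm (M (ω r)) ^ 2 / rowDensity M (ω r) / p := by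
  rw [l2norm_sq, l2norm_sq, Finset.sum_div, Finset.sum_div]
  refine Finset.sum_congr rfl fun j _ => ?_
  rw [fkvS, div_pow, Real.sq_sqrt (mul_nonneg (Nat.cast_nonneg _) (rowDensity_nonneg _ _)),
    div_div, mul_comm (p : ℝ)]

lemma frob_fkvS_sq_le (M : Matrix (Fin m) (Fin n) ℝ) (ω : Fin p → Fin m) :
    frob (fkvS M ω) ^ 2 ≤ frob M ^ 2 := by
  rw [frob_sq_eq_sum_row]
  have h : ∀ r ∈ (Finset.univ : Finset (Fin p)), l2norm (fkvS M ω r) ^ 2 ≤ frob M ^ 2 / p :=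
    fun r _ => by
      rw [l2norm_fkvS_row_sq]
      exact div_le_div_of_nonneg_right (l2norm_sq_div_rowDensity_le _ _) (Nat.cast_nonneg _)
  refine (Finset.sum_le_card_nsmul _ _ _ h).trans ?_
  rw [Finset.card_univ, Fintype.card_fin, nsmul_eq_mul]
  rcases Nat.eq_zero_or_pos p with rfl | hp
  · simp [sq_nonneg]
  · rw [mul_div_cancel₀]
    exact_mod_cast hp.ne'

lemma frob_fkvS_sq {M : Matrix (Fin m) (Fin n) ℝ} (hp : 0 < p) {ω : Fin p → Fin m}
    (hω : ∀ r, M (ω r) ≠ 0) : frob (fkvS M ω) ^ 2 = frob M ^ 2 := by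
  rw [frob_sq_eq_sum_row]
  have h : ∀ r ∈ (Finset.univ : Finset (Fin p)), l2norm (fkvS M ω r) ^ 2 = frob M ^ 2 / p :=
    fun r _ => by
      rw [l2norm_fkvS_row_sq, rowDensity_apply,
        div_div_cancel₀ (pow_ne_zero 2 (l2norm_pos (hω r)).ne')]
  rw [Finset.sum_congr rfl h, Finset.sum_const, Finset.card_univ, Fintype.card_fin, nsmul_eq_mul,
    mul_div_cancel₀]
  exact_mod_cast hp.ne'

lemma fkvS_transpose_mul_self_apply (M : Matrix (Fin m) (Fin n) ℝ) (ω : Fin p → Fin m)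
    (i j : Fin n) :
    ((fkvS M ω)ᵀ * fkvS M ω) i j =
      (p : ℝ)⁻¹ * ∑ r, M (ω r) i * M (ω r) j / rowDensity M (ω r) := by
  rw [Matrix.mul_apply, Finset.mul_sum]
  refine Finset.sum_congr rfl fun r _ => ?_
  rw [transpose_apply, fkvS, fkvS, div_mul_div_comm,
    Real.mul_self_sqrt (mul_nonneg (Nat.cast_nonneg _) (rowDensity_nonneg _ _)), mul_comm (p : ℝ),
    ← div_div, inv_mul_eq_div]

/-- The Gram matrix of a length-squared row sample concentrates around that of the full matrix. -/
theorem measure_fkvS_gram_ge_le {M : Matrix (Fin m) (Fin n) ℝ} (hM : M ≠ 0) {θ : ℝ} (hθ : 0 ≤ θ)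
    (hp : 16 ≤ p * θ ^ 2) :
    (Measure.pi fun _ : Fin p => lawOf (rowDensity M)).real
      {ω | θ * frob M ^ 2 ≤ frob (Mᵀ * M - (fkvS M ω)ᵀ * fkvS M ω)} ≤
        Real.exp (-(p * θ ^ 2 / 32)) := by
  have hprob := isProbabilityMeasure_rowLaw hM
  have hF : 0 < frob M ^ 2 := pow_pos (frob_pos hM) 2
  have hp0 : (p : ℝ) ≠ 0 := fun h => by rw [h] at hp; norm_num at hp
  set μ := lawOf (rowDensity M) with hμ
  let G : Fin n × Fin n → ℝ := fun q => (Mᵀ * M) q.1 q.2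
  let X : Fin m → EuclideanSpace ℝ (Fin n × Fin n) := fun a =>
    WithLp.toLp 2 fun q => M a q.1 * M a q.2 / rowDensity M a
  let Y : Fin m → EuclideanSpace ℝ (Fin n × Fin n) := fun a => X a - WithLp.toLp 2 G
  have hX : ∀ a, ‖X a‖ ≤ frob M ^ 2 := fun a => by
    refine le_trans ?_ (l2norm_sq_div_rowDensity_le M a)
    refine le_of_eq ?_
    rw [← sq_eq_sq₀ (norm_nonneg _) (div_nonneg (sq_nonneg _) (rowDensity_nonneg _ _)),
      EuclideanSpace.real_norm_sq_eq, Fintype.sum_prod_type, div_pow, ← pow_mul, pow_mul', l2norm_sq,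
      sq (∑ i, M a i ^ 2), Finset.sum_mul_sum, Finset.sum_div]
    refine Finset.sum_congr rfl fun i _ => ?_
    rw [Finset.sum_div]
    refine Finset.sum_congr rfl fun j _ => ?_
    simp only [X]
    ring
  have hmean : ∫ a, X a ∂μ = WithLp.toLp 2 G := by
    rw [integral_lawOf (rowDensity_nonneg M) (sum_rowDensity hM)]
    ext q
    rw [WithLp.ofLp_sum, Finset.sum_apply]
    refine (Finset.sum_congr rfl fun a _ => ?_).trans (Matrix.mul_apply (M := Mᵀ)).symm
    rw [transpose_apply, WithLp.ofLp_smul, Pi.smul_apply, smul_eq_mul]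
    simp only [X]
    by_cases h : l2norm (M a) = 0
    · have h0 : M a = 0 := l2norm_eq_zero.1 h
      simp [h0]
    · have h1 : rowDensity M a ≠ 0 := by
        rw [rowDensity_apply]
        exact div_ne_zero (pow_ne_zero 2 h) hF.ne'
      field_simp
  have hY0 : ∫ a, Y a ∂μ = 0 := by
    rw [integral_sub Integrable.of_finite Integrable.of_finite, hmean]
    simp
  have hY : ∀ a, ‖Y a‖ ≤ 2 * frob M ^ 2 := fun a => by
    refine (norm_sub_le _ _).trans ?_
    have h1 : ‖WithLp.toLp 2 G‖ ≤ frob M ^ 2 := by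
      rw [← hmean]
      refine (norm_integral_le_integral_norm _).trans ?_
      refine (integral_mono Integrable.of_finite Integrable.of_finite hX).trans_eq ?_
      simp
    linarith [hX a]
  have hdiff : ∀ ω : Fin p → Fin m,
      p * frob (Mᵀ * M - (fkvS M ω)ᵀ * fkvS M ω) = ‖∑ i, Y (ω i)‖ := fun ω => by
    have h1 : ∑ i, Y (ω i) =
        WithLp.toLp 2 (-(p : ℝ) • fun q : Fin n × Fin n =>
          (Mᵀ * M - (fkvS M ω)ᵀ * fkvS M ω) q.1 q.2) := by
      ext q
      rw [WithLp.ofLp_sum, Finset.sum_apply]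
      change _ = -(p : ℝ) * ((Mᵀ * M) q.1 q.2 - ((fkvS M ω)ᵀ * fkvS M ω) q.1 q.2)
      rw [fkvS_transpose_mul_self_apply, mul_sub, neg_mul, neg_mul, ← mul_assoc,
        mul_inv_cancel₀ hp0, one_mul, sub_neg_eq_add]
      simp only [Y, X, G, PiLp.sub_apply, Finset.sum_sub_distrib, Finset.sum_const,
        Finset.card_univ, Fintype.card_fin, nsmul_eq_mul]
      ring
    rw [h1, frob_eq_l2norm]
    change _ = l2norm _
    rw [l2norm_smul, abs_neg, Nat.abs_cast]
  have h := measure_norm_sum_ge_le μ (by positivity : (0 : ℝ) < 2 * frob M ^ 2) hY hY0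
    (θ := θ * frob M ^ 2) (by positivity) (p := p) (by nlinarith [pow_pos hF 2])
  have hset : {ω : Fin p → Fin m | θ * frob M ^ 2 ≤ frob (Mᵀ * M - (fkvS M ω)ᵀ * fkvS M ω)} =
      {ω | p * (θ * frob M ^ 2) ≤ ‖∑ i, Y (ω i)‖} := by
    ext ω
    simp only [Set.mem_ofPred_eq]
    rw [← hdiff, mul_le_mul_iff_of_pos_left (lt_of_le_of_ne (Nat.cast_nonneg p) hp0.symm)]
  rw [hset]
  refine h.trans_eq ?_
  congr 2
  have hF' : frob M ≠ 0 := (frob_pos hM).ne'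
  field_simp
  ring

/-- The length-squared distribution of the columns of the row sample `S` is the mixture of the
length-squared distributions of the sampled rows. -/
lemma colDensity_eq_rowDensity {A : Matrix (Fin m) (Fin n) ℝ} (hA : A ≠ 0) (hp : 0 < p)
    {ω : Fin p → Fin m} (hω : ∀ r, A (ω r) ≠ 0) :
    colDensity A ω = rowDensity (fkvS A ω)ᵀ := by
  ext j
  have hF : 0 < frob A ^ 2 := pow_pos (frob_pos hA) 2
  have hp' : (p : ℝ) ≠ 0 := by exact_mod_cast hp.ne'
  rw [rowDensity_apply, frob_transpose, frob_fkvS_sq hp hω, l2norm_sq, colDensity, Finset.mul_sum,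
    Finset.sum_div]
  refine Finset.sum_congr rfl fun r _ => ?_
  have h1 : rowDensity A (ω r) = l2norm (A (ω r)) ^ 2 / frob A ^ 2 := rowDensity_apply _ _
  have h2 : l2norm (A (ω r)) ≠ 0 := (l2norm_pos (hω r)).ne'
  rw [transpose_apply, fkvS, div_pow,
    Real.sq_sqrt (mul_nonneg (Nat.cast_nonneg _) (rowDensity_nonneg _ _)), h1, l2Density]
  have hF' : frob A ≠ 0 := (frob_pos hA).ne'
  field_simp

lemma fkvW_eq {A : Matrix (Fin m) (Fin n) ℝ} (hA : A ≠ 0) (hp : 0 < p)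
    (ω : (Fin p → Fin m) × (Fin p → Fin n)) (hω : ∀ r, A (ω.1 r) ≠ 0) :
    fkvW A ω = (fkvS (fkvS A ω.1)ᵀ ω.2)ᵀ := by
  ext r c
  rw [fkvW, colDensity_eq_rowDensity hA hp hω]
  rfl

lemma fkvS_transpose_mulVec_mem (A : Matrix (Fin m) (Fin n) ℝ) (ω : Fin p → Fin m)
    (y : Fin p → ℝ) : (fkvS A ω)ᵀ *ᵥ y ∈ Submodule.span ℝ (Set.range A.row) := by
  have h : (fkvS A ω)ᵀ *ᵥ y =
      ∑ r, (y r / √(p * rowDensity A (ω r))) • A.row (ω r) := by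
    ext j
    rw [Finset.sum_apply, mulVec, dotProduct]
    refine Finset.sum_congr rfl fun r _ => ?_
    rw [transpose_apply, fkvS, Pi.smul_apply, smul_eq_mul, Matrix.row_apply]
    ring
  rw [h]
  exact Submodule.sum_mem _ fun r _ => Submodule.smul_mem _ _ (Submodule.subset_span ⟨_, rfl⟩)

end Sampling

/-! ### The sketching event of the Frieze–Kannan–Vempala algorithm -/

section FkvLaw

variable {m n p : ℕ} {A : Matrix (Fin m) (Fin n) ℝ}

lemma ofReal_one_sub_le {α : Type*} [MeasurableSpace α] (ν : Measure α) [IsProbabilityMeasure ν]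
    {s t : Set α} (hs : MeasurableSet s) (hst : ∀ᵐ a ∂ν, a ∉ s → a ∈ t) {η : ℝ}
    (h : ν.real s ≤ η) : ENNReal.ofReal (1 - η) ≤ ν t := by
  have h1 : ν sᶜ ≤ ν t := measure_mono_ae (by filter_upwards [hst] with a ha using ha)
  refine le_trans ?_ h1
  rw [← ofReal_measureReal, probReal_compl_eq_one_sub hs]
  exact ENNReal.ofReal_le_ofReal (by linarith)

/-- Almost surely no zero row is sampled. -/
lemma ae_rows_ne_zero (hA : A ≠ 0) (p : ℕ) :
    ∀ᵐ rows ∂Measure.pi (fun _ : Fin p => lawOf (rowDensity A)), ∀ r, A (rows r) ≠ 0 := by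
  have hprob := isProbabilityMeasure_rowLaw hA
  rw [ae_all_iff]
  intro r
  refine (Measure.tendsto_eval_ae_ae (μ := fun _ : Fin p => lawOf (rowDensity A))
    (i := r)).eventually (p := fun i => A i ≠ 0) ?_
  rw [ae_iff, ← measureReal_eq_zero_iff, lawOf_real_apply (rowDensity_nonneg A)]
  refine Finset.sum_eq_zero fun i _ => ?_
  refine Set.indicator_apply_eq_zero.2 fun hi => ?_
  have h0 : A i = 0 := not_not.1 hi
  rw [rowDensity_apply, h0, l2norm_zero]
  norm_num

lemma isProbabilityMeasure_colLaw (hA : A ≠ 0) (hp : 0 < p) {rows : Fin p → Fin m}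
    (h : ∀ r, A (rows r) ≠ 0) : IsProbabilityMeasure (lawOf (colDensity A rows)) := by
  rw [colDensity_eq_rowDensity hA hp h]
  refine isProbabilityMeasure_rowLaw fun h0 => (frob_pos hA).ne' ?_
  rw [← sq_eq_zero_iff, ← frob_fkvS_sq hp h, ← frob_transpose, h0]
  simp [frob]

lemma fkvLaw_apply (A : Matrix (Fin m) (Fin n) ℝ) (p : ℕ)
    (s : Set ((Fin p → Fin m) × (Fin p → Fin n))) :
    fkvLaw A p s = ∫⁻ rows, (Measure.pi fun _ : Fin p => lawOf (colDensity A rows))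
      (Prod.mk rows ⁻¹' s) ∂Measure.pi fun _ : Fin p => lawOf (rowDensity A) := by
  rw [fkvLaw, Measure.bind_apply (MeasurableSet.of_discrete)
    (Measurable.of_discrete).aemeasurable]
  refine lintegral_congr fun rows => ?_
  rw [Measure.map_apply Measurable.of_discrete MeasurableSet.of_discrete]

lemma isProbabilityMeasure_fkvLaw (hA : A ≠ 0) (hp : 0 < p) :
    IsProbabilityMeasure (fkvLaw A p) := by
  have hprob := isProbabilityMeasure_rowLaw hA
  constructor
  rw [fkvLaw_apply]
  have h : ∀ᵐ rows ∂Measure.pi (fun _ : Fin p => lawOf (rowDensity A)),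
      (Measure.pi fun _ : Fin p => lawOf (colDensity A rows)) (Prod.mk rows ⁻¹' Set.univ) = 1 := by
    filter_upwards [ae_rows_ne_zero hA p] with rows hrows
    have := isProbabilityMeasure_colLaw hA hp hrows
    rw [Set.preimage_univ, measure_univ]
  rw [lintegral_congr_ae h, lintegral_one, measure_univ]

/-- The event that both the row sample and the column sample preserve Gram matrices up to a
relative Frobenius error `θ`. -/
def sketchEvent (A : Matrix (Fin m) (Fin n) ℝ) (p : ℕ) (θ : ℝ) :
    Set ((Fin p → Fin m) × (Fin p → Fin n)) :=
  {ω | frob (Aᵀ * A - (fkvS A ω.1)ᵀ * fkvS A ω.1) ≤ θ * frob A ^ 2 ∧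
    frob (fkvS A ω.1 * (fkvS A ω.1)ᵀ - fkvW A ω * (fkvW A ω)ᵀ) ≤ θ * frob A ^ 2 ∧
    frob (fkvW A ω) ^ 2 ≤ frob A ^ 2}

theorem ofReal_le_fkvLaw_sketchEvent (hA : A ≠ 0) {θ δ : ℝ} (hθ : 0 ≤ θ) (hδ : 0 < δ)
    (hδ1 : δ < 1) (hp : 32 * Real.log (2 / δ) ≤ p * θ ^ 2) :
    ENNReal.ofReal (1 - δ) ≤ fkvLaw A p (sketchEvent A p θ) := by
  have hlog : 1 / 2 < Real.log (2 / δ) := by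
    have h1 : Real.log 2 ≤ Real.log (2 / δ) :=
      Real.log_le_log two_pos (by rw [le_div_iff₀ hδ]; linarith)
    linarith [Real.log_two_gt_d9]
  have hp16 : 16 ≤ p * θ ^ 2 := by linarith
  have hp0 : 0 < p := by
    rcases Nat.eq_zero_or_pos p with rfl | h
    · norm_num at hp16
    · exact h
  have htail : Real.exp (-(p * θ ^ 2 / 32)) ≤ δ / 2 := by
    rw [← Real.le_log_iff_exp_le (by positivity), ← inv_div 2 δ, Real.log_inv]
    linarith
  have hprob := isProbabilityMeasure_rowLaw hA
  rw [fkvLaw_apply]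
  set μ := Measure.pi fun _ : Fin p => lawOf (rowDensity A) with hμ
  set R : Set (Fin p → Fin m) := {rows | (∀ r, A (rows r) ≠ 0) ∧
    frob (Aᵀ * A - (fkvS A rows)ᵀ * fkvS A rows) ≤ θ * frob A ^ 2} with hR
  have h1 : ENNReal.ofReal (1 - δ / 2) ≤ μ R := by
    refine ofReal_one_sub_le μ MeasurableSet.of_discrete ?_
      ((measure_fkvS_gram_ge_le hA hθ hp16).trans htail)
    filter_upwards [ae_rows_ne_zero hA p] with rows hrows hn
    exact ⟨hrows, (not_le.1 hn).le⟩
  have h2 : ∀ rows ∈ R, ENNReal.ofReal (1 - δ / 2) ≤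
      (Measure.pi fun _ : Fin p => lawOf (colDensity A rows))
        (Prod.mk rows ⁻¹' sketchEvent A p θ) := fun rows hrows => by
    have hcol := isProbabilityMeasure_colLaw hA hp0 hrows.1
    have hS : frob (fkvS A rows)ᵀ ^ 2 = frob A ^ 2 := by
      rw [frob_transpose, frob_fkvS_sq hp0 hrows.1]
    have hS0 : (fkvS A rows)ᵀ ≠ 0 := fun h0 => (frob_pos hA).ne' (by
      rw [← sq_eq_zero_iff, ← hS, h0]
      simp [frob])
    have h3 := (measure_fkvS_gram_ge_le (p := p) hS0 hθ hp16).trans htail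
    rw [← colDensity_eq_rowDensity hA hp0 hrows.1] at h3
    refine ofReal_one_sub_le _ MeasurableSet.of_discrete (ae_of_all _ fun cols hn => ?_) h3
    have h4 := fkvW_eq hA hp0 (rows, cols) hrows.1
    refine ⟨hrows.2, ?_, ?_⟩
    · rw [Set.mem_ofPred_eq, not_le, hS, transpose_transpose] at hn
      rw [h4, transpose_transpose]
      exact hn.le
    · rw [h4, frob_transpose]
      exact (frob_fkvS_sq_le _ _).trans_eq hS
  calc ENNReal.ofReal (1 - δ) ≤ ENNReal.ofReal (1 - δ / 2) * ENNReal.ofReal (1 - δ / 2) := by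
        rw [← ENNReal.ofReal_mul (by linarith)]
        exact ENNReal.ofReal_le_ofReal (by nlinarith)
    _ ≤ ENNReal.ofReal (1 - δ / 2) * μ R := by gcongr
    _ = ∫⁻ _ in R, ENNReal.ofReal (1 - δ / 2) ∂μ := by rw [setLIntegral_const]
    _ ≤ ∫⁻ rows in R, (Measure.pi fun _ : Fin p => lawOf (colDensity A rows))
        (Prod.mk rows ⁻¹' sketchEvent A p θ) ∂μ :=
        setLIntegral_mono' MeasurableSet.of_discrete h2
    _ ≤ _ := setLIntegral_le_lintegral _ _

end FkvLaw

/-! ### Medians of means -/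

section Curry

variable {ι κ α : Type*} [Fintype ι] [Fintype κ] [MeasurableSpace α]

lemma measurePreserving_curry (μ : Measure α) [IsProbabilityMeasure μ] :
    MeasurePreserving (MeasurableEquiv.curry ι κ α) (Measure.pi fun _ : ι × κ => μ)
      (Measure.pi fun _ : ι => Measure.pi fun _ : κ => μ) := by
  refine ⟨MeasurableEquiv.measurable _, ?_⟩
  simp only [← Measure.infinitePi_eq_pi]
  exact Measure.infinitePi_map_curry fun _ _ => μ

/-- Events on disjoint blocks of independent coordinates are independent. -/
lemma pi_block_event (μ : Measure α) [IsProbabilityMeasure μ] (s : ι → Set (κ → α)) :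
    (Measure.pi fun _ : ι × κ => μ) {ω | ∀ i, (fun j => ω (i, j)) ∈ s i} =
      ∏ i, (Measure.pi fun _ : κ => μ) (s i) := by
  rw [← Measure.pi_pi, ← (measurePreserving_curry μ).measure_preimage_equiv]
  congr 1
  ext ω
  simp only [Set.mem_ofPred_eq, Set.mem_preimage, Set.mem_pi, Set.mem_univ, forall_true_left]
  rfl

end Curry

/-- If the median is off by more than `τ`, then so is at least half of the values. -/
lemma le_two_mul_card_of_median {N : ℕ} (f : Fin N → ℝ) {v τ : ℝ} (hN : 0 < N)
    (h : τ < |median f - v|) :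
    N ≤ 2 * (Finset.univ.filter fun g => τ < |f g - v|).card := by
  have hhalf : N / 2 < N := Nat.div_lt_self hN one_lt_two
  have hmed : median f = f (Tuple.sort f ⟨N / 2, hhalf⟩) := by rw [median, dif_pos hN]
  have hmono : Monotone (f ∘ Tuple.sort f) := Tuple.monotone_sort f
  rcases lt_abs.1 h with h1 | h1
  · have hcard : (Finset.Ici (⟨N / 2, hhalf⟩ : Fin N)).card ≤
        (Finset.univ.filter fun g => τ < |f g - v|).card := by
      refine Finset.card_le_card_of_injOn (Tuple.sort f) (fun i hi => ?_)
        (Tuple.sort f).injective.injOn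
      have h2 : median f ≤ f (Tuple.sort f i) := by
        rw [hmed]
        exact hmono (Finset.mem_Ici.1 (Finset.mem_coe.1 hi))
      simp only [Finset.coe_filter, Finset.mem_univ, true_and, Set.mem_ofPred_eq]
      exact lt_abs.2 (Or.inl (by linarith))
    rw [Fin.card_Ici] at hcard
    simp only at hcard
    omega
  · have hcard : (Finset.Iic (⟨N / 2, hhalf⟩ : Fin N)).card ≤
        (Finset.univ.filter fun g => τ < |f g - v|).card := by
      refine Finset.card_le_card_of_injOn (Tuple.sort f) (fun i hi => ?_)
        (Tuple.sort f).injective.injOn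
      have h2 : f (Tuple.sort f i) ≤ median f := by
        rw [hmed]
        exact hmono (Finset.mem_Iic.1 (Finset.mem_coe.1 hi))
      simp only [Finset.coe_filter, Finset.mem_univ, true_and, Set.mem_ofPred_eq]
      exact lt_abs.2 (Or.inr (by linarith))
    rw [Fin.card_Iic] at hcard
    simp only at hcard
    omega

/-- Among `N` independent trials that each fail with probability at most `1 / 16`, half of them
fail with probability at most `2⁻ᴺ`. -/
lemma measure_half_bad_le {β : Type*} [Finite β] [MeasurableSpace β] [MeasurableSingletonClass β]
    (ν : Measure β) [IsProbabilityMeasure ν] (P : β → Prop) [DecidablePred P]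
    (hbad : ν.real {x | P x} ≤ 1 / 16) (N : ℕ) :
    (Measure.pi fun _ : Fin N => ν).real
      {η | N ≤ 2 * (Finset.univ.filter fun g => P (η g)).card} ≤ (1 / 2) ^ N := by
  set w : β → ℝ := fun x => if P x then 16 else 1 with hw
  -- exponential Markov inequality: `16 ^ #bad ≥ 4 ^ N` on the event
  have hprod : ∀ η : Fin N → β,
      ∏ g, w (η g) = 16 ^ (Finset.univ.filter fun g => P (η g)).card := fun η => by
    rw [hw]
    simp only
    rw [Finset.prod_ite, Finset.prod_const, Finset.prod_const_one, mul_one]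
  have h1 := mul_meas_ge_le_integral_of_nonneg (μ := Measure.pi fun _ : Fin N => ν)
    (f := fun η => ∏ g, w (η g)) (ae_of_all _ fun η => by
      simp only [hprod]; positivity) Integrable.of_finite (4 ^ N)
  rw [integral_fintype_prod_eq_pow, Fintype.card_fin] at h1
  have hint : ∫ x, w x ∂ν ≤ 2 := by
    have h2 : w = fun x => 1 + {x | P x}.indicator (fun _ => (15 : ℝ)) x := by
      ext x
      by_cases hx : P x
      · simp [hw, hx]; norm_num
      · simp [hw, hx]
    rw [h2, integral_add Integrable.of_finite Integrable.of_finite,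
      integral_indicator MeasurableSet.of_discrete, setIntegral_const]
    simp only [integral_const, probReal_univ, smul_eq_mul]
    linarith
  have hint0 : 0 ≤ ∫ x, w x ∂ν := integral_nonneg fun x => by
    simp only [hw]; split_ifs <;> norm_num
  have h3 : (Measure.pi fun _ : Fin N => ν).real
      {η | N ≤ 2 * (Finset.univ.filter fun g => P (η g)).card} ≤
      (Measure.pi fun _ : Fin N => ν).real {η | (4 : ℝ) ^ N ≤ ∏ g, w (η g)} := by
    refine measureReal_mono fun η hη => ?_
    rw [Set.mem_ofPred_eq] at hη ⊢
    rw [hprod]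
    calc (4 : ℝ) ^ N ≤ 4 ^ (2 * (Finset.univ.filter fun g => P (η g)).card) :=
          pow_le_pow_right₀ (by norm_num) hη
      _ = _ := by rw [pow_mul]; norm_num
  have h4 := h1.trans (pow_le_pow_left₀ hint0 hint N)
  refine h3.trans ?_
  have h5 : ((1 : ℝ) / 2) ^ N = 2 ^ N / 4 ^ N := by rw [← div_pow]; norm_num
  rw [h5, le_div_iff₀ (by positivity), mul_comm]
  exact h4

/-- Chebyshev's inequality for the mean of `q` independent samples. -/
lemma measure_mean_sub_gt_le {α : Type*} [Finite α] [MeasurableSpace α]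
    [MeasurableSingletonClass α] (μ : Measure α) [IsProbabilityMeasure μ] {Z : α → ℝ} {v b τ : ℝ}
    (hmean : ∫ a, Z a ∂μ = v) (hsq : ∫ a, Z a ^ 2 ∂μ ≤ b ^ 2) {q : ℕ} (hq : 0 < q)
    (hτ : 0 < τ) (hqτ : 16 * b ^ 2 ≤ q * τ ^ 2) :
    (Measure.pi fun _ : Fin q => μ).real {ω | τ < |1 / (q : ℝ) * ∑ l, Z (ω l) - v|} ≤ 1 / 16 := by
  have hq0 : (0 : ℝ) < q := by exact_mod_cast hq
  have h0 : ∫ a, (Z a - v) ∂μ = 0 := by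
    rw [integral_sub Integrable.of_finite Integrable.of_finite, hmean]
    simp
  have hvar : ∫ a, ‖Z a - v‖ ^ 2 ∂μ ≤ b ^ 2 := by
    have h1 : ∀ a, ‖Z a - v‖ ^ 2 = Z a ^ 2 - v * (2 * (Z a - v) + v) := fun a => by
      rw [Real.norm_eq_abs, sq_abs]; ring
    simp only [h1]
    rw [integral_sub Integrable.of_finite Integrable.of_finite, integral_const_mul,
      integral_add Integrable.of_finite Integrable.of_finite, integral_const_mul, h0]
    simp only [integral_const, probReal_univ, smul_eq_mul]
    nlinarith [sq_nonneg v]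
  have h2 := integral_norm_sum_sq_le μ (Y := fun a => Z a - v) hvar h0 q 0
  have h3 := mul_meas_ge_le_integral_of_nonneg (μ := Measure.pi fun _ : Fin q => μ)
    (f := fun ω => ‖0 + ∑ i, (Z (ω i) - v)‖ ^ 2) (ae_of_all _ fun ω => sq_nonneg _)
    Integrable.of_finite ((q * τ) ^ 2)
  have h4 : (Measure.pi fun _ : Fin q => μ).real {ω | τ < |1 / (q : ℝ) * ∑ l, Z (ω l) - v|} ≤
      (Measure.pi fun _ : Fin q => μ).real
        {ω | (q * τ) ^ 2 ≤ ‖0 + ∑ i, (Z (ω i) - v)‖ ^ 2} := by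
    refine measureReal_mono fun ω hω => ?_
    rw [Set.mem_ofPred_eq] at hω ⊢
    refine pow_le_pow_left₀ (by positivity) ?_ 2
    have h5 : 0 + ∑ i, (Z (ω i) - v) = q * (1 / (q : ℝ) * ∑ l, Z (ω l) - v) := by
      rw [zero_add, Finset.sum_sub_distrib, Finset.sum_const, Finset.card_univ, Fintype.card_fin,
        nsmul_eq_mul]
      field_simp
    rw [h5, norm_mul, Real.norm_eq_abs, Real.norm_eq_abs, Nat.abs_cast]
    exact mul_le_mul_of_nonneg_left hω.le hq0.le
  refine h4.trans ?_
  have h6 : (q * τ) ^ 2 * (Measure.pi fun _ : Fin q => μ).real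
        {ω | (q * τ) ^ 2 ≤ ‖0 + ∑ i, (Z (ω i) - v)‖ ^ 2} ≤ (q * τ) ^ 2 * (1 / 16) := by
    refine (h3.trans h2).trans ?_
    rw [norm_zero]
    nlinarith
  exact le_of_mul_le_mul_left h6 (by positivity)

/-! ### The entrywise estimate of a matrix product -/

section Estimate

variable {m n k : ℕ} {A : Matrix (Fin m) (Fin n) ℝ}

lemma l2norm_entries (A : Matrix (Fin m) (Fin n) ℝ) :
    l2norm (fun ij : Fin m × Fin n => A ij.1 ij.2) = frob A := (frob_eq_l2norm A).symm

lemma entries_ne_zero (hA : A ≠ 0) : (fun ij : Fin m × Fin n => A ij.1 ij.2) ≠ 0 := fun h =>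
  hA (by ext i j; exact congrFun h (i, j))

lemma isProbabilityMeasure_entry (hA : A ≠ 0) :
    IsProbabilityMeasure (lawOf (l2Density fun ij : Fin m × Fin n => A ij.1 ij.2)) :=
  isProbabilityMeasure_lawOf (l2Density_nonneg _) (sum_l2Density (entries_ne_zero hA))

/-- The single-sample estimator is unbiased. -/
lemma integral_estimator (hA : A ≠ 0) (L : Matrix (Fin k) (Fin m) ℝ) (R : Matrix (Fin n) (Fin k) ℝ)
    (a b : Fin k) :
    ∫ ij, frob A ^ 2 * L a ij.1 * R ij.2 b / A ij.1 ij.2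
      ∂lawOf (l2Density fun ij : Fin m × Fin n => A ij.1 ij.2) = (L * A * R) a b := by
  have hF := (frob_pos hA).ne'
  rw [integral_lawOf (l2Density_nonneg _) (sum_l2Density (entries_ne_zero hA)),
    Fintype.sum_prod_type, Finset.sum_comm, Matrix.mul_apply]
  refine Finset.sum_congr rfl fun j _ => ?_
  rw [Matrix.mul_apply, Finset.sum_mul]
  refine Finset.sum_congr rfl fun i _ => ?_
  rw [l2Density, l2norm_entries, smul_eq_mul]
  by_cases h : A i j = 0
  · simp [h]
  · field_simp

lemma integral_estimator_sq_le (hA : A ≠ 0) (L : Matrix (Fin k) (Fin m) ℝ)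
    (R : Matrix (Fin n) (Fin k) ℝ) (a b : Fin k) :
    ∫ ij, (frob A ^ 2 * L a ij.1 * R ij.2 b / A ij.1 ij.2) ^ 2
      ∂lawOf (l2Density fun ij : Fin m × Fin n => A ij.1 ij.2) ≤
        (frob A * l2norm (L a) * l2norm (R.col b)) ^ 2 := by
  have hF := (frob_pos hA).ne'
  rw [integral_lawOf (l2Density_nonneg _) (sum_l2Density (entries_ne_zero hA)),
    Fintype.sum_prod_type, mul_pow, mul_pow, l2norm_sq (L a), l2norm_sq (R.col b), mul_assoc,
    Finset.sum_mul_sum, Finset.mul_sum]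
  refine Finset.sum_le_sum fun i _ => ?_
  rw [Finset.mul_sum]
  refine Finset.sum_le_sum fun j _ => ?_
  rw [l2Density, l2norm_entries, smul_eq_mul, Matrix.col_apply]
  by_cases h : A i j = 0
  · simp only [h]
    norm_num
    positivity
  · refine le_of_eq ?_
    field_simp

/-- With the prescribed sample sizes, every entry of the estimate is accurate with the prescribed
probability; the entries use independent samples, so the success probabilities multiply. -/
theorem ofReal_le_entryLaw (hA : A ≠ 0) (L : Matrix (Fin k) (Fin m) ℝ)
    (R : Matrix (Fin n) (Fin k) ℝ) (hk : 0 < k) {b ζ η : ℝ} (hb : 0 < b)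
    (hLR : ∀ s t, frob A * l2norm (L s) * l2norm (R.col t) ≤ b) (hζ : 0 < ζ) (hη : 0 < η)
    (hη1 : η < 1) :
    ENNReal.ofReal (1 - η) ≤ entryLaw A k (medianSize 32 k η) (meanSize 32 ζ)
      {ω | ∀ s t, |estimate A L R ω s t - (L * A * R) s t| ≤ ζ * b} := by
  classical
  have hprob := isProbabilityMeasure_entry hA
  set μ := lawOf (l2Density fun ij : Fin m × Fin n => A ij.1 ij.2) with hμ
  set q := meanSize 32 ζ with hq
  set G := medianSize 32 k η with hG
  set η' := 1 - (1 - η) ^ (1 / (k : ℝ) ^ 2) with hη'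
  have hk0 : (0 : ℝ) < k := by exact_mod_cast hk
  have hη'0 : 0 < η' := by
    have := Real.rpow_lt_one (by linarith : 0 ≤ 1 - η) (by linarith) (by positivity : 0 < 1 / (k : ℝ) ^ 2)
    linarith
  have hη'1 : η' < 1 := by
    have := Real.rpow_pos_of_pos (by linarith : 0 < 1 - η) (1 / (k : ℝ) ^ 2)
    linarith
  have hqζ : 32 ≤ q * ζ ^ 2 := by
    rw [← div_le_iff₀ (by positivity)]
    exact Nat.le_ceil _
  have hq0 : 0 < q := by
    rw [hq, meanSize, Nat.ceil_pos]
    positivity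
  have hlog : Real.log 2 ≤ Real.log (2 / η') :=
    Real.log_le_log two_pos (by rw [le_div_iff₀ hη'0]; linarith)
  have hlog2 := Real.log_two_gt_d9
  have hGlog : 32 * Real.log (2 / η') ≤ G := Nat.le_ceil _
  have hG0 : 0 < G := by
    have : (0 : ℝ) < G := by linarith
    exact_mod_cast this
  have htail : ((1 : ℝ) / 2) ^ G ≤ η' := by
    have h1 : ((1 : ℝ) / 2) ^ G = Real.exp (-(G * Real.log 2)) := by
      rw [Real.exp_neg, Real.exp_nat_mul, Real.exp_log two_pos, one_div, inv_pow]
    have h2 : Real.log (2 / η') = Real.log 2 - Real.log η' := Real.log_div two_ne_zero hη'0.ne'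
    rw [h1, ← Real.le_log_iff_exp_le hη'0]
    nlinarith
  have hentry : ∀ s t, ENNReal.ofReal (1 - η') ≤ (Measure.pi fun _ : Fin G × Fin q => μ)
      {ω | |median (fun g : Fin G => (1 / (q : ℝ)) * ∑ l : Fin q,
        frob A ^ 2 * L s (ω (g, l)).1 * R (ω (g, l)).2 t / A (ω (g, l)).1 (ω (g, l)).2) -
          (L * A * R) s t| ≤ ζ * b} := fun s t => by
    set Z : Fin m × Fin n → ℝ := fun ij => frob A ^ 2 * L s ij.1 * R ij.2 t / A ij.1 ij.2 with hZ
    set v := (L * A * R) s t with hv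
    have h0 : 0 ≤ frob A * l2norm (L s) * l2norm (R.col t) :=
      mul_nonneg (mul_nonneg (frob_nonneg _) (l2norm_nonneg _)) (l2norm_nonneg _)
    have hcheb := measure_mean_sub_gt_le μ (Z := Z) (v := v) (b := b) (τ := ζ * b)
      (integral_estimator hA L R s t)
      ((integral_estimator_sq_le hA L R s t).trans (pow_le_pow_left₀ h0 (hLR s t) 2)) hq0
      (by positivity) (by rw [mul_pow]; nlinarith [pow_pos hb 2])
    have hhalf := (measure_half_bad_le (Measure.pi fun _ : Fin q => μ)
      (fun x => ζ * b < |1 / (q : ℝ) * ∑ l, Z (x l) - v|) hcheb G).trans htail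
    have h1 := ofReal_one_sub_le (Measure.pi fun _ : Fin G => Measure.pi fun _ : Fin q => μ)
      (t := {x | |median (fun g : Fin G => (1 / (q : ℝ)) * ∑ l : Fin q, Z (x g l)) - v| ≤ ζ * b})
      MeasurableSet.of_discrete (ae_of_all _ fun x hx => ?_) hhalf
    · rw [← (measurePreserving_curry μ).measure_preimage_equiv] at h1
      exact h1
    · by_contra hbad
      exact hx (le_two_mul_card_of_median _ hG0 (not_le.1 hbad))
  have hset : {ω : Fin k × Fin k × Fin G × Fin q → Fin m × Fin n |
      ∀ s t, |estimate A L R ω s t - (L * A * R) s t| ≤ ζ * b} =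
      {ω | ∀ s, (fun j => ω (s, j)) ∈ {ω' : Fin k × Fin G × Fin q → Fin m × Fin n |
        ∀ t, (fun j => ω' (t, j)) ∈ {ω'' : Fin G × Fin q → Fin m × Fin n |
          |median (fun g : Fin G => (1 / (q : ℝ)) * ∑ l : Fin q,
            frob A ^ 2 * L s (ω'' (g, l)).1 * R (ω'' (g, l)).2 t /
              A (ω'' (g, l)).1 (ω'' (g, l)).2) - (L * A * R) s t| ≤ ζ * b}}} := rfl
  rw [hset, entryLaw, pi_block_event]
  simp only [pi_block_event]
  have hpow : (1 - η') ^ (k * k) = 1 - η := by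
    rw [hη', sub_sub_cancel, ← Real.rpow_natCast, ← Real.rpow_mul (by linarith)]
    push_cast
    rw [show 1 / (k : ℝ) ^ 2 * (k * k) = 1 by field_simp, Real.rpow_one]
  calc ENNReal.ofReal (1 - η) = ∏ _s : Fin k, ∏ _t : Fin k, ENNReal.ofReal (1 - η') := by
        simp only [Finset.prod_const, Finset.card_univ, Fintype.card_fin]
        rw [← hpow, ← pow_mul, ENNReal.ofReal_pow (by linarith)]
    _ ≤ _ := Finset.prod_le_prod' fun s _ => Finset.prod_le_prod' fun t _ => hentry s t

end Estimate

/-! ### Rejection sampling -/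

section Rejection

variable {m k : ℕ}

lemma runOutput_cons {T : ℕ} (w : Fin k × Fin m × Bool) (ω : Fin T → Fin k × Fin m × Bool) :
    runOutput (Fin.cons w ω : Fin (T + 1) → Fin k × Fin m × Bool) =
      if w.2.2 then some w.2.1 else runOutput ω := by
  rw [runOutput, List.ofFn_succ, List.findSome?_cons, Fin.cons_zero]
  simp only [Fin.cons_succ]
  by_cases h : w.2.2 = true <;> simp [h, runOutput]

lemma pi_real_succ {α : Type*} [Finite α] [MeasurableSpace α] [MeasurableSingletonClass α]
    (μ : Measure α) [IsProbabilityMeasure μ] {T : ℕ} (s : Set (Fin (T + 1) → α)) :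
    (Measure.pi fun _ => μ).real s =
      ∫ a, (Measure.pi fun _ : Fin T => μ).real {ω | (Fin.cons a ω : Fin (T + 1) → α) ∈ s} ∂μ := by
  rw [← integral_indicator_one MeasurableSet.of_discrete, integral_pi_succ]
  refine integral_congr_ae (ae_of_all _ fun a => ?_)
  simp only
  rw [← integral_indicator_one MeasurableSet.of_discrete]
  rfl

variable (μ : Measure (Fin k × Fin m × Bool)) [IsProbabilityMeasure μ]

/-- Conditioning on the first trial: either it accepts, or the remaining trials decide. -/
lemma run_real_succ (T : ℕ) (Q : Option (Fin m) → Prop) :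
    (Measure.pi fun _ : Fin (T + 1) => μ).real {ω | Q (runOutput ω)} =
      μ.real {w | w.2.2 = true ∧ Q (some w.2.1)} +
        μ.real {w | ¬ w.2.2 = true} *
          (Measure.pi fun _ : Fin T => μ).real {ω | Q (runOutput ω)} := by
  classical
  set c := (Measure.pi fun _ : Fin T => μ).real {ω | Q (runOutput ω)} with hc
  rw [pi_real_succ]
  have h : ∀ w : Fin k × Fin m × Bool, (Measure.pi fun _ : Fin T => μ).real
      {ω | (Fin.cons w ω : Fin (T + 1) → _) ∈
        {ω : Fin (T + 1) → Fin k × Fin m × Bool | Q (runOutput ω)}} =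
      {w : Fin k × Fin m × Bool | w.2.2 = true ∧ Q (some w.2.1)}.indicator 1 w +
        c * {w : Fin k × Fin m × Bool | ¬ w.2.2 = true}.indicator 1 w := fun w => by
    simp only [Set.mem_ofPred_eq, runOutput_cons]
    by_cases h1 : w.2.2 = true
    · by_cases h2 : Q (some w.2.1) <;> simp [h1, h2]
    · simp only [h1]
      simp [h1, hc]
  simp only [h]
  rw [integral_add Integrable.of_finite Integrable.of_finite, integral_const_mul,
    integral_indicator_one MeasurableSet.of_discrete,
    integral_indicator_one MeasurableSet.of_discrete, mul_comm c]

lemma run_real_none (T : ℕ) :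
    (Measure.pi fun _ : Fin T => μ).real {ω | runOutput ω = none} =
      μ.real {w | ¬ w.2.2 = true} ^ T := by
  induction T with
  | zero => simp [runOutput]
  | succ T ih =>
    rw [run_real_succ μ T (fun o => o = none), ih]
    simp [pow_succ']

lemma run_real_some_mul (T : ℕ) (l : Fin m) :
    μ.real {w | w.2.2 = true} * (Measure.pi fun _ : Fin T => μ).real {ω | runOutput ω = some l} =
      μ.real {w | w.2.2 = true ∧ w.2.1 = l} *
        (Measure.pi fun _ : Fin T => μ).real {ω | runOutput ω ≠ none} := by
  induction T with
  | zero => simp [runOutput]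
  | succ T ih =>
    rw [run_real_succ μ T (fun o => o = some l), run_real_succ μ T (fun o => o ≠ none)]
    simp only [Option.some.injEq, ne_eq, reduceCtorEq, not_false_eq_true, and_true]
    rw [mul_add, mul_add, mul_left_comm, ih]
    simp only [ne_eq]
    ring

end Rejection

section Trial

variable {m k : ℕ} {U : Matrix (Fin m) (Fin k) ℝ} {y : Fin k → ℝ}

/-- The normalization `∑ j, ‖y_j U^(j)‖²` of the proposal distribution. -/
noncomputable def proposalMass (U : Matrix (Fin m) (Fin k) ℝ) (y : Fin k → ℝ) : ℝ :=
  ∑ j, l2norm (y j • U.col j) ^ 2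

lemma mulVec_apply_sq_le (U : Matrix (Fin m) (Fin k) ℝ) (y : Fin k → ℝ) (l : Fin m) :
    (U *ᵥ y) l ^ 2 ≤ k * ∑ j, (y j * U l j) ^ 2 := by
  have h := sq_sum_le_card_mul_sum_sq (s := Finset.univ) (f := fun j => y j * U l j)
  rw [Finset.card_univ, Fintype.card_fin] at h
  have h1 : (U *ᵥ y) l = ∑ j, y j * U l j := by
    rw [mulVec, dotProduct]
    exact Finset.sum_congr rfl fun j _ => mul_comm _ _
  rwa [h1]

lemma acceptProb_nonneg (U : Matrix (Fin m) (Fin k) ℝ) (y : Fin k → ℝ) (l : Fin m) :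
    0 ≤ acceptProb U y l :=
  div_nonneg (sq_nonneg _) (mul_nonneg (Nat.cast_nonneg _)
    (Finset.sum_nonneg fun _ _ => sq_nonneg _))

lemma acceptProb_le_one (U : Matrix (Fin m) (Fin k) ℝ) (y : Fin k → ℝ) (l : Fin m) :
    acceptProb U y l ≤ 1 :=
  div_le_one_of_le₀ (mulVec_apply_sq_le U y l) (mul_nonneg (Nat.cast_nonneg _)
    (Finset.sum_nonneg fun _ _ => sq_nonneg _))

lemma trialDensity_nonneg (U : Matrix (Fin m) (Fin k) ℝ) (y : Fin k → ℝ)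
    (w : Fin k × Fin m × Bool) : 0 ≤ trialDensity U y w := by
  refine mul_nonneg (mul_nonneg (l2Density_nonneg _ _) (l2Density_nonneg _ _)) ?_
  split_ifs
  · exact acceptProb_nonneg _ _ _
  · linarith [acceptProb_le_one U y w.2.1]

variable (hU : ∀ j, U.col j ≠ 0) (hy : y ≠ 0)

include hU hy

lemma proposal_ne_zero : (fun j => l2norm (y j • U.col j)) ≠ 0 := fun h => hy <| by
  ext j
  have h1 := l2norm_eq_zero.1 (congrFun h j)
  exact (smul_eq_zero.1 h1).resolve_right (hU j)

lemma proposalMass_pos : 0 < proposalMass U y := by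
  have h := l2norm_pos (proposal_ne_zero hU hy)
  rw [proposalMass, ← l2norm_sq]
  positivity

lemma isProbabilityMeasure_trial : IsProbabilityMeasure (lawOf (trialDensity U y)) := by
  refine isProbabilityMeasure_lawOf (trialDensity_nonneg U y) ?_
  simp only [Fintype.sum_prod_type, trialDensity, Fintype.sum_bool, if_true, ← mul_add]
  simp only [Bool.false_eq_true, if_false, add_sub_cancel, mul_one, ← Finset.mul_sum]
  simp only [sum_l2Density (hU _), mul_one]
  exact sum_l2Density (proposal_ne_zero hU hy)

/-- The mixture of the column distributions has density proportional to `∑ j, (y_j U_lj)²`, which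
the acceptance probability replaces by `(U y)_l² / k`. -/
lemma trial_accept_real (l : Fin m) :
    (lawOf (trialDensity U y)).real {w | w.2.2 = true ∧ w.2.1 = l} =
      (U *ᵥ y) l ^ 2 / (k * proposalMass U y) := by
  classical
  have hZ := (proposalMass_pos hU hy).ne'
  rw [lawOf_real_apply (trialDensity_nonneg U y)]
  simp only [Fintype.sum_prod_type, Fintype.sum_bool, Set.indicator_apply, Set.mem_ofPred_eq,
    true_and, Bool.false_eq_true, false_and, if_false, add_zero, Finset.sum_ite_eq',
    Finset.mem_univ, if_true, trialDensity]
  have h1 : ∀ j, l2Density (fun j => l2norm (y j • U.col j)) j * l2Density (U.col j) l *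
      acceptProb U y l = acceptProb U y l / proposalMass U y * (y j * U l j) ^ 2 := fun j => by
    have h2 := (l2norm_pos (hU j)).ne'
    rw [l2Density, l2Density, l2norm_sq (fun j => l2norm (y j • U.col j)), ← proposalMass,
      l2norm_smul, mul_pow, sq_abs, Matrix.col_apply]
    field_simp
  rw [Finset.sum_congr rfl fun j _ => h1 j, ← Finset.mul_sum, acceptProb]
  by_cases h0 : ∑ j, (y j * U l j) ^ 2 = 0
  · have h2 := mulVec_apply_sq_le U y l
    rw [h0, mul_zero] at h2
    rw [h0, mul_zero, le_antisymm h2 (sq_nonneg _), zero_div]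
  · generalize ∑ j, (y j * U l j) ^ 2 = x at h0
    field_simp

lemma trial_accept_real_total :
    (lawOf (trialDensity U y)).real {w | w.2.2 = true} =
      l2norm (U *ᵥ y) ^ 2 / (k * proposalMass U y) := by
  have hprob := isProbabilityMeasure_trial hU hy
  have h : {w : Fin k × Fin m × Bool | w.2.2 = true} =
      ⋃ l ∈ (Finset.univ : Finset (Fin m)), {w | w.2.2 = true ∧ w.2.1 = l} := by
    ext w; simp
  rw [h, measureReal_biUnion_finset (fun l _ l' _ hl => ?_) fun _ _ => MeasurableSet.of_discrete,
    l2norm_sq, Finset.sum_div]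
  · exact Finset.sum_congr rfl fun l _ => trial_accept_real hU hy l
  · refine Set.disjoint_left.2 fun w hw hw' => hl (hw.2.symm.trans hw'.2)

/-- Given that a run does not fail, its output has exactly the target distribution. -/
theorem outputDensity_eq {T : ℕ} (hT : 0 < T) (hUy : U *ᵥ y ≠ 0) :
    outputDensity U y T = l2Density (U *ᵥ y) := by
  have hprob := isProbabilityMeasure_trial hU hy
  have hk : (0 : ℝ) < k := by
    rcases Nat.eq_zero_or_pos k with rfl | hk
    · exact absurd (Subsingleton.elim y 0) hy
    · exact_mod_cast hk
  have hZ := proposalMass_pos hU hy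
  have hN := l2norm_pos hUy
  set μ := lawOf (trialDensity U y) with hμ
  have ha : 0 < μ.real {w | w.2.2 = true} := by
    rw [trial_accept_real_total hU hy]
    positivity
  have hfail : μ.real {w | ¬ w.2.2 = true} < 1 := by
    have := probReal_compl_eq_one_sub (μ := μ) (s := {w | w.2.2 = true}) MeasurableSet.of_discrete
    have h1 : μ.real {w | ¬ w.2.2 = true} = 1 - μ.real {w | w.2.2 = true} := this
    linarith
  have hsucc : 0 < (runLaw U y T).real {w | runOutput w ≠ none} := by
    have h1 := probReal_compl_eq_one_sub (μ := Measure.pi fun _ : Fin T => μ)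
      (s := {w | runOutput w = none}) MeasurableSet.of_discrete
    rw [run_real_none] at h1
    have h2 := pow_lt_one₀ measureReal_nonneg hfail hT.ne'
    change 0 < (Measure.pi fun _ : Fin T => μ).real {w | runOutput w = none}ᶜ
    rw [h1]
    linarith
  ext l
  have h := run_real_some_mul μ T l
  rw [trial_accept_real hU hy, trial_accept_real_total hU hy] at h
  change _ * (runLaw U y T).real _ = _ * (runLaw U y T).real _ at h
  rw [outputDensity, l2Density, div_eq_div_iff hsucc.ne' (by positivity)]
  field_simp at h
  linarith

end Trial

section Run

variable {m k : ℕ} {U : Matrix (Fin m) (Fin k) ℝ} {y : Fin k → ℝ}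

lemma col_bounds_of_gram_close (hU : frob (Uᵀ * U - 1) ≤ 1 / 4) (j : Fin k) :
    3 / 4 ≤ l2norm (U.col j) ^ 2 ∧ l2norm (U.col j) ^ 2 ≤ 5 / 4 := by
  have h := l2norm_le_of_gram_close U (Pi.single j 1)
  have h1 : l2norm (Pi.single j 1 : Fin k → ℝ) ^ 2 = 1 := by
    rw [l2norm_sq, Finset.sum_eq_single j] <;> simp +contextual
  rw [h1, Matrix.mulVec_single_one] at h
  constructor <;> linarith [h.1, h.2]

lemma col_ne_zero_of_gram_close (hU : frob (Uᵀ * U - 1) ≤ 1 / 4) (j : Fin k) : U.col j ≠ 0 := by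
  intro h
  have := (col_bounds_of_gram_close hU j).1
  rw [h, l2norm_zero] at this
  norm_num at this

/-- For nearly orthonormal columns a trial accepts with probability at least `1 / (2 k)`, so a run
of the prescribed length fails with probability at most `γ`. -/
theorem ofReal_le_runLaw (hU : frob (Uᵀ * U - 1) ≤ 1 / 4) (hy : y ≠ 0) {γ : ℝ} (hγ : 0 < γ)
    (hγ1 : γ < 1) :
    ENNReal.ofReal (1 - γ) ≤ runLaw U y (trialCount 32 k γ) {w | runOutput w ≠ none} := by
  have hcol := col_ne_zero_of_gram_close hU
  have hprob := isProbabilityMeasure_trial hcol hy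
  have hk : (0 : ℝ) < k := by
    rcases Nat.eq_zero_or_pos k with rfl | hk
    · exact absurd (Subsingleton.elim y 0) hy
    · exact_mod_cast hk
  have hZ := proposalMass_pos hcol hy
  set μ := lawOf (trialDensity U y) with hμ
  set T := trialCount 32 k γ with hT
  have ha : 1 / (2 * k) ≤ μ.real {w | w.2.2 = true} := by
    rw [trial_accept_real_total hcol hy, div_le_div_iff₀ (by positivity) (by positivity)]
    have h1 := (l2norm_le_of_gram_close U y).1
    have h2 : proposalMass U y ≤ 5 / 4 * l2norm y ^ 2 := by
      rw [proposalMass, l2norm_sq, Finset.mul_sum]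
      refine Finset.sum_le_sum fun j _ => ?_
      rw [l2norm_smul, mul_pow, sq_abs, mul_comm]
      exact mul_le_mul_of_nonneg_right (col_bounds_of_gram_close hU j).2 (sq_nonneg _)
    have h3 : 3 / 4 * l2norm y ^ 2 ≤ l2norm (U *ᵥ y) ^ 2 := by
      nlinarith [sq_nonneg (l2norm y)]
    nlinarith [sq_nonneg (l2norm y)]
  have hfail : μ.real {w | ¬ w.2.2 = true} ≤ Real.exp (-(1 / (2 * k))) := by
    have h1 : μ.real {w | ¬ w.2.2 = true} = 1 - μ.real {w | w.2.2 = true} :=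
      probReal_compl_eq_one_sub MeasurableSet.of_discrete
    linarith [Real.add_one_le_exp (-(1 / (2 * k : ℝ)))]
  have hlog : 0 < Real.log (2 / γ) := Real.log_pos (by rw [lt_div_iff₀ hγ]; linarith)
  have hTk : 32 * k * Real.log (2 / γ) ≤ T := Nat.le_ceil _
  have h2 : (Measure.pi fun _ : Fin T => μ).real {w | runOutput w = none} ≤ γ := by
    rw [run_real_none]
    refine (pow_le_pow_left₀ measureReal_nonneg hfail T).trans ?_
    rw [← Real.exp_nat_mul, ← Real.le_log_iff_exp_le hγ]
    have h3 : Real.log (2 / γ) = Real.log 2 - Real.log γ := Real.log_div two_ne_zero hγ.ne'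
    have h4 : 16 * Real.log (2 / γ) ≤ T * (1 / (2 * k)) := by
      rw [mul_one_div, le_div_iff₀ (by positivity)]
      linarith
    have h5 : 0 < Real.log 2 := Real.log_pos one_lt_two
    linarith
  exact ofReal_one_sub_le (Measure.pi fun _ : Fin T => μ) MeasurableSet.of_discrete
    (ae_of_all _ fun w hw => hw) h2

end Run

/-! ### Total variation distance of length-squared distributions -/

/-- Normalizing `u` and `v` at most doubles their relative distance, and the squared entries of two
unit vectors differ by at most `(a - b) (a + b)` summed up. -/
lemma tv_l2Density_le {ι : Type*} [Fintype ι] {u v : ι → ℝ} (hu : u ≠ 0) (hv : v ≠ 0) :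
    tv (l2Density u) (l2Density v) ≤ 2 * l2norm (u - v) / l2norm v := by
  have hu' := l2norm_pos hu
  have hv' := l2norm_pos hv
  set a : ι → ℝ := (l2norm u)⁻¹ • u with ha
  set b : ι → ℝ := (l2norm v)⁻¹ • v with hb
  have ha1 : l2norm a = 1 := by
    rw [ha, l2norm_smul, abs_of_pos (inv_pos.2 hu'), inv_mul_cancel₀ hu'.ne']
  have hb1 : l2norm b = 1 := by
    rw [hb, l2norm_smul, abs_of_pos (inv_pos.2 hv'), inv_mul_cancel₀ hv'.ne']
  have h1 : ∑ i, |l2Density u i - l2Density v i| =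
      (fun i => |a i - b i|) ⬝ᵥ fun i => |a i + b i| := by
    refine Finset.sum_congr rfl fun i _ => ?_
    rw [← abs_mul, l2Density, l2Density, ha, hb, Pi.smul_apply, Pi.smul_apply, smul_eq_mul,
      smul_eq_mul]
    congr 1
    field_simp
    ring
  have habs : ∀ w : ι → ℝ, l2norm (fun i => |w i|) = l2norm w := fun w => by
    rw [← sq_eq_sq₀ (l2norm_nonneg _) (l2norm_nonneg _), l2norm_sq, l2norm_sq]
    simp
  have h2 : ∑ i, |l2Density u i - l2Density v i| ≤ l2norm (a - b) * 2 := by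
    rw [h1]
    refine (le_abs_self _).trans ((abs_dotProduct_le _ _).trans ?_)
    have h3 : l2norm (fun i => |a i - b i|) = l2norm (a - b) := habs (a - b)
    have h4 : l2norm (fun i => |a i + b i|) = l2norm (a + b) := habs (a + b)
    rw [h3, h4]
    refine mul_le_mul_of_nonneg_left ?_ (l2norm_nonneg _)
    linarith [l2norm_add_le a b]
  have h5 : a - b = (l2norm v)⁻¹ • (u - v) + ((l2norm v - l2norm u) / l2norm v) • a := by
    ext i
    simp only [ha, hb, Pi.sub_apply, Pi.add_apply, Pi.smul_apply, smul_eq_mul]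
    field_simp
    ring
  have h6 : l2norm (a - b) ≤ 2 * l2norm (u - v) / l2norm v := by
    rw [h5]
    refine (l2norm_add_le _ _).trans ?_
    rw [l2norm_smul, l2norm_smul, ha1, mul_one, abs_of_pos (inv_pos.2 hv'), abs_div,
      abs_of_pos hv']
    have h7 : |l2norm v - l2norm u| ≤ l2norm (u - v) := by
      rw [abs_le]
      have h8 := l2norm_sub_le v u
      rw [l2norm_sub_rev] at h8
      constructor <;> linarith [l2norm_sub_le u v]
    have h9 := div_le_div_of_nonneg_right h7 hv'.le
    calc (l2norm v)⁻¹ * l2norm (u - v) + |l2norm v - l2norm u| / l2norm v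
        ≤ (l2norm v)⁻¹ * l2norm (u - v) + l2norm (u - v) / l2norm v := by linarith
      _ = _ := by ring
  rw [tv]
  linarith

/-! ### From the sketching event to the approximate singular vectors -/

/-- The properties of a matrix that enter the error analysis: its rank `k`, a lower bound `σ` for
its nonzero singular values and a bound `κ` for its condition number. -/
structure WellConditioned {m n : ℕ} (A : Matrix (Fin m) (Fin n) ℝ) (k : ℕ) (σ κ : ℝ) : Prop where
  rank_eq : A.rank = k
  k_pos : 0 < k
  σ_pos : 0 < σ
  one_le_κ : 1 ≤ κ
  frob_le : frob A ≤ √k * κ * σ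
  le_mulVec : ∀ x ∈ Submodule.span ℝ (Set.range A.row), σ * l2norm x ≤ l2norm (A *ᵥ x)

section

variable {m n k : ℕ} {A : Matrix (Fin m) (Fin n) ℝ} {σ κ : ℝ}

lemma wellConditioned_condNumber (hA : A ≠ 0) (hk : A.rank = k) :
    WellConditioned A k (sv A (k - 1)) (condNumber A) := by
  obtain ⟨h1, h2, h3, h4⟩ := condNumber_facts hA hk
  exact ⟨hk, h1, h2, h3, h4, fun x hx => sv_mul_le_of_mem_rowSpace hk hx⟩

lemma WellConditioned.transpose (h : WellConditioned A k σ κ) : WellConditioned Aᵀ k σ κ where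
  rank_eq := by rw [Matrix.rank_transpose, h.rank_eq]
  k_pos := h.k_pos
  σ_pos := h.σ_pos
  one_le_κ := h.one_le_κ
  frob_le := by rw [frob_transpose]; exact h.frob_le
  le_mulVec _ hz := le_transpose_mulVec_of_mem_colSpace h.σ_pos.le h.le_mulVec hz

lemma WellConditioned.one_le_k (h : WellConditioned A k σ κ) : (1 : ℝ) ≤ k := by
  exact_mod_cast h.k_pos

lemma WellConditioned.frob_sq_le (h : WellConditioned A k σ κ) :
    frob A ^ 2 ≤ k * κ ^ 2 * σ ^ 2 := by
  refine (pow_le_pow_left₀ (frob_nonneg A) h.frob_le 2).trans_eq ?_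
  rw [mul_pow, mul_pow, Real.sq_sqrt (Nat.cast_nonneg _)]

/-- What the error analysis uses about an output `M` of `FKV(A, k, ε, δ)`. -/
structure IsGoodOutput (A : Matrix (Fin m) (Fin n) ℝ) (k : ℕ) (σ κ ε : ℝ)
    (M : Matrix (Fin n) (Fin k) ℝ) : Prop where
  gram_close : frob (Mᵀ * M - 1) ≤ 2 * (ε ^ 2 * κ ^ 2)
  span_eq : Submodule.span ℝ (Set.range M.col) = Submodule.span ℝ (Set.range A.row)
  proj_close : ∀ w, l2norm (M *ᵥ Mᵀ *ᵥ Aᵀ *ᵥ w - Aᵀ *ᵥ w) ≤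
    8 * √k * (ε ^ 2 * κ ^ 2) * σ * l2norm w

lemma le_fkvSize_mul_sq {ε δ : ℝ} (hk : 0 < k) (hε : 0 < ε) :
    32 * Real.log (2 / δ) ≤ fkvSize 32 k ε δ * ((ε / k) ^ 2) ^ 2 := by
  have hk' : (0 : ℝ) < k := by exact_mod_cast hk
  have h : 32 * ((k : ℝ) / ε) ^ 4 * Real.log (2 / δ) ≤ fkvSize 32 k ε δ := Nat.le_ceil _
  have h1 := mul_le_mul_of_nonneg_right h (by positivity : 0 ≤ ((ε / k) ^ 2) ^ 2)
  refine le_trans (le_of_eq ?_) h1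
  field_simp

lemma k_le_fkvSize {ε δ : ℝ} (hk : 0 < k) (hε : 0 < ε) (hε1 : ε ≤ 1) (hδ : 0 < δ) (hδ1 : δ < 1) :
    k ≤ fkvSize 32 k ε δ := by
  have hk' : (1 : ℝ) ≤ k := by exact_mod_cast hk
  have h : 32 * ((k : ℝ) / ε) ^ 4 * Real.log (2 / δ) ≤ fkvSize 32 k ε δ := Nat.le_ceil _
  have hlog : Real.log 2 ≤ Real.log (2 / δ) :=
    Real.log_le_log two_pos (by rw [le_div_iff₀ hδ]; linarith)
  have hlog2 := Real.log_two_gt_d9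
  have h1 : (k : ℝ) ≤ k / ε := by
    rw [le_div_iff₀ hε]
    nlinarith
  have h2 : (k : ℝ) / ε ≤ ((k : ℝ) / ε) ^ 4 := le_self_pow₀ (hk'.trans h1) (by norm_num)
  have h3 : (k : ℝ) ≤ fkvSize 32 k ε δ := by nlinarith
  exact_mod_cast h3

/-- On the sketching event no column of the output is dropped, and the output is good. -/
theorem isGoodOutput_fkvOutput (h : WellConditioned A k σ κ) {ε : ℝ} (hε : 0 < ε)
    (hεκ : ε * κ ^ 2 * k ≤ 1 / 1000) {p : ℕ} (hkp : k ≤ p)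
    {svd : ∀ p : ℕ, Matrix (Fin p) (Fin p) ℝ → Fin p → Fin p → ℝ}
    (hsvd : ∀ (p : ℕ) (W : Matrix (Fin p) (Fin p) ℝ), IsLeftSingularBasis W (svd p W))
    {ω : (Fin p → Fin m) × (Fin p → Fin n)} (hω : ω ∈ sketchEvent A p ((ε / k) ^ 2)) :
    IsGoodOutput A k σ κ ε (fkvOutput A k ε svd ω) := by
  have hk := h.one_le_k
  have hσ := h.σ_pos
  have hκ2 : 1 ≤ κ ^ 2 := one_le_pow₀ h.one_le_κ
  have hκ0 : 0 < κ := by linarith [h.one_le_κ]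
  have hεκ' : ε * κ ^ 2 ≤ 1 / 1000 := by nlinarith [mul_pos hε (pow_pos hκ0 2)]
  have hε1 : ε ≤ 1 / 1000 := by nlinarith
  set S := fkvS A ω.1 with hS
  set W := fkvW A ω with hW
  set e := ε ^ 2 * κ ^ 2 * σ ^ 2 / k with he
  have hFe : (ε / k) ^ 2 * frob A ^ 2 ≤ e := by
    refine (mul_le_mul_of_nonneg_left h.frob_sq_le (sq_nonneg _)).trans_eq ?_
    rw [he]
    field_simp
  have hsk : IsSketch A k σ e S W :=
    { rank_eq := h.rank_eq
      k_pos := h.k_pos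
      k_le := hkp
      σ_pos := hσ
      le_mulVec := h.le_mulVec
      rows_mem := fkvS_transpose_mulVec_mem A ω.1
      gram_close := hω.1.trans hFe
      cogram_close := hω.2.1.trans hFe
      small := by
        have h1 : 8 * k * e = 8 * (ε * (ε * κ ^ 2)) * σ ^ 2 := by
          rw [he]
          field_simp
        rw [h1]
        have h2 : ε * (ε * κ ^ 2) ≤ 1 / 1000 * (1 / 1000) :=
          mul_le_mul hε1 hεκ' (by positivity) (by norm_num)
        nlinarith [pow_pos hσ 2] }
  have hu := hsvd _ W
  have hcol : ∀ t : Fin k, (fkvOutput A k ε svd ω).col t =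
      (sv W t)⁻¹ • (Sᵀ *ᵥ svd _ W (Fin.castLE hsk.k_le t)) := fun t => by
    have ht : (t : ℕ) < p := t.2.trans_le hkp
    have hthr : ε / (8 * k) * frob W ^ 2 ≤ sv W t ^ 2 := by
      refine le_trans ?_ (hsk.le_sv_sq hu (t := Fin.castLE hkp t) t.2)
      have h1 := mul_le_mul_of_nonneg_left (hω.2.2.trans h.frob_sq_le)
        (by positivity : 0 ≤ ε / (8 * (k : ℝ)))
      refine h1.trans ?_
      have h2 : ε / (8 * k) * (k * κ ^ 2 * σ ^ 2) = ε * κ ^ 2 / 8 * σ ^ 2 := by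
        field_simp
      rw [h2]
      exact mul_le_mul_of_nonneg_right (by linarith) (sq_nonneg _)
    ext j
    rw [Matrix.col_apply, fkvOutput, dif_pos ht, if_pos hthr, Pi.smul_apply, smul_eq_mul,
      inv_mul_eq_div]
    rfl
  refine ⟨?_, hsk.span_col_eq hu hcol, fun w => ?_⟩
  · refine (hsk.frob_gram_sub_one_le hu hcol).trans_eq ?_
    rw [he]
    field_simp
  · refine (hsk.l2norm_proj_sub_le hu hcol w).trans_eq ?_
    rw [he]
    field_simp

/-! ### The error of the computed projection -/

/-- `Û M̃ x` differs from `A V x` by three errors: that of the estimate `M̃` of `Ûᵀ A V̂`, that of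
`Û Ûᵀ` as a projection onto the column space of `A`, and that of `V̂` as an approximation of `V`. -/
theorem l2norm_projection_error_le (h : WellConditioned A k σ κ) {ε εV εU ζ : ℝ} (hε : 0 < ε)
    (hεV : 0 < εV) (hεU : 0 < εU) (hζ : 0 < ζ)
    (hV1 : εV * (√k * κ) ≤ ε / 1000) (hV2 : εV * κ ^ 2 * k ≤ 1 / 1000)
    (hU1 : εU * k ≤ ε / 1000) (hU2 : εU * κ ^ 2 * k ≤ 1 / 1000)
    (hζ1 : ζ * (k ^ 2 * κ) ≤ ε / 1000)
    {V Vh : Matrix (Fin n) (Fin k) ℝ} {Uh : Matrix (Fin m) (Fin k) ℝ}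
    {M : Matrix (Fin k) (Fin k) ℝ}
    (hVh : IsGoodOutput A k σ κ εV Vh) (hUh : IsGoodOutput Aᵀ k σ κ εU Uh)
    (hVVh : frob (V - Vh) ≤ frob (Vhᵀ * Vh - 1))
    (hM : ∀ s t, |M s t - (Uhᵀ * A * Vh) s t| ≤ ζ * (2 * frob A)) {x : Fin k → ℝ}
    (hx : l2norm x = 1) :
    l2norm (Uh *ᵥ M *ᵥ x - A *ᵥ V *ᵥ x) ≤ ε * σ / 2 := by
  have hk := h.one_le_k
  have hσ := h.σ_pos
  have hκ0 : 0 < κ := by linarith [h.one_le_κ]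
  have hκ2 : 1 ≤ κ ^ 2 := one_le_pow₀ h.one_le_κ
  have hsk1 : 1 ≤ √(k : ℝ) := Real.one_le_sqrt.2 hk
  have hsk2 : √(k : ℝ) * √k = k := Real.mul_self_sqrt (by linarith)
  have hskk : √(k : ℝ) ≤ k := by nlinarith
  have hbound : ∀ {r : ℕ} {N : Matrix (Fin r) (Fin k) ℝ} {ε' : ℝ}, 0 < ε' →
      ε' * κ ^ 2 * k ≤ 1 / 1000 → frob (Nᵀ * N - 1) ≤ 2 * (ε' ^ 2 * κ ^ 2) →
      ∀ v, l2norm (N *ᵥ v) ≤ 2 * l2norm v := by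
    intro r N ε' hε' hε'κ hN v
    have h1 : ε' * κ ^ 2 ≤ 1 / 1000 := by nlinarith [mul_pos hε' (pow_pos hκ0 2)]
    have h2 : ε' ≤ 1 / 1000 := by nlinarith
    have h3 : ε' ^ 2 * κ ^ 2 ≤ 1 / 1000 * (1 / 1000) := by
      calc ε' ^ 2 * κ ^ 2 = ε' * (ε' * κ ^ 2) := by ring
        _ ≤ _ := mul_le_mul h2 h1 (by positivity) (by norm_num)
    refine l2norm_le_of_sq_le (by have := l2norm_nonneg v; positivity) ?_
    have h4 := (l2norm_le_of_gram_close N v).2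
    nlinarith [sq_nonneg (l2norm v)]
  have hUb := hbound hεU hU2 hUh.gram_close
  have hVb := hbound hεV hV2 hVh.gram_close x
  rw [hx] at hVb
  have hdecomp : Uh *ᵥ M *ᵥ x - A *ᵥ V *ᵥ x = Uh *ᵥ (M - Uhᵀ * A * Vh) *ᵥ x +
      (Uh *ᵥ Uhᵀ *ᵥ A *ᵥ Vh *ᵥ x - A *ᵥ Vh *ᵥ x) + A *ᵥ (Vh - V) *ᵥ x := by
    simp only [sub_mulVec, mulVec_sub, ← mulVec_mulVec]
    abel
  have e1 : l2norm (Uh *ᵥ (M - Uhᵀ * A * Vh) *ᵥ x) ≤ ε * σ / 8 := by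
    refine (hUb _).trans ?_
    have h1 := l2norm_mulVec_le (M - Uhᵀ * A * Vh) x
    rw [hx, mul_one] at h1
    have h2 : frob (M - Uhᵀ * A * Vh) ≤ k * (ζ * (2 * frob A)) := by
      have := frob_le_of_abs_le (M := M - Uhᵀ * A * Vh) (b := ζ * (2 * frob A))
        (by have := frob_nonneg A; positivity) hM
      rwa [Fintype.card_fin] at this
    have h3 : k * (ζ * (2 * frob A)) ≤ k * (ζ * (2 * (√k * κ * σ))) := by
      have := h.frob_le
      gcongr
    have h4 : k * (ζ * (2 * (√k * κ * σ))) ≤ 2 * (ζ * (k ^ 2 * κ)) * σ := by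
      have h5 : (k : ℝ) * √k ≤ k ^ 2 := by nlinarith
      have h6 := mul_le_mul_of_nonneg_right h5 (by positivity : 0 ≤ 2 * ζ * κ * σ)
      linarith
    have h7 := mul_le_mul_of_nonneg_right hζ1 hσ.le
    have := mul_pos hε hσ
    linarith
  have e2 : l2norm (Uh *ᵥ Uhᵀ *ᵥ A *ᵥ Vh *ᵥ x - A *ᵥ Vh *ᵥ x) ≤ ε * σ / 8 := by
    have h1 := hUh.proj_close (Vh *ᵥ x)
    rw [transpose_transpose] at h1
    refine h1.trans ?_
    have h2 : √(k : ℝ) * (εU ^ 2 * κ ^ 2) ≤ ε / 1000 * (1 / 1000) := by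
      calc √(k : ℝ) * (εU ^ 2 * κ ^ 2) ≤ k * k * (εU ^ 2 * κ ^ 2) := by
            refine mul_le_mul_of_nonneg_right ?_ (by positivity)
            nlinarith
        _ = εU * k * (εU * κ ^ 2 * k) := by ring
        _ ≤ _ := mul_le_mul hU1 hU2 (by positivity) (by positivity)
    calc 8 * √k * (εU ^ 2 * κ ^ 2) * σ * l2norm (Vh *ᵥ x)
        = 8 * (√k * (εU ^ 2 * κ ^ 2)) * (σ * l2norm (Vh *ᵥ x)) := by ring
      _ ≤ 8 * (ε / 1000 * (1 / 1000)) * (σ * (2 * 1)) := by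
          have := l2norm_nonneg (Vh *ᵥ x)
          gcongr
      _ ≤ ε * σ / 8 := by nlinarith [mul_pos hε hσ]
  have e3 : l2norm (A *ᵥ (Vh - V) *ᵥ x) ≤ ε * σ / 8 := by
    have h1 := l2norm_mulVec_le (Vh - V) x
    rw [hx, mul_one, frob_sub_rev] at h1
    have h2 := h1.trans (hVVh.trans hVh.gram_close)
    refine (l2norm_mulVec_le A _).trans ?_
    calc frob A * l2norm ((Vh - V) *ᵥ x) ≤ √k * κ * σ * (2 * (εV ^ 2 * κ ^ 2)) :=
          mul_le_mul h.frob_le h2 (l2norm_nonneg _) (by positivity)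
      _ = 2 * (εV * (√k * κ)) * (εV * κ ^ 2) * σ := by ring
      _ ≤ 2 * (ε / 1000) * (1 / 1000) * σ := by
          have h3 : εV * κ ^ 2 ≤ 1 / 1000 := by nlinarith [mul_pos hεV (pow_pos hκ0 2)]
          gcongr
      _ ≤ ε * σ / 8 := by nlinarith [mul_pos hε hσ]
  rw [hdecomp]
  have h1 := l2norm_add_le (Uh *ᵥ (M - Uhᵀ * A * Vh) *ᵥ x +
      (Uh *ᵥ Uhᵀ *ᵥ A *ᵥ Vh *ᵥ x - A *ᵥ Vh *ᵥ x)) (A *ᵥ (Vh - V) *ᵥ x)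
  have h2 := l2norm_add_le (Uh *ᵥ (M - Uhᵀ * A * Vh) *ᵥ x)
      (Uh *ᵥ Uhᵀ *ᵥ A *ᵥ Vh *ᵥ x - A *ᵥ Vh *ᵥ x)
  have := mul_pos hε hσ
  linarith

end

/-! ### The probability space of the algorithm -/

lemma isProbabilityMeasure_sphereUniform {k : ℕ} (hk : 0 < k) :
    IsProbabilityMeasure (sphereUniform k) := by
  have : Nonempty (Fin k) := ⟨⟨0, hk⟩⟩
  constructor
  rw [sphereUniform, Measure.smul_apply, smul_eq_mul]
  refine ENNReal.inv_mul_cancel ?_ (measure_ne_top _ _)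
  rw [Measure.toSphere_apply_univ]
  refine mul_ne_zero ?_ (Metric.measure_ball_pos _ _ one_pos).ne'
  simpa using hk.ne'

lemma measurableSet_dependent {α β : Type*} [MeasurableSpace α] [MeasurableSpace β] [Countable α]
    [MeasurableSingletonClass α] (s : Set α) {t : α → Set β} (ht : ∀ a, MeasurableSet (t a)) :
    MeasurableSet {p : α × β | p.1 ∈ s ∧ p.2 ∈ t p.1} := by
  have h : {p : α × β | p.1 ∈ s ∧ p.2 ∈ t p.1} = ⋃ a ∈ s, {a} ×ˢ t a := by
    ext ⟨a, b⟩
    simp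
  rw [h]
  exact MeasurableSet.biUnion s.to_countable fun a _ => (measurableSet_singleton a).prod (ht a)

/-- A two-stage lower bound: the first stage succeeds with mass `x` and, whatever its successful
outcome, the second one with mass `y`. -/
lemma mul_le_prod_dependent {α β : Type*} [MeasurableSpace α] [MeasurableSpace β] [Countable α]
    [MeasurableSingletonClass α] (μ : Measure α) (ν : Measure β) [SFinite ν] {s : Set α}
    {t : α → Set β} (ht : ∀ a, MeasurableSet (t a)) {x y : ENNReal} (hx : x ≤ μ s)
    (hy : ∀ a ∈ s, y ≤ ν (t a)) : x * y ≤ μ.prod ν {p | p.1 ∈ s ∧ p.2 ∈ t p.1} := by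
  have hs : MeasurableSet s := s.to_countable.measurableSet
  rw [Measure.prod_apply (measurableSet_dependent s ht)]
  calc x * y ≤ y * μ s := by rw [mul_comm]; gcongr
    _ = ∫⁻ _ in s, y ∂μ := by rw [setLIntegral_const]
    _ ≤ ∫⁻ a in s, ν (Prod.mk a ⁻¹' {p | p.1 ∈ s ∧ p.2 ∈ t p.1}) ∂μ := by
        refine setLIntegral_mono' hs fun a ha => (hy a ha).trans (measure_mono fun b hb => ?_)
        exact ⟨ha, hb⟩
    _ ≤ _ := setLIntegral_le_lintegral _ _

section

variable {m n : ℕ} (P : Params) (A : Matrix (Fin m) (Fin n) ℝ)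
  (svd : ∀ p : ℕ, Matrix (Fin p) (Fin p) ℝ → Fin p → Fin p → ℝ)

/-- The samples for which the estimate of `Uᵀ A V` is accurate in every entry. -/
def goodSamples (U : Matrix (Fin m) (Fin P.k) ℝ) (V : Matrix (Fin n) (Fin P.k) ℝ) :
    Set (Fin P.k × Fin P.k × Fin P.G × Fin P.q → Fin m × Fin n) :=
  {e | ∀ s t, |estimate A Uᵀ V e s t - (Uᵀ * A * V) s t| ≤ P.ζ * (2 * frob A)}

/-- Given the output `V` of the first call of FKV, the remaining choices for which the sketch of
`Aᵀ` and the estimate are accurate. The unit vectors are arbitrary. -/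
def goodRest (V : Matrix (Fin n) (Fin P.k) ℝ) :
    Set (((Fin P.pU → Fin n) × (Fin P.pU → Fin m)) ×
      (Fin P.k × Fin P.k × Fin P.G × Fin P.q → Fin m × Fin n) ×
        (Fin P.s → Metric.sphere (0 : EuclideanSpace ℝ (Fin P.k)) 1)) :=
  {ω | ω.1 ∈ sketchEvent Aᵀ P.pU ((P.εU / P.k) ^ 2) ∧
    ω.2 ∈ goodSamples P A (fkvOutput Aᵀ P.k P.εU svd ω.1) V ×ˢ
      (Set.univ : Set (Fin P.s → Metric.sphere (0 : EuclideanSpace ℝ (Fin P.k)) 1))}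

/-- The choices for which both sketches and the estimate of `Ûᵀ A V̂` are accurate. -/
def goodChoices : Set (Choices P m n) :=
  {ω | ω.1 ∈ sketchEvent A P.pV ((P.εV / P.k) ^ 2) ∧
    ω.2 ∈ goodRest P A svd (fkvOutput A P.k P.εV svd ω.1)}

lemma measurableSet_goodRest (V : Matrix (Fin n) (Fin P.k) ℝ) :
    MeasurableSet (goodRest P A svd V) :=
  measurableSet_dependent _
    (t := fun ω => goodSamples P A (fkvOutput Aᵀ P.k P.εU svd ω) V ×ˢ Set.univ)
    fun _ => MeasurableSet.of_discrete.prod MeasurableSet.univ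

lemma measurableSet_goodChoices : MeasurableSet (goodChoices P A svd) :=
  measurableSet_dependent _ (t := fun ω => goodRest P A svd (fkvOutput A P.k P.εV svd ω))
    fun _ => measurableSet_goodRest P A svd _

/-- The estimate is as accurate as `goodChoices` demands with the prescribed probability, since the
columns of nearly orthonormal `Û` and `V̂` have norms close to `1`. -/
lemma ofReal_le_entryLaw_of_gram_close {k G q : ℕ} (hA : A ≠ 0) (hk : 0 < k)
    {ζ η : ℝ} (hG : G = medianSize 32 k η) (hq : q = meanSize 32 ζ) (hζ : 0 < ζ) (hη : 0 < η) (hη1 : η < 1) {U : Matrix (Fin m) (Fin k) ℝ} {V : Matrix (Fin n) (Fin k) ℝ}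
    (hU : frob (Uᵀ * U - 1) ≤ 1 / 4) (hV : frob (Vᵀ * V - 1) ≤ 1 / 4) :
    ENNReal.ofReal (1 - η) ≤ entryLaw A k G q
      {e | ∀ s t, |estimate A Uᵀ V e s t - (Uᵀ * A * V) s t| ≤ ζ * (2 * frob A)} := by
  subst hG hq
  have hF := frob_pos hA
  refine ofReal_le_entryLaw hA Uᵀ V hk (by positivity) (fun s t => ?_) hζ hη hη1
  have h1 : l2norm (Uᵀ s) * l2norm (V.col t) ≤ 2 := by
    have hu : l2norm (Uᵀ s) ^ 2 ≤ 5 / 4 := (col_bounds_of_gram_close hU s).2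
    have hv := (col_bounds_of_gram_close hV t).2
    nlinarith [sq_nonneg (l2norm (Uᵀ s) - l2norm (V.col t))]
  nlinarith

end

lemma IsGoodOutput.gram_quarter {m n k : ℕ} {A : Matrix (Fin m) (Fin n) ℝ} {σ κ ε : ℝ}
    {M : Matrix (Fin n) (Fin k) ℝ} (h : IsGoodOutput A k σ κ ε M) (hk : (1 : ℝ) ≤ k)
    (hκ : 1 ≤ κ) (hε : 0 < ε) (hεκ : ε * κ ^ 2 * k ≤ 1 / 1000) :
    frob (Mᵀ * M - 1) ≤ 1 / 4 := by
  have hκ2 : 1 ≤ κ ^ 2 := one_le_pow₀ hκ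
  have h1 : ε * κ ^ 2 ≤ 1 / 1000 := by nlinarith [mul_pos hε (by linarith : 0 < κ ^ 2)]
  have h2 : ε ≤ 1 / 1000 := by nlinarith
  have h3 : ε * (ε * κ ^ 2) ≤ 1 / 1000 * (1 / 1000) := mul_le_mul h2 h1 (by positivity) (by norm_num)
  refine h.gram_close.trans ?_
  nlinarith

/-! ### Admissible parameters -/

/-- Parameters within the ranges in which the algorithm succeeds, with `1 / 1000` and `32` for the
absolute constants. The bounds on the error parameters are written without divisions. -/
structure Admissible {m n : ℕ} (P : Params) (A : Matrix (Fin m) (Fin n) ℝ) (ε : ℝ) : Prop where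
  ne_zero : A ≠ 0
  rank_eq : A.rank = P.k
  C_eq : P.C = 32
  δ_pos : 0 < P.δ
  δ_lt_one : P.δ < 1
  ε_pos : 0 < ε
  ε_le_one : ε ≤ 1
  εV_pos : 0 < P.εV
  εU_pos : 0 < P.εU
  ζ_pos : 0 < P.ζ
  εV_le : P.εV * (√P.k * condNumber A) ≤ ε / 1000
  εV_le' : P.εV * condNumber A ^ 2 * P.k ≤ 1 / 1000
  εU_le : P.εU * P.k ≤ ε / 1000
  εU_le' : P.εU * condNumber A ^ 2 * P.k ≤ 1 / 1000
  ζ_le : P.ζ * (P.k ^ 2 * condNumber A) ≤ ε / 1000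

namespace Admissible

variable {m n : ℕ} {P : Params} {A : Matrix (Fin m) (Fin n) ℝ} {ε : ℝ} (h : Admissible P A ε)

include h

lemma wellConditioned : WellConditioned A P.k (sv A (P.k - 1)) (condNumber A) :=
  wellConditioned_condNumber h.ne_zero h.rank_eq

lemma pV_eq : P.pV = fkvSize 32 P.k P.εV P.δ₁ := by rw [Params.pV, h.C_eq]

lemma pU_eq : P.pU = fkvSize 32 P.k P.εU P.δ₁ := by rw [Params.pU, h.C_eq]

lemma root_pos : 0 < (1 - P.δ) ^ (1 / 4 : ℝ) :=
  Real.rpow_pos_of_pos (by linarith [h.δ_lt_one]) _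

lemma root_lt_one : (1 - P.δ) ^ (1 / 4 : ℝ) < 1 :=
  Real.rpow_lt_one (by linarith [h.δ_lt_one]) (by linarith [h.δ_pos]) (by norm_num)

lemma δ₁_pos : 0 < P.δ₁ := by
  rw [Params.δ₁]
  linarith [h.root_lt_one]

lemma δ₁_lt_one : P.δ₁ < 1 := by
  rw [Params.δ₁]
  linarith [h.root_pos]

lemma error_le_one {e : ℝ} (he : 0 < e) (he1 : e * condNumber A ^ 2 * P.k ≤ 1 / 1000) : e ≤ 1 := by
  have hκ := one_le_pow₀ h.wellConditioned.one_le_κ (n := 2)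
  have hk := h.wellConditioned.one_le_k
  have h1 : 1 ≤ condNumber A ^ 2 * P.k := by nlinarith
  nlinarith

lemma k_le_pV : P.k ≤ P.pV := by
  rw [h.pV_eq]
  exact k_le_fkvSize h.wellConditioned.k_pos h.εV_pos (h.error_le_one h.εV_pos h.εV_le')
    h.δ₁_pos h.δ₁_lt_one

lemma k_le_pU : P.k ≤ P.pU := by
  rw [h.pU_eq]
  exact k_le_fkvSize h.wellConditioned.k_pos h.εU_pos (h.error_le_one h.εU_pos h.εU_le')
    h.δ₁_pos h.δ₁_lt_one

variable {svd : ∀ p : ℕ, Matrix (Fin p) (Fin p) ℝ → Fin p → Fin p → ℝ}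
  (hsvd : ∀ (p : ℕ) (W : Matrix (Fin p) (Fin p) ℝ), IsLeftSingularBasis W (svd p W))

include hsvd

lemma isGoodOutput_V {ω : (Fin P.pV → Fin m) × (Fin P.pV → Fin n)}
    (hω : ω ∈ sketchEvent A P.pV ((P.εV / P.k) ^ 2)) :
    IsGoodOutput A P.k (sv A (P.k - 1)) (condNumber A) P.εV (fkvOutput A P.k P.εV svd ω) :=
  isGoodOutput_fkvOutput h.wellConditioned h.εV_pos h.εV_le' h.k_le_pV hsvd hω

lemma isGoodOutput_U {ω : (Fin P.pU → Fin n) × (Fin P.pU → Fin m)}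
    (hω : ω ∈ sketchEvent Aᵀ P.pU ((P.εU / P.k) ^ 2)) :
    IsGoodOutput Aᵀ P.k (sv A (P.k - 1)) (condNumber A) P.εU (fkvOutput Aᵀ P.k P.εU svd ω) :=
  isGoodOutput_fkvOutput h.wellConditioned.transpose h.εU_pos h.εU_le' h.k_le_pU hsvd hω

/-- Both calls of FKV and the estimation step succeed with probability at least
`((1 - δ) ^ (1 / 4)) ^ 3`. -/
theorem le_choicesLaw_goodChoices :
    ENNReal.ofReal (1 - P.δ₁) * (ENNReal.ofReal (1 - P.δ₁) * ENNReal.ofReal (1 - P.δ₁)) ≤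
      choicesLaw P A (goodChoices P A svd) := by
  have hw := h.wellConditioned
  have hAt : Aᵀ ≠ 0 := fun h0 => h.ne_zero (Matrix.transpose_eq_zero.1 h0)
  have hprobV := isProbabilityMeasure_fkvLaw h.ne_zero (hw.k_pos.trans_le h.k_le_pV)
  have hprobU := isProbabilityMeasure_fkvLaw hAt (hw.k_pos.trans_le h.k_le_pU)
  have hprobS := isProbabilityMeasure_sphereUniform hw.k_pos
  have hprobE := isProbabilityMeasure_entry h.ne_zero
  have hprobE' : IsProbabilityMeasure (entryLaw A P.k P.G P.q) := by
    rw [entryLaw]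
    infer_instance
  refine mul_le_prod_dependent _ _
    (t := fun ω => goodRest P A svd (fkvOutput A P.k P.εV svd ω))
    (fun _ => measurableSet_goodRest P A svd _) ?_ fun ω hω => ?_
  · refine ofReal_le_fkvLaw_sketchEvent h.ne_zero (by positivity) h.δ₁_pos h.δ₁_lt_one ?_
    rw [h.pV_eq]
    exact le_fkvSize_mul_sq hw.k_pos h.εV_pos
  refine mul_le_prod_dependent _ _
    (t := fun ω' => goodSamples P A (fkvOutput Aᵀ P.k P.εU svd ω')
      (fkvOutput A P.k P.εV svd ω) ×ˢ Set.univ)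
    (fun _ => MeasurableSet.of_discrete.prod MeasurableSet.univ) ?_ fun ω' hω' => ?_
  · refine ofReal_le_fkvLaw_sketchEvent hAt (by positivity) h.δ₁_pos h.δ₁_lt_one ?_
    rw [h.pU_eq]
    exact le_fkvSize_mul_sq hw.k_pos h.εU_pos
  rw [Measure.prod_prod, measure_univ, mul_one]
  exact ofReal_le_entryLaw_of_gram_close A h.ne_zero hw.k_pos (by rw [Params.G, h.C_eq])
    (by rw [Params.q, h.C_eq]) h.ζ_pos h.δ₁_pos h.δ₁_lt_one
    ((h.isGoodOutput_U hsvd hω').gram_quarter hw.one_le_k hw.one_le_κ h.εU_pos h.εU_le')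
    ((h.isGoodOutput_V hsvd hω).gram_quarter hw.one_le_k hw.one_le_κ h.εV_pos h.εV_le')

omit hsvd in
/-- A good output of the first call of FKV has an orthonormalization as claimed. -/
lemma isOrthonormalization {Vh : Matrix (Fin n) (Fin P.k) ℝ}
    (hVh : IsGoodOutput A P.k (sv A (P.k - 1)) (condNumber A) P.εV Vh) :
    IsOrthonormalization 1 3 (P.εV * P.k / 16) Vh (orthonormalize n P.k Vh) := by
  have hw := h.wellConditioned
  have hεV := h.εV_pos
  have hk := hw.one_le_k
  have hκ := one_le_pow₀ hw.one_le_κ (n := 2)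
  have hκ0 : 0 < condNumber A := by linarith [hw.one_le_κ]
  have hVq := hVh.gram_quarter hk hw.one_le_κ hεV h.εV_le'
  obtain ⟨hO1, hO2, hO3⟩ := orthonormalize_spec (M := Vh) (by linarith)
  have h1 : P.εV * condNumber A ^ 2 ≤ 1 / 1000 := by
    nlinarith [mul_pos hεV (pow_pos hκ0 2), h.εV_le']
  have hα : 2 * (P.εV ^ 2 * condNumber A ^ 2) ≤ P.εV * P.k / 16 / 2 := by
    nlinarith
  have hsqrt2 : √(2 : ℝ) ≤ 2 := by
    rw [Real.sqrt_le_left two_pos.le]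
    norm_num
  have hα0 : 0 < P.εV * P.k / 16 := by positivity
  have hclose := hVh.gram_close.trans hα
  refine ⟨hO1, hO2, ?_, ?_⟩
  · have h2 : P.εV * P.k / 16 / 2 ≤ P.εV * P.k / 16 / √2 :=
      div_le_div_of_nonneg_left hα0.le (by positivity) hsqrt2
    have h3 := sq_nonneg (P.εV * P.k / 16)
    linarith
  · refine (frob_proj_sub_le hO1 hO3 (by linarith)).trans ?_
    linarith

/-- For good choices the target vector `A V x_i` has norm at least `σ`, and the rejection sampler
runs on a vector that is `ε σ / 2`-close to it. -/
lemma error_of_mem_goodChoices {ω : Choices P m n} (hω : ω ∈ goodChoices P A svd) (i : Fin P.s) :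
    sv A (P.k - 1) ≤
        l2norm (A *ᵥ (orthonormalize n P.k (Vhat P A svd ω) *ᵥ xvec P ω i)) ∧
      l2norm (Uhat P A svd ω *ᵥ ytilde P A svd ω i -
        A *ᵥ (orthonormalize n P.k (Vhat P A svd ω) *ᵥ xvec P ω i)) ≤
          ε * sv A (P.k - 1) / 2 := by
  have hw := h.wellConditioned
  have hVh : IsGoodOutput A P.k (sv A (P.k - 1)) (condNumber A) P.εV (Vhat P A svd ω) :=
    h.isGoodOutput_V hsvd hω.1
  have hUh : IsGoodOutput Aᵀ P.k (sv A (P.k - 1)) (condNumber A) P.εU (Uhat P A svd ω) :=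
    h.isGoodOutput_U hsvd hω.2.1
  have hM : ∀ s t, |Mtilde P A svd ω s t - ((Uhat P A svd ω)ᵀ * A * Vhat P A svd ω) s t| ≤
      P.ζ * (2 * frob A) := hω.2.2.1
  have hVq := hVh.gram_quarter hw.one_le_k hw.one_le_κ h.εV_pos h.εV_le'
  obtain ⟨hO1, hO2, hO3⟩ := orthonormalize_spec (M := Vhat P A svd ω) (by linarith)
  have hx : l2norm (xvec P ω i) = 1 := by
    have := (ω.2.2.2 i).2
    rw [mem_sphere_zero_iff_norm] at this
    exact this
  constructor
  · have h1 := hw.le_mulVec (orthonormalize n P.k (Vhat P A svd ω) *ᵥ xvec P ω i) (by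
      rw [← hVh.span_eq, ← hO2, ← Matrix.range_mulVecLin]
      exact ⟨_, rfl⟩)
    rwa [l2norm_mulVec_of_orthonormal hO1, hx, mul_one] at h1
  · exact l2norm_projection_error_le hw h.ε_pos h.εV_pos h.εU_pos h.ζ_pos h.εV_le h.εV_le'
      h.εU_le h.εU_le' h.ζ_le hVh hUh hO3 hM hx

/-- For good choices, `Û ỹ_i` is nonzero and its length-squared distribution is `ε`-close to the
target. -/
lemma tv_of_mem_goodChoices {ω : Choices P m n} (hω : ω ∈ goodChoices P A svd) (i : Fin P.s) :
    Uhat P A svd ω *ᵥ ytilde P A svd ω i ≠ 0 ∧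
      tv (l2Density (Uhat P A svd ω *ᵥ ytilde P A svd ω i)) (l2Density
        (A *ᵥ (orthonormalize n P.k (Vhat P A svd ω) *ᵥ xvec P ω i))) ≤ ε := by
  obtain ⟨hlow, herr⟩ := h.error_of_mem_goodChoices hsvd hω i
  have hσ := h.wellConditioned.σ_pos
  have hε1 := h.ε_le_one
  generalize A *ᵥ (orthonormalize n P.k (Vhat P A svd ω) *ᵥ xvec P ω i) = v at hlow herr ⊢
  generalize Uhat P A svd ω *ᵥ ytilde P A svd ω i = u at herr ⊢
  have hu : u ≠ 0 := fun h0 => by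
    rw [h0, l2norm_sub_rev, sub_zero] at herr
    nlinarith
  have hpos : 0 < l2norm v := hσ.trans_le hlow
  have hv : v ≠ 0 := fun h0 => by
    rw [h0, l2norm_zero] at hpos
    exact hpos.false
  refine ⟨hu, (tv_l2Density_le hu hv).trans ?_⟩
  rw [div_le_iff₀ hpos]
  have := mul_le_mul_of_nonneg_left hlow h.ε_pos.le
  linarith

/-- For good choices all runs succeed with probability at least `(1 - δ) ^ (1 / 4)`, and the
output distribution of every run is `ε`-close to the target. -/
lemma le_pi_runLaw {ω : Choices P m n} (hω : ω ∈ goodChoices P A svd) :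
    ENNReal.ofReal (1 - P.δ₁) ≤
      (Measure.pi fun i => runLaw (Uhat P A svd ω) (ytilde P A svd ω i) P.T)
        {ρ | ∀ i : Fin P.s, runOutput (ρ i) ≠ none ∧
          tv (O P A svd ω i) (l2Density
            (A *ᵥ (orthonormalize n P.k (Vhat P A svd ω) *ᵥ xvec P ω i))) ≤ ε} := by
  have hw := h.wellConditioned
  have hδ0 := h.δ_pos
  have hδ1 := h.δ_lt_one
  have hUh : IsGoodOutput Aᵀ P.k (sv A (P.k - 1)) (condNumber A) P.εU (Uhat P A svd ω) :=
    h.isGoodOutput_U hsvd hω.2.1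
  have hUq := hUh.gram_quarter hw.one_le_k hw.one_le_κ h.εU_pos h.εU_le'
  have hcol := col_ne_zero_of_gram_close hUq
  have htv := h.tv_of_mem_goodChoices hsvd hω
  have hy : ∀ i, ytilde P A svd ω i ≠ 0 := fun i h0 => (htv i).1 (by rw [h0, mulVec_zero])
  have hprobR : ∀ i, IsProbabilityMeasure (runLaw (Uhat P A svd ω) (ytilde P A svd ω i) P.T) :=
    fun i => by
      have := isProbabilityMeasure_trial hcol (hy i)
      rw [runLaw]
      infer_instance
  have hδ₁ : 1 - P.δ₁ = (1 - P.δ) ^ (1 / 4 : ℝ) := by rw [Params.δ₁, sub_sub_cancel]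
  rcases Nat.eq_zero_or_pos P.s with hs | hs
  · have hempty : IsEmpty (Fin P.s) := by rw [hs]; infer_instance
    refine (ENNReal.ofReal_le_one.2 (by linarith [h.δ₁_pos])).trans ?_
    rw [← measure_univ (μ := Measure.pi fun i =>
      runLaw (Uhat P A svd ω) (ytilde P A svd ω i) P.T)]
    exact measure_mono fun ρ _ i => hempty.elim i
  have hs' : (0 : ℝ) < P.s := by exact_mod_cast hs
  have hγ0 : 0 < P.γ := by
    have := Real.rpow_lt_one (by linarith : 0 ≤ 1 - P.δ) (by linarith)
      (by positivity : 0 < 1 / (4 * (P.s : ℝ)))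
    rw [Params.γ]
    linarith
  have hγ1 : P.γ < 1 := by
    have := Real.rpow_pos_of_pos (by linarith : 0 < 1 - P.δ) (1 / (4 * (P.s : ℝ)))
    rw [Params.γ]
    linarith
  have hγr : (1 - P.γ) ^ P.s = 1 - P.δ₁ := by
    rw [hδ₁, Params.γ, sub_sub_cancel, ← Real.rpow_natCast, ← Real.rpow_mul (by linarith)]
    congr 1
    field_simp
  have hT : P.T = trialCount 32 P.k P.γ := by rw [Params.T, h.C_eq]
  have hT0 : 0 < P.T := by
    have hk : (0 : ℝ) < P.k := by linarith [hw.one_le_k]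
    have := Real.log_pos (x := 2 / P.γ) (by rw [lt_div_iff₀ hγ0]; linarith)
    rw [hT, trialCount, Nat.ceil_pos]
    positivity
  calc ENNReal.ofReal (1 - P.δ₁) = ∏ _i : Fin P.s, ENNReal.ofReal (1 - P.γ) := by
        rw [Finset.prod_const, Finset.card_univ, Fintype.card_fin,
          ← ENNReal.ofReal_pow (by linarith), hγr]
    _ ≤ ∏ i : Fin P.s, runLaw (Uhat P A svd ω) (ytilde P A svd ω i) P.T
        {w | runOutput w ≠ none} := Finset.prod_le_prod' fun i _ =>
        hT ▸ ofReal_le_runLaw hUq (hy i) hγ0 hγ1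
    _ = (Measure.pi fun i => runLaw (Uhat P A svd ω) (ytilde P A svd ω i) P.T)
        (Set.univ.pi fun _ => {w | runOutput w ≠ none}) := (Measure.pi_pi _ _).symm
    _ ≤ _ := by
        refine measure_mono fun ρ hρ i => ⟨hρ i trivial, ?_⟩
        rw [O, outputDensity_eq hcol (hy i) hT0 (htv i).1]
        exact (htv i).2

end Admissible

end FAS

theorem mainTheorem3 :
    ∃ c C c₁ c₂ : ℝ, 0 < c ∧ 0 < C ∧ 0 < c₁ ∧ 0 < c₂ ∧
    ∃ orth : ∀ n k : ℕ, Matrix (Fin n) (Fin k) ℝ → Matrix (Fin n) (Fin k) ℝ,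
    ∀ (svd : ∀ p : ℕ, Matrix (Fin p) (Fin p) ℝ → Fin p → Fin p → ℝ),
      (∀ (p : ℕ) (W : Matrix (Fin p) (Fin p) ℝ), FAS.IsLeftSingularBasis W (svd p W)) →
    ∀ (m n k s : ℕ) (A : Matrix (Fin m) (Fin n) ℝ), A ≠ 0 → A.rank = k →
    ∀ (δ ε εV εU ζ : ℝ), 0 < δ → δ < 1 → 0 < ε → ε ≤ 1 →
      0 < εV →
      εV ≤ c * min (ε / (Real.sqrt k * FAS.condNumber A)) (1 / (k * FAS.condNumber A ^ 2)) →
      0 < εU →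
      εU ≤ c * min (ε / k) (1 / (k * FAS.condNumber A ^ 2)) →
      0 < ζ →
      ζ ≤ c * (ε / (k ^ 2 * FAS.condNumber A)) →
    ∀ P : FAS.Params, P = { k := k, s := s, δ := δ, εV := εV, εU := εU, ζ := ζ, C := C } →
      ENNReal.ofReal (1 - δ) ≤ FAS.prob P A svd fun ω ρ =>
        FAS.IsOrthonormalization c₁ c₂ (εV * k / 16) (FAS.Vhat P A svd ω)
          (orth n P.k (FAS.Vhat P A svd ω)) ∧
        Submodule.span ℝ (Set.range (orth n P.k (FAS.Vhat P A svd ω)).col) =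
          Submodule.span ℝ (Set.range A.row) ∧
        ∀ i : Fin P.s,
          FAS.runOutput (ρ i) ≠ none ∧
          FAS.tv (FAS.O P A svd ω i)
            (FAS.l2Density (A *ᵥ (orth n P.k (FAS.Vhat P A svd ω) *ᵥ FAS.xvec P ω i))) ≤ ε := by
  refine ⟨1 / 1000, 32, 1, 3, by norm_num, by norm_num, one_pos, by norm_num, FAS.orthonormalize,
    ?_⟩
  intro svd hsvd m n k s A hA hrank δ ε εV εU ζ hδ hδ1 hε hε1 hεV hεV1 hεU hεU1 hζ hζ1 P hP
  have hw := FAS.wellConditioned_condNumber hA hrank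
  have hkpos : (0 : ℝ) < k := by linarith [hw.one_le_k]
  have hκ0 : 0 < FAS.condNumber A := by linarith [hw.one_le_κ]
  have hclear : ∀ {e x y : ℝ}, 0 < y → e ≤ 1 / 1000 * (x / y) → e * y ≤ x / 1000 := by
    intro e x y hy h
    rw [← mul_div_assoc, le_div_iff₀ hy] at h
    linarith
  have hV1 := hclear (by positivity)
    (hεV1.trans (mul_le_mul_of_nonneg_left (min_le_left _ _) (by norm_num)))
  have hV2 := hclear (by positivity)
    (hεV1.trans (mul_le_mul_of_nonneg_left (min_le_right _ _) (by norm_num)))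
  have hU1 := hclear (by positivity)
    (hεU1.trans (mul_le_mul_of_nonneg_left (min_le_left _ _) (by norm_num)))
  have hU2 := hclear (by positivity)
    (hεU1.trans (mul_le_mul_of_nonneg_left (min_le_right _ _) (by norm_num)))
  have hζ2 := hclear (by positivity) hζ1
  have hadm : FAS.Admissible P A ε := by
    subst hP
    exact ⟨hA, hrank, rfl, hδ, hδ1, hε, hε1, hεV, hεU, hζ, hV1, by linarith, hU1, by linarith, hζ2⟩
  have hPV : P.εV * P.k / 16 = εV * k / 16 := by rw [hP]
  have hPδ : 1 - δ = (1 - P.δ₁) * ((1 - P.δ₁) * (1 - P.δ₁)) * (1 - P.δ₁) := by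
    have h : (1 - P.δ₁) ^ (4 : ℕ) = 1 - δ := by
      rw [FAS.Params.δ₁, sub_sub_cancel, hP, ← Real.rpow_natCast, ← Real.rpow_mul (by linarith)]
      norm_num
    rw [← h]
    ring
  have hroot : 0 ≤ 1 - P.δ₁ := by linarith [hadm.δ₁_lt_one]
  have hruns : ∀ ω ∈ FAS.goodChoices P A svd, ENNReal.ofReal (1 - P.δ₁) ≤
      (Measure.pi fun i => FAS.runLaw (FAS.Uhat P A svd ω) (FAS.ytilde P A svd ω i) P.T)
        {ρ | FAS.IsOrthonormalization 1 3 (εV * k / 16) (FAS.Vhat P A svd ω)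
            (FAS.orthonormalize n P.k (FAS.Vhat P A svd ω)) ∧
          Submodule.span ℝ (Set.range (FAS.orthonormalize n P.k (FAS.Vhat P A svd ω)).col) =
            Submodule.span ℝ (Set.range A.row) ∧
          ∀ i : Fin P.s, FAS.runOutput (ρ i) ≠ none ∧
            FAS.tv (FAS.O P A svd ω i) (FAS.l2Density
              (A *ᵥ (FAS.orthonormalize n P.k (FAS.Vhat P A svd ω) *ᵥ FAS.xvec P ω i))) ≤ ε} := by
    intro ω hω
    have hVh := hadm.isGoodOutput_V hsvd hω.1
    have horth := hadm.isOrthonormalization hVh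
    rw [hPV] at horth
    exact (hadm.le_pi_runLaw hsvd hω).trans
      (measure_mono fun ρ hρ => ⟨horth, horth.span_eq.trans hVh.span_eq, hρ⟩)
  rw [FAS.prob]
  calc ENNReal.ofReal (1 - δ)
      = ENNReal.ofReal (1 - P.δ₁) * (ENNReal.ofReal (1 - P.δ₁) * ENNReal.ofReal (1 - P.δ₁)) *
          ENNReal.ofReal (1 - P.δ₁) := by
        rw [hPδ, ENNReal.ofReal_mul (by positivity), ENNReal.ofReal_mul hroot,
          ENNReal.ofReal_mul hroot]
    _ ≤ FAS.choicesLaw P A (FAS.goodChoices P A svd) * ENNReal.ofReal (1 - P.δ₁) := by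
        gcongr
        exact hadm.le_choicesLaw_goodChoices hsvd
    _ = ∫⁻ _ in FAS.goodChoices P A svd, ENNReal.ofReal (1 - P.δ₁) ∂FAS.choicesLaw P A := by
        rw [setLIntegral_const, mul_comm]
    _ ≤ _ := (setLIntegral_mono' (FAS.measurableSet_goodChoices P A svd) hruns).trans
        (setLIntegral_le_lintegral _ _)
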